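/- Fix an integer $r\ge 1$ and a probability distribution $\mu=(\mu_1,\dots,\mu_r)$ with all $\mu_i>0$. For each $n$ let $K_{1,n},\dots,K_{r,n},P_n$ be nonnegative integers and $\alpha_n\in(0,1)$, with $1\le K_{1,n}\le K_{2,n}\le\dots\le K_{r,n}\le P_n/2$ for all $n\ge 2$, and put $\Theta_n=(K_{1,n},\dots,K_{r,n},P_n,\alpha_n)$. The random graph $\mathbb G(n;\mu,\Theta_n)$ on the nodes $v_1,\dots,v_n$ is defined as follows. The nodes independently receive a class, class $i$ with probability $\mu_i$, and a node of class $i$ independently receives a uniformly random $K_{i,n}$-element subset (its key ring) of a pool of $P_n$ keys. Independently of this, each pair of distinct nodes has a channel that is on with probability $\alpha_n$, independently over pairs. Two distinct nodes are adjacent if and only if their key rings intersect and the channel between them is on. Let $$p_{ij}(n)=1-\binom{P_n-K_{i,n}}{K_{j,n}}\Big/\binom{P_n}{K_{j,n}}\ \text{ if } K_{i,n}+K_{j,n}\le P_n,\qquad p_{ij}(n)=1\ \text{ otherwise},$$ be the probability that the key rings of a class-$i$ node and of a class-$j$ node intersect, and let $\lambda_1(n)=\sum_{j=1}^r\mu_j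 p_{1j}(n)$ and $\Lambda_1(n)=\alpha_n\lambda_1(n)$. Theorem. Assume that, for some $c>0$ and as $n\to\infty$, $\Lambda_1(n)\sim c\,\frac{\log n}{n}$; that, for some $\sigma>0$, $P_n\ge\sigma n$ for all $n\ge1$; and that $p_{11}(n)=\omega\!\left(\frac1{n\alpha_n}\right)$, i.e. $\frac{1}{n\alpha_n}=o(p_{11}(n))$. Then $$\lim_{n\to\infty}\mathbb P[\mathbb G(n;\mu,\Theta_n)\text{ is connected}]=\begin{cases}0&\text{if }c<1,\\ 1&\text{if }c>1,\end{cases}$$ and the probability that $\mathbb G(n;\mu,\Theta_n)$ has no isolated node has the same limits, $0$ if $c<1$ and $1$ if $c>1$. -/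

import Mathlib

open Filter Asymptotics MeasureTheory ProbabilityTheory
open scoped Topology

noncomputable section

namespace HeterogeneousKeyGraph

/-- A scaling of the parameters with `r ≥ 1` classes (class `i` is `i : Fin r`; the class of nodes
with the smallest key rings is `0`): key ring sizes `K n i`, key pool sizes `P n` and channel
probabilities `α n ∈ (0, 1)`, with `1 ≤ K₁ ≤ ⋯ ≤ K_r ≤ P / 2` for all `n ≥ 2`. -/
structure Scaling (r : ℕ) [NeZero r] where
  K : ℕ → Fin r → ℕ
  P : ℕ → ℕ
  α : ℕ → unitInterval
  α_pos : ∀ n, 0 < (α n : ℝ)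
  α_lt_one : ∀ n, (α n : ℝ) < 1
  one_le_K : ∀ n, 2 ≤ n → 1 ≤ K n 0
  K_mono : ∀ n, 2 ≤ n → Monotone (K n)
  K_le : ∀ n, 2 ≤ n → ∀ i, (K n i : ℝ) ≤ (P n : ℝ) / 2

/-- The probability that two independent uniformly random subsets of a pool of `P` keys, of sizes
`k` and `l`, have a key in common. -/
def shareProb (P k l : ℕ) : ℝ :=
  if k + l ≤ P then 1 - ((P - k).choose l : ℝ) / (P.choose l : ℝ) else 1

/-- The law of the pair (class, key ring) of one node: the class is `i` with probability `μ i`,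
and given class `i` the key ring is uniform among the `K i`-element subsets of the key pool. -/
def nodeLaw {r : ℕ} (μ : Fin r → ℝ) (K : Fin r → ℕ) (P : ℕ) :
    Measure (Fin r × Finset (Fin P)) :=
  ∑ i, ENNReal.ofReal (μ i) •
    (Measure.dirac i).prod (uniformOn {S : Finset (Fin P) | S.card = K i})

/-- The sample space: a class and a key ring for each of the `n` nodes, and the graph of the
channels that are on. -/
abbrev Sample (n r P : ℕ) : Type :=
  (Fin n → Fin r × Finset (Fin P)) × SimpleGraph (Fin n)

/-- Nodes are independent with law `nodeLaw`; independently of them, each channel is on with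
probability `α`, independently of all other channels (the Erdős–Rényi graph). -/
def modelMeasure (n : ℕ) {r : ℕ} (μ : Fin r → ℝ) (K : Fin r → ℕ) (P : ℕ) (α : unitInterval) :
    Measure (Sample n r P) :=
  (Measure.pi fun _ : Fin n => nodeLaw μ K P).prod (SimpleGraph.binomialRandom (Fin n) α)

/-- The key graph: distinct nodes are adjacent when their key rings intersect. -/
def keyGraph {n r P : ℕ} (x : Fin n → Fin r × Finset (Fin P)) : SimpleGraph (Fin n) where
  Adj u v := u ≠ v ∧ ((x u).2 ∩ (x v).2).Nonempty
  symm := ⟨fun _ _ h => ⟨h.1.symm, by rw [Finset.inter_comm]; exact h.2⟩⟩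
  loopless := ⟨fun _ h => h.1 rfl⟩

/-- The network: the intersection of the key graph and the graph of the channels. -/
def network {n r P : ℕ} (ω : Sample n r P) : SimpleGraph (Fin n) :=
  keyGraph ω.1 ⊓ ω.2

namespace Scaling

variable {r : ℕ} [NeZero r]

/-- The key sharing probability `p_{ij}(n)` of a class-`i` and a class-`j` node. -/
def p (Θ : Scaling r) (n : ℕ) (i j : Fin r) : ℝ :=
  shareProb (Θ.P n) (Θ.K n i) (Θ.K n j)

/-- The mean key sharing probability `λ_i(n)` of a class-`i` node. -/
def meanShare (Θ : Scaling r) (μ : Fin r → ℝ) (n : ℕ) (i : Fin r) : ℝ :=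
  ∑ j, μ j * Θ.p n i j

/-- The mean edge probability `Λ_i(n) = α_n λ_i(n)` of a class-`i` node. -/
def meanEdge (Θ : Scaling r) (μ : Fin r → ℝ) (n : ℕ) (i : Fin r) : ℝ :=
  (Θ.α n : ℝ) * Θ.meanShare μ n i

/-- The probability that the random network on `n` nodes has the property `A`. -/
def prob (Θ : Scaling r) (μ : Fin r → ℝ) (n : ℕ) (A : SimpleGraph (Fin n) → Prop) : ℝ :=
  (modelMeasure n μ (Θ.K n) (Θ.P n) (Θ.α n)).real {ω | A (network ω)}

end Scaling

end HeterogeneousKeyGraph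

end

noncomputable section

namespace HeterogeneousKeyGraph

/-! Write Λ for the mean edge probability of a node of the first class (index `0`), and call a
node's key ring its ring. Both limits rest on one formula: given the classes and rings of a set S,
the remaining nodes are independent. So S has no edge to a disjoint set T with probability E[(∑ μ_i
· avoid_i)^|T|], where avoid_i is the chance that a class-i node misses every node of S
(`Admissible.real_no_edges`).

For c < 1, apply the second moment method to the isolated nodes of the first class. The expected
number is about n^(1-c), up to the factor μ₁. For two such nodes the only correlation is that a
third node can hit both rings. Given the third ring the two hits are independent, so this costs a
relative error of order nΛ² e^(nΛ), which tends to zero (`Admissible.real_two_isolated_le`).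

For c > 1, a disconnected graph has an isolated cut S with at most n/2 nodes, and cuts are excluded
by a union bound. The difficulty is that overlapping rings in S may cover fewer keys than
independent edges would suggest. Reveal the nodes of S one by one and follow the avoidance
probability of each class. A new ring normally lowers it by almost α p while it is near 1
(`avg_low_drop_le`), and by a constant times α p while it stays above a constant
(`avg_low_drop_le_of_le_avg`). A step fails with a probability that is small when the smallest ring
is large, which `tendsto_smallest_ring` derives from the assumptions on P and p_11. An avoidance
probability that stays high forces many failures, and `sum_steps_le` counts the failure patterns.

Three ranges of |S| need different bounds. Up to n^(31/32), almost full drops give n^(-θ|S|) with θ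
> 1. Up to ηn, the bound must beat the binomial coefficient. Beyond that, it must beat the 4^n pairs
of sets; there only a class j with α p_1j ≥ Λ is used, because other classes may be much harder to
reach. -/

/-- The indicator that two key rings have a key in common. -/
def hit {β : Type*} [DecidableEq β] (S T : Finset β) : ℝ := if (S ∩ T).Nonempty then 1 else 0

/-- The average of `f` over the `k`-element subsets. -/
def avg {β : Type*} [Fintype β] (k : ℕ) (f : Finset β → ℝ) : ℝ :=
  (∑ S ∈ Finset.powersetCard k Finset.univ, f S) / ((Fintype.card β).choose k)

/-- The probability weight of a pair (class, key ring). -/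
def nodeWeight {r : ℕ} (μ : Fin r → ℝ) (K : Fin r → ℕ) (P : ℕ) (a : Fin r × Finset (Fin P)) : ℝ :=
  (nodeLaw μ K P).real {a}

/-! ### The law of the model as finite weighted sums -/

instance {V : Type*} [Finite V] : DiscreteMeasurableSpace (SimpleGraph V) where
  forall_measurableSet s := by
    rw [← SimpleGraph.measurableEmbedding_edgeSet.measurableSet_image]
    exact (Set.toFinite _).measurableSet

/-- The graph is the image of a product Bernoulli measure on edge sets, in which this event is a
cylinder with one factor per edge. -/
theorem binomialRandom_no_edges {V : Type*} [Fintype V] [DecidableEq V] (α : unitInterval)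
    (F : Finset (Sym2 V)) (hF : ∀ e ∈ F, ¬ e.IsDiag) :
    (SimpleGraph.binomialRandom V α).real {G | ∀ e ∈ F, e ∉ G.edgeSet} = (1 - (α : ℝ)) ^ F.card := by
  have h1 : (SimpleGraph.binomialRandom V α) {G | ∀ e ∈ F, e ∉ G.edgeSet}
      = (setBernoulli (Sym2.diagSetᶜ : Set (Sym2 V)) α) {T | ∀ e ∈ F, e ∉ T} := by
    rw [SimpleGraph.binomialRandom_eq_map, Measure.map_apply]
    · congr 1
      ext T
      simp only [Set.mem_preimage, Set.mem_ofPred_eq, SimpleGraph.edgeSet_fromEdgeSet]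
      refine forall₂_congr fun e he => ?_
      have := hF e he
      simp [this]
    · fun_prop
    · exact (Set.toFinite _).measurableSet
  have h2 : (setBernoulli (Sym2.diagSetᶜ : Set (Sym2 V)) α) {T | ∀ e ∈ F, e ∉ T}
      = ∏ e ∈ F, (unitInterval.toNNReal (unitInterval.symm α) : ENNReal) := by
    rw [setBernoulli_apply']
    have : ((fun p : Sym2 V → Prop ↦ {i | p i}) ⁻¹' {T | ∀ e ∈ F, e ∉ T})
        = Set.pi (F : Set (Sym2 V)) (fun _ => {False}) := by
      ext p; simp [Set.pi]
    rw [this, Measure.infinitePi_pi _ (fun _ _ => MeasurableSet.of_discrete)]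
    refine Finset.prod_congr rfl fun e he => ?_
    have := hF e he
    simp [this]
  rw [measureReal_def, h1, h2]
  simp

theorem hit_nonneg {β : Type*} [DecidableEq β] (S T : Finset β) : 0 ≤ hit S T := by
  unfold hit; split <;> simp

theorem hit_le_one {β : Type*} [DecidableEq β] (S T : Finset β) : hit S T ≤ 1 := by
  unfold hit; split <;> simp

theorem hit_comm {β : Type*} [DecidableEq β] (S T : Finset β) : hit S T = hit T S := by
  unfold hit; rw [Finset.inter_comm]

theorem isFiniteMeasure_class {r : ℕ} (μ : Fin r → ℝ) (K : Fin r → ℕ) (P : ℕ) (i : Fin r) :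
    IsFiniteMeasure (ENNReal.ofReal (μ i) •
      (Measure.dirac i).prod (uniformOn {S : Finset (Fin P) | S.card = K i})) := by
  have : IsFiniteMeasure (uniformOn {S : Finset (Fin P) | S.card = K i}) := by
    unfold uniformOn; infer_instance
  exact Measure.smul_finite _ ENNReal.ofReal_ne_top

instance {r : ℕ} {μ : Fin r → ℝ} {K : Fin r → ℕ} {P : ℕ} : IsFiniteMeasure (nodeLaw μ K P) := by
  unfold nodeLaw
  have := isFiniteMeasure_class μ K P
  infer_instance

/-- This is the passage from measures to counting: expectations over one node become mixtures of
averages over fixed-size subsets. -/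
theorem sum_nodeWeight_mul {r : ℕ} {μ : Fin r → ℝ} (hμ : ∀ i, 0 ≤ μ i) {K : Fin r → ℕ} {P : ℕ}
    (f : Fin r × Finset (Fin P) → ℝ) :
    ∑ a, nodeWeight μ K P a * f a = ∑ i, μ i * avg (K i) (fun S => f (i, S)) := by
  have hw : ∀ i S, nodeWeight μ K P (i, S)
      = μ i * (if S.card = K i then 1 / ((P.choose (K i) : ℕ) : ℝ) else 0) := by
    intro i S
    unfold nodeWeight nodeLaw
    rw [measureReal_def, Measure.finsetSum_apply, ENNReal.toReal_sum]
    · rw [Finset.sum_eq_single i]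
      · rw [← Set.singleton_prod_singleton, Measure.smul_apply, Measure.prod_prod]
        simp only [smul_eq_mul, ENNReal.toReal_mul, ENNReal.toReal_ofReal (hμ i)]
        congr 1
        have h2 := uniformOn_apply_finset (s := Finset.powersetCard (K i) (Finset.univ : Finset (Fin P))) (t := {S})
        have h3 : ((Finset.powersetCard (K i) (Finset.univ : Finset (Fin P)) : Finset (Finset (Fin P))) :
            Set (Finset (Fin P))) = {S : Finset (Fin P) | S.card = K i} := by
          ext; simp
        rw [h3, Finset.coe_singleton] at h2
        rw [h2]
        split_ifs with h
        · have : Finset.powersetCard (K i) (Finset.univ : Finset (Fin P)) ∩ {S} = {S} := by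
            simp [h]
          rw [this]
          simp
        · have : Finset.powersetCard (K i) (Finset.univ : Finset (Fin P)) ∩ {S} = ∅ := by
            simp [h]
          rw [this]
          simp
      · intro j _ hj
        rw [← Set.singleton_prod_singleton, Measure.smul_apply, Measure.prod_prod]
        simp [hj]
      · simp
    · intro j _
      have := isFiniteMeasure_class μ K P j
      exact measure_ne_top _ _
  rw [Fintype.sum_prod_type]
  refine Finset.sum_congr rfl fun i _ => ?_
  unfold avg
  rw [Fintype.card_fin, mul_div_assoc', Finset.mul_sum, Finset.sum_div]
  rw [← Finset.sum_subset (Finset.subset_univ (Finset.powersetCard (K i) Finset.univ))]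
  · refine Finset.sum_congr rfl fun S hS => ?_
    rw [hw, if_pos (Finset.mem_powersetCard_univ.1 hS)]
    ring
  · intro S _ hS
    rw [hw, if_neg (by simpa using hS)]
    simp

theorem nodeWeight_nonneg {r : ℕ} (μ : Fin r → ℝ) (K : Fin r → ℕ) (P : ℕ)
    (a : Fin r × Finset (Fin P)) : 0 ≤ nodeWeight μ K P a := measureReal_nonneg

/-- Disjointness rules out the swapped pair, so pairs and unordered edges have the same count. -/
theorem pair_edge_injOn {V : Type*} [DecidableEq V] {S T : Finset V} (h : Disjoint S T) :
    Set.InjOn (fun p : V × V => s(p.1, p.2)) ((S ×ˢ T : Finset (V × V)) : Set (V × V)) := by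
  rintro ⟨a, b⟩ hab ⟨c, d⟩ hcd he
  simp only [Finset.coe_product, Set.mem_prod, Finset.mem_coe] at hab hcd
  rcases Sym2.eq_iff.1 he with ⟨h1, h2⟩ | ⟨h1, h2⟩
  · exact Prod.ext h1 h2
  · exact absurd hcd.2 (Finset.disjoint_left.1 h ((show a = d from h1) ▸ hab.1))

/-- Only pairs with intersecting rings need their channel off. Each contributes a factor 1 - α, and
all other pairs contribute 1. -/
theorem binomialRandom_no_key_edges {n r P : ℕ} (α : unitInterval)
    (x : Fin n → Fin r × Finset (Fin P)) {S T : Finset (Fin n)} (h : Disjoint S T) :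
    (SimpleGraph.binomialRandom (Fin n) α).real
        {G | ∀ u ∈ S, ∀ v ∈ T, ¬ (keyGraph x ⊓ G).Adj u v}
      = ∏ u ∈ S, ∏ v ∈ T, (1 - (α : ℝ) * hit (x u).2 (x v).2) := by
  classical
  set E := (S ×ˢ T).filter (fun p => ((x p.1).2 ∩ (x p.2).2).Nonempty)
  have hne : ∀ p ∈ S ×ˢ T, p.1 ≠ p.2 := by
    intro p hp
    rw [Finset.mem_product] at hp
    exact fun h' => Finset.disjoint_left.1 h hp.1 (h' ▸ hp.2)
  have h1 : {G : SimpleGraph (Fin n) | ∀ u ∈ S, ∀ v ∈ T, ¬ (keyGraph x ⊓ G).Adj u v}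
      = {G | ∀ e ∈ E.image (fun p : Fin n × Fin n => s(p.1, p.2)), e ∉ G.edgeSet} := by
    ext G
    simp only [Set.mem_ofPred_eq, Finset.mem_image, forall_exists_index, and_imp, Prod.forall]
    constructor
    · rintro hG _ u v huv rfl
      have := (Finset.mem_filter.1 huv)
      have h2 := Finset.mem_product.1 this.1
      have h3 := hG u h2.1 v h2.2
      intro h4
      exact h3 ⟨⟨hne _ this.1, this.2⟩, h4⟩
    · intro hG u hu v hv hadj
      exact hG _ u v (Finset.mem_filter.2 ⟨Finset.mem_product.2 ⟨hu, hv⟩, hadj.1.2⟩) rfl hadj.2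
  rw [h1, binomialRandom_no_edges, Finset.card_image_of_injOn, ← Finset.prod_product',
    Finset.card_filter, ← Finset.prod_pow_eq_pow_sum]
  · refine Finset.prod_congr rfl fun p _ => ?_
    unfold hit
    split_ifs <;> simp
  · exact (pair_edge_injOn h).mono (Finset.coe_subset.2 (Finset.filter_subset _ _))
  · simp only [Finset.mem_image, forall_exists_index, and_imp]
    rintro _ p hp rfl
    simpa using hne p (Finset.mem_filter.1 hp).1

theorem modelMeasure_real {n r P : ℕ} {μ : Fin r → ℝ} {K : Fin r → ℕ} {α : unitInterval}
    (E : Set (Sample n r P)) :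
    (modelMeasure n μ K P α).real E = ∑ x : Fin n → Fin r × Finset (Fin P),
      (∏ v, nodeWeight μ K P (x v)) *
        (SimpleGraph.binomialRandom (Fin n) α).real {G | (x, G) ∈ E} := by
  unfold modelMeasure
  rw [measureReal_def, Measure.prod_apply (Set.toFinite _).measurableSet, lintegral_fintype,
    ENNReal.toReal_sum]
  · refine Finset.sum_congr rfl fun x _ => ?_
    rw [ENNReal.toReal_mul, mul_comm, Measure.pi_singleton, ENNReal.toReal_prod]
    rfl
  · intro x _
    exact ENNReal.mul_ne_top (measure_ne_top _ _) (measure_ne_top _ _)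

/-- The joint probability of an event on the nodes and of the absence of edges between two
disjoint sets of nodes. -/
theorem modelMeasure_no_edges {n r P : ℕ} {μ : Fin r → ℝ} {K : Fin r → ℕ} {α : unitInterval}
    (Φ : (Fin n → Fin r × Finset (Fin P)) → Prop) [DecidablePred Φ] {S T : Finset (Fin n)}
    (h : Disjoint S T) :
    (modelMeasure n μ K P α).real
        {ω | Φ ω.1 ∧ ∀ u ∈ S, ∀ v ∈ T, ¬ (network ω).Adj u v}
      = ∑ x : Fin n → Fin r × Finset (Fin P), (∏ v, nodeWeight μ K P (x v)) *
        (if Φ x then ∏ u ∈ S, ∏ v ∈ T, (1 - (α : ℝ) * hit (x u).2 (x v).2) else 0) := by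
  rw [modelMeasure_real]
  refine Finset.sum_congr rfl fun x _ => ?_
  congr 1
  split_ifs with hx
  · rw [← binomialRandom_no_key_edges α x h]
    congr 1
    ext G
    simp [hx, network]
  · simp [hx]

theorem sum_prod_weight {ι A : Type*} [Fintype ι] [DecidableEq ι] [Fintype A] (w : A → ℝ)
    (f : ι → A → ℝ) :
    ∑ x : ι → A, (∏ v, w (x v)) * ∏ v, f v (x v) = ∏ v, ∑ a, w a * f v a := by
  rw [Finset.prod_univ_sum]
  simp [Finset.prod_mul_distrib]

/-- Averaging over the nodes outside `S` first. -/
theorem sum_split {n : ℕ} {A : Type*} [Fintype A] {w : A → ℝ} (hw : ∑ a, w a = 1)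
    {S T : Finset (Fin n)} (h : Disjoint S T) (Ψ : (S → A) → ℝ) (F : (S → A) → A → ℝ) :
    ∑ x : Fin n → A, (∏ v, w (x v)) *
        (Ψ (fun u => x u) * ∏ v ∈ T, F (fun u => x u) (x v))
      = ∑ y : S → A, (∏ u, w (y u)) * (Ψ y * (∑ a, w a * F y a) ^ T.card) := by
  classical
  rw [← (Equiv.piEquivPiSubtypeProd (fun v => v ∈ S) (fun _ => A)).symm.sum_comp,
    Fintype.sum_prod_type]
  refine Finset.sum_congr rfl fun y _ => ?_
  have hy : ∀ z : ({v // v ∉ S} → A), (fun u : S => (Equiv.piEquivPiSubtypeProd (fun v => v ∈ S)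
      (fun _ => A)).symm (y, z) u) = y := by
    intro z; ext u; simp
  have hz : ∀ (z : ({v // v ∉ S} → A)) (v : {v // v ∉ S}), (Equiv.piEquivPiSubtypeProd
      (fun v => v ∈ S) (fun _ => A)).symm (y, z) v = z v := by
    intro z v; simp [v.2]
  have hsplit : ∀ z : ({v // v ∉ S} → A),
      (∏ v, w ((Equiv.piEquivPiSubtypeProd (fun v => v ∈ S) (fun _ => A)).symm (y, z) v))
        = (∏ u, w (y u)) * ∏ v, w (z v) := by
    intro z
    rw [← Fintype.prod_subtype_mul_prod_subtype (fun v => v ∈ S)]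
    congr 1
    · exact Finset.prod_congr (by ext; simp) fun u _ => by rw [← congrFun (hy z) u]
    · exact Finset.prod_congr rfl fun u _ => by rw [hz]
  have hT : ∀ z : ({v // v ∉ S} → A),
      ∏ v ∈ T, F y ((Equiv.piEquivPiSubtypeProd (fun v => v ∈ S) (fun _ => A)).symm (y, z) v)
        = ∏ v : {v // v ∉ S}, (if (v : Fin n) ∈ T then F y (z v) else 1) := by
    intro z
    rw [← Finset.prod_filter_mul_prod_filter_not T (fun v => v ∈ S)]
    have : T.filter (fun v => v ∈ S) = ∅ := by
      ext v; simp only [Finset.mem_filter, Finset.notMem_empty, iff_false, not_and]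
      exact fun h1 h2 => Finset.disjoint_left.1 h h2 h1
    rw [this, Finset.prod_empty, one_mul]
    calc _ = ∏ v ∈ Finset.univ.filter (fun v => v ∉ S), (if v ∈ T then F y ((Equiv.piEquivPiSubtypeProd (fun v => v ∈ S)
      (fun _ => A)).symm (y, z) v) else 1) := by
          rw [Finset.prod_ite_mem, Finset.filter_inter, Finset.univ_inter]
      _ = _ := by
          rw [Finset.prod_subtype (p := fun v => v ∉ S) _ (by simp)]
          exact Finset.prod_congr rfl fun v _ => by rw [hz]
  have hcard : ∏ v : {v // v ∉ S}, (∑ a, w a * (if (v : Fin n) ∈ T then F y a else 1))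
      = (∑ a, w a * F y a) ^ T.card := by
    have : ∀ v : {v // v ∉ S}, (∑ a, w a * (if (v : Fin n) ∈ T then F y a else 1))
        = (fun v : Fin n => if v ∈ T then ∑ a, w a * F y a else 1) v := by
      intro v; dsimp only; split_ifs <;> simp [hw]
    rw [Finset.prod_congr rfl fun v _ => this v,
      ← Finset.prod_subtype (p := fun v => v ∉ S) (Finset.univ.filter (fun v => v ∉ S)) (by simp)
        (fun v : Fin n => if v ∈ T then ∑ a, w a * F y a else 1),
      Finset.prod_ite_mem, Finset.prod_const]
    congr 2
    ext v
    simp only [Finset.mem_inter, Finset.mem_filter, Finset.mem_univ, true_and, and_iff_right_iff_imp]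
    exact fun h1 h2 => Finset.disjoint_left.1 h h2 h1
  calc _ = ∑ z : ({v // v ∉ S} → A), ((∏ u, w (y u)) * Ψ y) * ((∏ v, w (z v)) *
        ∏ v : {v // v ∉ S}, (if (v : Fin n) ∈ T then F y (z v) else 1)) := by
        refine Finset.sum_congr rfl fun z _ => ?_
        rw [hsplit, hy, hT]; ring
    _ = _ := by
        rw [← Finset.mul_sum, sum_prod_weight w
          (fun (v : {v // v ∉ S}) a => if (v : Fin n) ∈ T then F y a else 1), hcard]
        ring

/-! ### Averages over the subsets of a given size -/

theorem hit_le_card_inter {β : Type*} [DecidableEq β] (S T : Finset β) : hit S T ≤ (S ∩ T).card := by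
  unfold hit
  split_ifs with h
  · exact_mod_cast Finset.card_pos.2 h
  · positivity

/-- Expand (1 - tN)² ≥ 0 with N the size of the intersection. The free t is optimized later, which
turns second moments into lower bounds for hitting probabilities. -/
theorem le_hit {β : Type*} [DecidableEq β] (S T : Finset β) (t : ℝ) :
    2 * t * (S ∩ T).card - t ^ 2 * ((S ∩ T).card : ℝ) ^ 2 ≤ hit S T := by
  unfold hit
  split_ifs with h
  · nlinarith [sq_nonneg (1 - t * (S ∩ T).card)]
  · rw [Finset.not_nonempty_iff_eq_empty.1 h]; simp

/-- Factor by factor, (k - i)/(n - i) ≤ k/n. Probabilistically, sampling without replacement is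
negatively dependent. -/
theorem choose_mul_pow_le {k n : ℕ} (hk : k ≤ n) (a : ℕ) :
    (k.choose a : ℝ) * (n : ℝ) ^ a ≤ n.choose a * (k : ℝ) ^ a := by
  induction a with
  | zero => simp
  | succ a ih =>
    rcases lt_or_ge k (a + 1) with h | h
    · rw [Nat.choose_eq_zero_of_lt h]
      simp only [Nat.cast_zero, zero_mul]
      positivity
    have h1 : (k.choose (a + 1) : ℝ) * (a + 1) = k.choose a * ((k : ℝ) - a) := by
      have := Nat.choose_succ_right_eq k a
      rw [← Nat.cast_sub (by omega)]
      exact_mod_cast this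
    have h2 : (n.choose (a + 1) : ℝ) * (a + 1) = n.choose a * ((n : ℝ) - a) := by
      have := Nat.choose_succ_right_eq n a
      rw [← Nat.cast_sub (by omega)]
      exact_mod_cast this
    have hkn : (k : ℝ) ≤ n := by exact_mod_cast hk
    have hak : (a : ℝ) + 1 ≤ k := by exact_mod_cast h
    have h3 : ((k : ℝ) - a) * n ≤ (n - a) * k := by nlinarith [(Nat.cast_nonneg a : (0 : ℝ) ≤ a)]
    have h4 : ((k.choose (a + 1) : ℝ) * (n : ℝ) ^ (a + 1)) * (a + 1)
        ≤ (n.choose (a + 1) * (k : ℝ) ^ (a + 1)) * (a + 1) := by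
      calc ((k.choose (a + 1) : ℝ) * (n : ℝ) ^ (a + 1)) * (a + 1)
          = (k.choose a * (n : ℝ) ^ a) * (((k : ℝ) - a) * n) := by
            rw [pow_succ]; linear_combination (n : ℝ) ^ a * n * h1
        _ ≤ (n.choose a * (k : ℝ) ^ a) * ((n - a) * k) := by
            apply mul_le_mul ih h3
            · exact mul_nonneg (by linarith) (Nat.cast_nonneg _)
            · positivity
        _ = _ := by
            rw [pow_succ]; linear_combination -(k : ℝ) ^ a * k * h2
    exact le_of_mul_le_mul_right h4 (by positivity)

section Average

variable {β : Type*} [Fintype β]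

theorem choose_card_pos {k : ℕ} (hk : k ≤ Fintype.card β) :
    (0 : ℝ) < ((Fintype.card β).choose k : ℕ) := by
  exact_mod_cast Nat.choose_pos hk

theorem avg_mono {k : ℕ} {f g : Finset β → ℝ} (h : ∀ S, S.card = k → f S ≤ g S) :
    avg k f ≤ avg k g := by
  unfold avg
  gcongr with S hS
  exact h S (Finset.mem_powersetCard_univ.1 hS)

theorem avg_congr {k : ℕ} {f g : Finset β → ℝ} (h : ∀ S, S.card = k → f S = g S) :
    avg k f = avg k g :=
  le_antisymm (avg_mono fun S hS => (h S hS).le) (avg_mono fun S hS => (h S hS).ge)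

theorem avg_const {k : ℕ} (hk : k ≤ Fintype.card β) (c : ℝ) :
    avg k (fun _ : Finset β => c) = c := by
  have := choose_card_pos hk
  unfold avg
  rw [Finset.sum_const, Finset.card_powersetCard, Finset.card_univ, nsmul_eq_mul]
  field_simp

theorem avg_add (k : ℕ) (f g : Finset β → ℝ) :
    avg k (fun S => f S + g S) = avg k f + avg k g := by
  unfold avg
  rw [Finset.sum_add_distrib, add_div]

theorem avg_sub (k : ℕ) (f g : Finset β → ℝ) :
    avg k (fun S => f S - g S) = avg k f - avg k g := by
  unfold avg
  rw [Finset.sum_sub_distrib, sub_div]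

theorem avg_const_mul (k : ℕ) (c : ℝ) (f : Finset β → ℝ) :
    avg k (fun S => c * f S) = c * avg k f := by
  unfold avg
  rw [← Finset.mul_sum, mul_div_assoc]

theorem avg_mul_const (k : ℕ) (c : ℝ) (f : Finset β → ℝ) :
    avg k (fun S => f S * c) = avg k f * c := by
  rw [mul_comm, ← avg_const_mul]
  simp_rw [mul_comm]

theorem avg_sum {ι : Type*} (k : ℕ) (s : Finset ι) (f : ι → Finset β → ℝ) :
    avg k (fun S => ∑ i ∈ s, f i S) = ∑ i ∈ s, avg k (f i) := by
  unfold avg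
  rw [Finset.sum_comm, Finset.sum_div]

theorem avg_nonneg {k : ℕ} {f : Finset β → ℝ} (h : ∀ S, 0 ≤ f S) : 0 ≤ avg k f :=
  div_nonneg (Finset.sum_nonneg fun S _ => h S) (Nat.cast_nonneg _)

theorem avg_le_one {k : ℕ} (hk : k ≤ Fintype.card β) {f : Finset β → ℝ} (h : ∀ S, f S ≤ 1) :
    avg k f ≤ 1 :=
  (avg_mono fun S _ => h S).trans_eq (avg_const hk 1)

theorem avg_comm {γ : Type*} [Fintype γ] (k l : ℕ) (f : Finset β → Finset γ → ℝ) :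
    avg k (fun S => avg l (fun T => f S T)) = avg l (fun T => avg k (fun S => f S T)) := by
  simp only [avg]
  rw [← Finset.sum_div, Finset.sum_comm, div_right_comm, ← Finset.sum_div]

/-- Markov's inequality for averages. -/
theorem avg_indicator_le {k : ℕ} {f : Finset β → ℝ} (hf : ∀ S, 0 ≤ f S) {c : ℝ} (hc : 0 < c)
    (bad : Finset β → Prop) [DecidablePred bad] (h : ∀ S, S.card = k → bad S → c ≤ f S) :
    avg k (fun S => if bad S then (1 : ℝ) else 0) ≤ avg k f / c := by
  rw [le_div_iff₀ hc, ← avg_mul_const]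
  refine avg_mono fun S hS => ?_
  split_ifs with hb
  · simpa using h S hS hb
  · simpa using hf S

variable [DecidableEq β]

theorem card_filter_superset (k : ℕ) (A : Finset β) (hA : A.card ≤ k) :
    ((Finset.powersetCard k (Finset.univ : Finset β)).filter (fun S => A ⊆ S)).card
      = (Fintype.card β - A.card).choose (k - A.card) := by
  rw [← Finset.card_compl, ← Finset.card_powersetCard]
  refine Finset.card_nbij' (fun S => S \ A) (fun S => S ∪ A) ?_ ?_ ?_ ?_
  · intro S hS
    simp only [Finset.coe_filter, Finset.mem_powersetCard_univ, Set.mem_ofPred_eq] at hS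
    simp only [Finset.mem_coe, Finset.mem_powersetCard]
    refine ⟨fun a ha => by simp at ha ⊢; exact ha.2, ?_⟩
    rw [Finset.card_sdiff_of_subset hS.2, hS.1]
  · intro S hS
    simp only [Finset.mem_coe, Finset.mem_powersetCard] at hS
    simp only [Finset.coe_filter, Finset.mem_powersetCard_univ, Set.mem_ofPred_eq]
    refine ⟨?_, Finset.subset_union_right⟩
    rw [Finset.card_union_of_disjoint, hS.2]
    · omega
    · rw [← Finset.subset_compl_iff_disjoint_right]; exact hS.1
  · intro S hS
    simp only [Finset.coe_filter, Finset.mem_powersetCard_univ, Set.mem_ofPred_eq] at hS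
    exact Finset.sdiff_union_of_subset hS.2
  · intro S hS
    simp only [Finset.mem_coe, Finset.mem_powersetCard] at hS
    dsimp only
    rw [Finset.union_sdiff_right]
    exact Finset.sdiff_eq_self_of_disjoint (Finset.subset_compl_iff_disjoint_right.1 hS.1)

theorem avg_superset {k : ℕ} (hk : k ≤ Fintype.card β) (A : Finset β) :
    avg k (fun S => if A ⊆ S then (1 : ℝ) else 0)
      = k.choose A.card / (Fintype.card β).choose A.card := by
  have hp := choose_card_pos hk
  unfold avg
  rw [← Finset.sum_filter, Finset.sum_const, nsmul_eq_mul, mul_one]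
  rcases lt_or_ge k A.card with h | h
  · rw [Nat.choose_eq_zero_of_lt h]
    simp only [Nat.cast_zero, zero_div, div_eq_zero_iff, Nat.cast_eq_zero, Finset.card_eq_zero]
    left
    rw [Finset.filter_eq_empty_iff]
    intro S hS hAS
    have := Finset.card_le_card hAS
    rw [Finset.mem_powersetCard_univ.1 hS] at this
    omega
  · rw [card_filter_superset k A h]
    have hA : (0 : ℝ) < ((Fintype.card β).choose A.card : ℕ) := choose_card_pos (h.trans hk)
    rw [div_eq_div_iff hp.ne' hA.ne']
    have := Nat.choose_mul (n := Fintype.card β) (k := k) (s := A.card) h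
    rw [mul_comm, mul_comm (k.choose A.card : ℝ)]
    exact_mod_cast this.symm

theorem avg_superset_le {k : ℕ} (hk : k ≤ Fintype.card β) (A : Finset β) :
    avg k (fun S => if A ⊆ S then (1 : ℝ) else 0) ≤ ((k : ℝ) / Fintype.card β) ^ A.card := by
  have hA : (0 : ℝ) < ((Fintype.card β).choose A.card : ℕ) := choose_card_pos A.card_le_univ
  rw [avg_superset hk, div_pow]
  rcases Nat.eq_zero_or_pos (Fintype.card β) with h | h
  · have : A.card = 0 := by have := A.card_le_univ; omega
    simp [this]
  · rw [div_le_div_iff₀ hA (by positivity), mul_comm ((k : ℝ) ^ _)]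
    exact choose_mul_pow_le hk _

theorem avg_mem {k : ℕ} (hk : k ≤ Fintype.card β) (b : β) :
    avg k (fun S => if b ∈ S then (1 : ℝ) else 0) = (k : ℝ) / Fintype.card β := by
  have := avg_superset hk {b}
  simpa using this

theorem sum_mem_eq (w : β → ℝ) (T : Finset β) :
    ∑ b ∈ T, w b = ∑ b, w b * (if b ∈ T then 1 else 0) := by
  simp

theorem avg_sum_mem {k : ℕ} (hk : k ≤ Fintype.card β) (w : β → ℝ) :
    avg k (fun T => ∑ b ∈ T, w b) = (k : ℝ) / Fintype.card β * ∑ b, w b := by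
  rw [avg_congr fun T _ => sum_mem_eq w T]
  simp_rw [avg_sum, avg_const_mul, avg_mem hk]
  rw [← Finset.sum_mul, mul_comm]

/-- Two distinct keys lie together in a random set with probability at most t², as if they were
chosen independently. The diagonal contributes t, and the surplus t² there does no harm. -/
theorem avg_sq_sum_mem_le {k : ℕ} (hk : k ≤ Fintype.card β) {w : β → ℝ} (hw : ∀ b, 0 ≤ w b) :
    avg k (fun T => (∑ b ∈ T, w b) ^ 2) ≤ (k : ℝ) / Fintype.card β * ∑ b, w b ^ 2
      + ((k : ℝ) / Fintype.card β) ^ 2 * (∑ b, w b) ^ 2 := by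
  set t := (k : ℝ) / Fintype.card β
  have ht : 0 ≤ t := by positivity
  have h1 : ∀ T : Finset β, (∑ b ∈ T, w b) ^ 2
      = ∑ b, ∑ c, (w b * w c) * (if ({b, c} : Finset β) ⊆ T then 1 else 0) := by
    intro T
    rw [sum_mem_eq, sq, Finset.sum_mul_sum]
    refine Finset.sum_congr rfl fun b _ => Finset.sum_congr rfl fun c _ => ?_
    by_cases hb : b ∈ T <;> by_cases hc : c ∈ T <;> simp [hb, hc, Finset.insert_subset_iff]
  have h2 : ∀ b c : β, avg k (fun T => if ({b, c} : Finset β) ⊆ T then (1 : ℝ) else 0)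
      ≤ (if b = c then t else 0) + t ^ 2 := by
    intro b c
    refine (avg_superset_le hk _).trans ?_
    split_ifs with h
    · subst h
      simp only [Finset.pair_eq_singleton, Finset.card_singleton, pow_one]
      nlinarith [sq_nonneg t]
    · rw [Finset.card_pair h, zero_add]
  rw [avg_congr fun T _ => h1 T]
  simp_rw [avg_sum, avg_const_mul]
  calc _ ≤ ∑ b, ∑ c, (w b * w c) * ((if b = c then t else 0) + t ^ 2) := by
        gcongr with b _ c _
        · exact mul_nonneg (hw b) (hw c)
        · exact h2 b c
    _ = _ := by
        simp_rw [mul_add, Finset.sum_add_distrib, ← Finset.sum_mul, ← Finset.sum_mul_sum]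
        simp only [mul_ite, mul_zero, Finset.sum_ite_eq, Finset.mem_univ, if_true]
        rw [← Finset.sum_mul]
        simp_rw [sq]
        ring

theorem avg_card_inter {k : ℕ} (hk : k ≤ Fintype.card β) (T : Finset β) :
    avg k (fun S => ((T ∩ S).card : ℝ)) = (T.card * k : ℝ) / Fintype.card β := by
  have h : ∀ S : Finset β, ((T ∩ S).card : ℝ) = ∑ b ∈ S, (if b ∈ T then (1 : ℝ) else 0) := by
    intro S
    simp [Finset.inter_comm]
  simp_rw [h]
  rw [avg_sum_mem hk]
  simp
  ring

theorem avg_sq_card_inter_le {k : ℕ} (hk : k ≤ Fintype.card β) (T : Finset β) :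
    avg k (fun S => ((T ∩ S).card : ℝ) ^ 2)
      ≤ (T.card * k : ℝ) / Fintype.card β + ((T.card * k : ℝ) / Fintype.card β) ^ 2 := by
  have h : ∀ S : Finset β, ((T ∩ S).card : ℝ) = ∑ b ∈ S, (if b ∈ T then (1 : ℝ) else 0) := by
    intro S
    simp [Finset.inter_comm]
  simp_rw [h]
  refine (avg_sq_sum_mem_le hk (fun b => by split_ifs <;> simp)).trans_eq ?_
  simp
  ring

theorem avg_hit {k : ℕ} (T : Finset β) (h : T.card + k ≤ Fintype.card β) :
    avg k (hit T) = shareProb (Fintype.card β) T.card k := by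
  have hk : k ≤ Fintype.card β := by omega
  have h1 : ∀ S, hit T S = 1 - (if S ⊆ Tᶜ then 1 else 0) := by
    intro S
    have h2 : S ⊆ Tᶜ ↔ ¬ (T ∩ S).Nonempty := by
      rw [Finset.subset_compl_iff_disjoint_right, Finset.disjoint_iff_inter_eq_empty,
        Finset.inter_comm S T, Finset.not_nonempty_iff_eq_empty]
    unfold hit
    by_cases h3 : (T ∩ S).Nonempty
    · rw [if_pos h3, if_neg (by rw [h2]; exact not_not.2 h3)]; simp
    · rw [if_neg h3, if_pos (h2.2 h3)]; simp
  rw [shareProb, if_pos h, show hit T = fun S => 1 - (if S ⊆ Tᶜ then (1 : ℝ) else 0) from funext h1,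
    avg_sub, avg_const hk]
  congr 1
  unfold avg
  rw [← Finset.sum_filter, Finset.sum_const, nsmul_eq_mul, mul_one]
  congr 2
  rw [← Finset.card_compl, ← Finset.card_powersetCard]
  congr 1
  ext S
  simp [Finset.mem_powersetCard, and_comm]

theorem avg_hit_le (T : Finset β) {k : ℕ} (hk : k ≤ Fintype.card β) :
    avg k (hit T) ≤ (T.card * k : ℝ) / Fintype.card β := by
  rw [← avg_card_inter hk]
  exact avg_mono fun S _ => hit_le_card_inter T S

/-- The intersection size has mean z and second moment at most z + z². The choice t = 1/(1 + z)
maximizes the resulting bound 2tz - t²(z + z²). -/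
theorem le_avg_hit (T : Finset β) {k : ℕ} (hk : k ≤ Fintype.card β) {z : ℝ}
    (hz : (T.card * k : ℝ) / Fintype.card β = z) : z / (1 + z) ≤ avg k (hit T) := by
  have hz0 : 0 ≤ z := by rw [← hz]; positivity
  have h := avg_mono (k := k) (fun S _ => le_hit T S (1 / (1 + z)))
  rw [avg_sub, avg_const_mul, avg_const_mul, avg_card_inter hk, hz] at h
  have h2 := avg_sq_card_inter_le hk T
  rw [hz] at h2
  refine le_trans ?_ h
  have h3 : (1 / (1 + z)) ^ 2 * avg k (fun S => ((T ∩ S).card : ℝ) ^ 2)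
      ≤ (1 / (1 + z)) ^ 2 * (z + z ^ 2) := by gcongr
  have h4 : z / (1 + z) = 2 * (1 / (1 + z)) * z - (1 / (1 + z)) ^ 2 * (z + z ^ 2) := by
    field_simp; ring
  linarith

/-- A family of bad sets which contains the subsets of its members is rarer among larger sets. -/
theorem avg_down_closed_le (bad : Finset β → Prop) [DecidablePred bad]
    (hbad : ∀ S T, S ⊆ T → bad T → bad S) {k l : ℕ} (hkl : k ≤ l) :
    avg l (fun S => if bad S then (1 : ℝ) else 0) ≤ avg k (fun S => if bad S then (1 : ℝ) else 0) := by
  induction l, hkl using Nat.le_induction with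
  | base => exact le_rfl
  | succ l _ ih =>
    refine le_trans ?_ ih
    unfold avg
    rw [← Finset.sum_filter, Finset.sum_const, nsmul_eq_mul, mul_one,
      ← Finset.sum_filter, Finset.sum_const, nsmul_eq_mul, mul_one]
    -- By local LYM, passing to the shadow does not lower the density. Since badness is inherited by
    -- subsets, the shadow of the bad sets consists of bad sets.
    have h := Finset.local_lubell_yamamoto_meshalkin_inequality_div (𝕜 := ℝ) (r := l + 1)
      (𝒜 := (Finset.powersetCard (l + 1) (Finset.univ : Finset β)).filter bad) (by simp)
      (by intro S hS; simpa using (Finset.mem_filter.1 hS).1)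
    refine h.trans ?_
    rw [Nat.add_sub_cancel]
    gcongr
    intro S hS
    obtain ⟨T, hT, b, hb, rfl⟩ := Finset.mem_shadow_iff.1 hS
    rw [Finset.mem_filter, Finset.mem_powersetCard_univ] at hT ⊢
    exact ⟨by rw [Finset.card_erase_of_mem hb, hT.1]; rfl, hbad _ _ (Finset.erase_subset _ _) hT.2⟩

/-- Union bound over the `a`-subsets of `B` that the random set could contain. -/
theorem avg_large_inter_le {k : ℕ} (hk : k ≤ Fintype.card β) (B : Finset β) (a : ℕ) :
    avg k (fun T => if a ≤ (T ∩ B).card then (1 : ℝ) else 0)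
      ≤ B.card.choose a * ((k : ℝ) / Fintype.card β) ^ a := by
  have h1 : ∀ T : Finset β, (if a ≤ (T ∩ B).card then (1 : ℝ) else 0)
      ≤ ∑ A ∈ Finset.powersetCard a B, if A ⊆ T then (1 : ℝ) else 0 := by
    intro T
    split_ifs with h
    · obtain ⟨A, hA, hc⟩ := Finset.exists_subset_card_eq h
      have hm : A ∈ Finset.powersetCard a B :=
        Finset.mem_powersetCard.2 ⟨hA.trans Finset.inter_subset_right, hc⟩
      have := Finset.single_le_sum (f := fun A => if A ⊆ T then (1 : ℝ) else 0)
        (fun A _ => by split_ifs <;> simp) hm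
      simpa [hA.trans Finset.inter_subset_left] using this
    · exact Finset.sum_nonneg fun A _ => by split_ifs <;> simp
  refine (avg_mono fun T _ => h1 T).trans ?_
  rw [avg_sum]
  calc _ ≤ ∑ A ∈ Finset.powersetCard a B, ((k : ℝ) / Fintype.card β) ^ a := by
        refine Finset.sum_le_sum fun A hA => ?_
        rw [← (Finset.mem_powersetCard.1 hA).2]
        exact avg_superset_le hk A
    _ = _ := by rw [Finset.sum_const, Finset.card_powersetCard, nsmul_eq_mul]

/-- Combines the union bound with a! ≥ (a/e)^a and e < 3, so the ring size cancels and only the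
density `b` of `B` remains. -/
theorem avg_large_inter_le_pow {k : ℕ} (hk : k ≤ Fintype.card β) (B : Finset β) {a q : ℕ}
    {b : ℝ} (hb : 0 ≤ b) (hB : (B.card : ℝ) ≤ b * Fintype.card β) (hka : k ≤ q * a) :
    avg k (fun T => if a ≤ (T ∩ B).card then (1 : ℝ) else 0) ≤ (3 * q * b) ^ a := by
  refine (avg_large_inter_le hk B a).trans ?_
  have h1 : (B.card : ℝ) * (k / Fintype.card β) ≤ b * q * a := by
    rcases Nat.eq_zero_or_pos (Fintype.card β) with h | h
    · rw [h]; simp; positivity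
    · have h2 : (k : ℝ) ≤ q * a := by exact_mod_cast hka
      calc (B.card : ℝ) * (k / Fintype.card β) ≤ b * Fintype.card β * (k / Fintype.card β) := by
            gcongr
        _ = b * k := by field_simp
        _ ≤ b * (q * a) := by gcongr
        _ = _ := by ring
  calc (B.card.choose a : ℝ) * ((k : ℝ) / Fintype.card β) ^ a
      ≤ (B.card ^ a / (a.factorial)) * ((k : ℝ) / Fintype.card β) ^ a := by
        gcongr
        exact Nat.choose_le_pow_div a _
    _ = ((B.card : ℝ) * (k / Fintype.card β)) ^ a / a.factorial := by rw [mul_pow]; ring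
    _ ≤ (b * q * a) ^ a / a.factorial := by gcongr
    _ = (b * q) ^ a * ((a : ℝ) ^ a / a.factorial) := by rw [mul_pow]; ring
    _ ≤ (b * q) ^ a * Real.exp a := by
        gcongr
        exact Real.pow_div_factorial_le_exp _ (Nat.cast_nonneg a) a
    _ = (Real.exp 1 * q * b) ^ a := by
        rw [mul_pow _ b, mul_pow, mul_pow, ← Real.exp_nat_mul, mul_one]; ring
    _ ≤ (3 * q * b) ^ a := by
        gcongr
        exact Real.exp_one_lt_three.le

/-- Makes "this ring hits too little" inherited by subsets, so the smallest ring size is the worst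
case and all classes are reduced to it. -/
theorem avg_mul_hit_mono {k : ℕ} {g : Finset β → ℝ} (hg : ∀ S, 0 ≤ g S) {T T' : Finset β}
    (h : T ⊆ T') : avg k (fun S => g S * hit T S) ≤ avg k (fun S => g S * hit T' S) := by
  refine avg_mono fun S _ => mul_le_mul_of_nonneg_left ?_ (hg S)
  unfold hit
  split_ifs with h1 h2
  · exact le_rfl
  · exact absurd (h1.mono (Finset.inter_subset_inter_right h)) h2
  · exact zero_le_one
  · exact le_rfl

end Average

/-! ### The effect of revealing one random ring -/

section OneStep

variable {β : Type*} [Fintype β] [DecidableEq β]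

theorem shareProb_le {P K k : ℕ} (h : K + k ≤ P) : shareProb P K k ≤ (K * k : ℝ) / P := by
  obtain ⟨T, hT⟩ := Finset.exists_subset_card_eq (s := (Finset.univ : Finset (Fin P))) (n := K)
    (by simp; omega)
  have := avg_hit_le T (k := k) (by simp; omega)
  rw [avg_hit T (by simp; omega), hT.2] at this
  simpa using this

theorem shareProb_le_one {P K k : ℕ} : shareProb P K k ≤ 1 := by
  unfold shareProb
  split_ifs
  · have : (0 : ℝ) ≤ ((P - K).choose k : ℝ) / (P.choose k : ℝ) := by positivity
    linarith
  · exact le_rfl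

theorem le_shareProb {P K k : ℕ} (h : K + k ≤ P) {z : ℝ} (hz : (K * k : ℝ) / P = z) :
    z / (1 + z) ≤ shareProb P K k := by
  obtain ⟨T, hT⟩ := Finset.exists_subset_card_eq (s := (Finset.univ : Finset (Fin P))) (n := K)
    (by simp; omega)
  have := le_avg_hit T (k := k) (by simp; omega) (z := z) (by rw [hT.2]; simpa using hz)
  rw [avg_hit T (by simp; omega), hT.2] at this
  simpa using this

theorem shareProb_nonneg {P K k : ℕ} (h : K + k ≤ P) : 0 ≤ shareProb P K k :=
  le_trans (by positivity) (le_shareProb h rfl)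

/-- Double counting of pairs (key, set containing it): every set contains `k` keys. -/
theorem sum_avg_mul_mem {k : ℕ} (g : Finset β → ℝ) :
    ∑ b, avg k (fun S => g S * (if b ∈ S then 1 else 0)) = k * avg k g := by
  rw [← avg_sum, ← avg_const_mul]
  refine avg_congr fun S hS => ?_
  rw [← Finset.mul_sum, mul_comm]
  simp [hS]

theorem avg_mul_mem_le {k : ℕ} (hk : k ≤ Fintype.card β) {g : Finset β → ℝ} (hg : ∀ S, g S ≤ 1)
    (b : β) : avg k (fun S => g S * (if b ∈ S then 1 else 0)) ≤ (k : ℝ) / Fintype.card β := by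
  rw [← avg_mem hk b]
  refine avg_mono fun S _ => ?_
  have := hg S
  split_ifs <;> linarith

theorem sum_avg_mul_mem_eq {k : ℕ} (g : Finset β → ℝ) (T : Finset β) :
    ∑ b ∈ T, avg k (fun S => g S * (if b ∈ S then 1 else 0))
      = avg k (fun S => g S * (T ∩ S).card) := by
  rw [← avg_sum]
  refine avg_congr fun S _ => ?_
  rw [← Finset.mul_sum]
  congr 1
  simp

/-- As long as few of the `k`-sets are lost, a random `K`-set hits almost all the share of the
remaining ones. -/
theorem avg_low_drop_le {K k l q L : ℕ} (hKk : K + k ≤ Fintype.card β)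
    (hk : 0 < k) (hq : 0 < q) (hL : q * L ≤ K) (hKl : K ≤ l)
    {g : Finset β → ℝ} (hg0 : ∀ S, 0 ≤ g S) (hg1 : ∀ S, g S ≤ 1) {x : ℝ}
    (hx : avg k (fun S => 1 - g S) ≤ x) (hx1 : 3 * (q : ℝ) ^ 2 * x ≤ 1) :
    avg l (fun T => if avg k (fun S => g S * hit T S)
        < (1 - 4 / (q : ℝ)) * shareProb (Fintype.card β) K k then (1 : ℝ) else 0)
      ≤ (3 * (q : ℝ) ^ 2 * x) ^ L := by
  classical
  have hkc : k ≤ Fintype.card β := by omega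
  have hKc : K ≤ Fintype.card β := by omega
  have hP : (0 : ℝ) < Fintype.card β := by exact_mod_cast (by omega : 0 < Fintype.card β)
  have hx0 : 0 ≤ x := le_trans (avg_nonneg fun S => by linarith [hg1 S]) hx
  have hqR : (1 : ℝ) ≤ q := by exact_mod_cast hq
  have hkR : (0 : ℝ) < k := by exact_mod_cast hk
  set P := Fintype.card β with hPdef
  set p := shareProb P K k
  refine (avg_down_closed_le _ (fun S T hST hT => lt_of_le_of_lt (avg_mul_hit_mono hg0 hST) hT)
    hKl).trans ?_
  -- `h b` is the lost share of the sets that contain the key `b`. Its sum over all keys is k times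
  -- the total loss.
  set h : β → ℝ := fun b => avg k (fun S => (1 - g S) * (if b ∈ S then 1 else 0)) with hh
  have hh1 : ∀ b, h b ≤ (k : ℝ) / P := fun b => avg_mul_mem_le hkc (fun S => by linarith [hg0 S]) b
  have hh0 : ∀ b, 0 ≤ h b := fun b => avg_nonneg fun S =>
    mul_nonneg (by linarith [hg1 S]) (by split_ifs <;> simp)
  -- Keys for which more than a fraction 1/q of the sets through them is lost. By Markov their
  -- density is at most qx, so a random ring rarely has K/q keys among them.
  set B : Finset β := Finset.univ.filter (fun b => (k : ℝ) / (q * P) < h b) with hB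
  have hBc : (B.card : ℝ) ≤ (q * x) * P := by
    have h1 : (B.card : ℝ) * ((k : ℝ) / (q * P)) ≤ k * x := by
      calc (B.card : ℝ) * ((k : ℝ) / (q * P)) = ∑ b ∈ B, (k : ℝ) / (q * P) := by
            rw [Finset.sum_const, nsmul_eq_mul]
        _ ≤ ∑ b ∈ B, h b := Finset.sum_le_sum fun b hb => (Finset.mem_filter.1 hb).2.le
        _ ≤ ∑ b, h b := Finset.sum_le_univ_sum_of_nonneg hh0
        _ = k * avg k (fun S => 1 - g S) := sum_avg_mul_mem _
        _ ≤ k * x := by gcongr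
    have h2 : (B.card : ℝ) = ((B.card : ℝ) * ((k : ℝ) / (q * P))) * ((q * P) / k) := by
      field_simp
    rw [h2]
    calc _ ≤ (k * x) * ((q * P) / k) := by gcongr
      _ = _ := by field_simp
  set a := ⌈(K : ℝ) / q⌉₊ with ha
  have hKa : K ≤ q * a := by
    have := Nat.le_ceil ((K : ℝ) / q)
    rw [div_le_iff₀ (by linarith)] at this
    rw [mul_comm]
    exact_mod_cast this
  have hLa : L ≤ a := by
    rw [ha]
    refine (Nat.cast_le (α := ℝ)).1 (le_trans ?_ (Nat.le_ceil _))
    rw [le_div_iff₀ (by linarith), mul_comm]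
    exact_mod_cast hL
  have hgood : ∀ T : Finset β, T.card = K → avg k (fun S => g S * hit T S) < (1 - 4 / (q : ℝ)) * p →
      a ≤ (T ∩ B).card := by
    intro T hT hlt
    by_contra hcon
    have hcon' : ((T ∩ B).card : ℝ) < K / q := Nat.lt_ceil.1 (not_le.1 hcon)
    have hpT : avg k (hit T) = p := by rw [avg_hit T (by omega), hT]
    have hsub : avg k (fun S => g S * hit T S) = p - avg k (fun S => (1 - g S) * hit T S) := by
      rw [← hpT, ← avg_sub]
      exact avg_congr fun S _ => by ring
    set z : ℝ := (K * k : ℝ) / P with hz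
    have hz0 : 0 ≤ z := by positivity
    -- Fewer than K/q bad keys lose at most k/P each, and at most K other keys lose at most k/(qP)
    -- each.
    have hloss1 : avg k (fun S => (1 - g S) * hit T S) ≤ 2 * z / q := by
      calc avg k (fun S => (1 - g S) * hit T S) ≤ avg k (fun S => (1 - g S) * (T ∩ S).card) :=
            avg_mono fun S _ => mul_le_mul_of_nonneg_left (hit_le_card_inter T S)
              (by linarith [hg1 S])
        _ = ∑ b ∈ T, h b := (sum_avg_mul_mem_eq _ T).symm
        _ = ∑ b ∈ T ∩ B, h b + ∑ b ∈ T \ B, h b := (Finset.sum_inter_add_sum_sdiff T B h).symm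
        _ ≤ ∑ b ∈ T ∩ B, (k : ℝ) / P + ∑ b ∈ T \ B, (k : ℝ) / (q * P) := by
            gcongr with b hb b hb
            · exact hh1 b
            · have := (Finset.mem_sdiff.1 hb).2
              simpa [hB] using this
        _ ≤ (K / q) * ((k : ℝ) / P) + K * ((k : ℝ) / (q * P)) := by
            rw [Finset.sum_const, Finset.sum_const, nsmul_eq_mul, nsmul_eq_mul]
            have : ((T \ B).card : ℝ) ≤ K := by
              rw [← hT]; exact_mod_cast Finset.card_le_card Finset.sdiff_subset
            gcongr
        _ = _ := by rw [hz]; field_simp; ring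
    have hloss2 : avg k (fun S => (1 - g S) * hit T S) ≤ x :=
      le_trans (avg_mono fun S _ => mul_le_of_le_one_right (by linarith [hg1 S]) (hit_le_one T S)) hx
    have hpz : z / (1 + z) ≤ p := le_shareProb hKk hz.symm
    have hx2 : x ≤ 1 / q := by
      rw [le_div_iff₀ (by linarith)]
      nlinarith [mul_nonneg hx0 (by linarith : (0:ℝ) ≤ q)]
    have hfin : avg k (fun S => (1 - g S) * hit T S) ≤ 4 / q * p := by
      -- If z ≤ 1, then p ≥ z/2 and the key-by-key loss 2z/q suffices. If z ≥ 1, then p ≥ 1/2 and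
      -- the total loss x ≤ 1/q suffices.
      rcases le_total z 1 with h1 | h1
      · have : z / 2 ≤ p := le_trans (by gcongr; linarith) hpz
        calc _ ≤ 2 * z / q := hloss1
          _ = 4 / q * (z / 2) := by ring
          _ ≤ _ := by gcongr
      · have : 1 / 2 ≤ p := le_trans (by rw [div_le_div_iff₀ (by norm_num) (by linarith)]; linarith) hpz
        calc _ ≤ 1 / (q : ℝ) := hloss2.trans hx2
          _ ≤ 4 / q * (1 / 2) := by
            rw [div_mul_div_comm, div_le_div_iff₀ (by linarith) (by linarith)]; linarith
          _ ≤ _ := by gcongr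
    rw [hsub] at hlt
    linarith
  have hmono : avg K (fun T => if avg k (fun S => g S * hit T S) < (1 - 4 / (q : ℝ)) * p
      then (1 : ℝ) else 0) ≤ avg K (fun T => if a ≤ (T ∩ B).card then (1 : ℝ) else 0) := by
    refine avg_mono fun T hT => ?_
    split_ifs with h1 h2
    · exact le_rfl
    · exact absurd (hgood T hT h1) h2
    · exact zero_le_one
    · exact le_rfl
  refine hmono.trans ((avg_large_inter_le_pow hKc B (by positivity) hBc hKa).trans ?_)
  have : 3 * (q : ℝ) * (q * x) = 3 * (q : ℝ) ^ 2 * x := by ring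
  rw [this]
  exact pow_le_pow_of_le_one (by positivity) hx1 hLa

/-- As long as a positive fraction of the `k`-sets remains, a large random `K`-set hits a positive
share of it with high probability. -/
theorem avg_low_drop_le_of_le_avg {K k l : ℕ} (hKk : K + k ≤ Fintype.card β)
    (hK : 0 < K) (hk : 0 < k) (hKl : K ≤ l)
    {g : Finset β → ℝ} (hg0 : ∀ S, 0 ≤ g S) (hg1 : ∀ S, g S ≤ 1) {d : ℝ} (hd : 0 < d)
    (hx : d ≤ avg k g) :
    avg l (fun T => if avg k (fun S => g S * hit T S)
        < d ^ 2 / 8 * shareProb (Fintype.card β) K k then (1 : ℝ) else 0)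
      ≤ 4 / (K * d ^ 2) := by
  classical
  have hkc : k ≤ Fintype.card β := by omega
  have hKc : K ≤ Fintype.card β := by omega
  have hP : (0 : ℝ) < Fintype.card β := by exact_mod_cast (by omega : 0 < Fintype.card β)
  have hkR : (0 : ℝ) < k := by exact_mod_cast hk
  have hKR : (0 : ℝ) < K := by exact_mod_cast hK
  set P := Fintype.card β with hPdef
  set p := shareProb P K k
  refine (avg_down_closed_le _ (fun S T hST hT => lt_of_le_of_lt (avg_mul_hit_mono hg0 hST) hT)
    hKl).trans ?_
  -- `w b` is the remaining share of the sets through `b`. A random ring should collect about its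
  -- mean M ≥ zd; the proof is Chebyshev for this sum.
  set w : β → ℝ := fun b => avg k (fun S => g S * (if b ∈ S then 1 else 0)) with hw
  have hw1 : ∀ b, w b ≤ (k : ℝ) / P := fun b => avg_mul_mem_le hkc hg1 b
  have hw0 : ∀ b, 0 ≤ w b := fun b => avg_nonneg fun S =>
    mul_nonneg (hg0 S) (by split_ifs <;> simp)
  set z : ℝ := (K * k : ℝ) / P with hz
  have hz0 : 0 < z := by positivity
  set M : ℝ := K / P * ∑ b, w b with hM
  have hMz : z * d ≤ M := by
    rw [hM, sum_avg_mul_mem, hz]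
    calc (K * k : ℝ) / P * d = K / P * (k * d) := by ring
      _ ≤ _ := by gcongr
  have hgood : ∀ T : Finset β, T.card = K → avg k (fun S => g S * hit T S) < d ^ 2 / 8 * p →
      (z * d / 2) ^ 2 ≤ (∑ b ∈ T, w b - M) ^ 2 := by
    intro T hT hlt
    have hF : ∑ b ∈ T, w b < z * d / 2 := by
      by_contra hcon
      push Not at hcon
      -- The maximizer of 2t·(zd/2) - t²(z + z²), the second moment bound for the remaining sets
      -- that are hit.
      set t : ℝ := d / (2 * (1 + z)) with ht
      have ht0 : 0 ≤ t := by positivity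
      have h1 : 2 * t * ∑ b ∈ T, w b - t ^ 2 * (z + z ^ 2) ≤ avg k (fun S => g S * hit T S) := by
        have h2 : avg k (fun S => ((T ∩ S).card : ℝ) ^ 2) ≤ z + z ^ 2 := by
          have := avg_sq_card_inter_le hkc T
          rwa [hT] at this
        calc 2 * t * ∑ b ∈ T, w b - t ^ 2 * (z + z ^ 2)
            ≤ 2 * t * avg k (fun S => g S * (T ∩ S).card)
              - t ^ 2 * avg k (fun S => ((T ∩ S).card : ℝ) ^ 2) := by
              rw [← sum_avg_mul_mem_eq]; gcongr
          _ = avg k (fun S => 2 * t * (g S * (T ∩ S).card) - t ^ 2 * ((T ∩ S).card : ℝ) ^ 2) := by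
              rw [avg_sub, avg_const_mul, avg_const_mul]
          _ ≤ _ := by
              refine avg_mono fun S _ => ?_
              have h3 := mul_le_mul_of_nonneg_left (le_hit T S t) (hg0 S)
              have h4 : g S * (t ^ 2 * ((T ∩ S).card : ℝ) ^ 2) ≤ t ^ 2 * ((T ∩ S).card : ℝ) ^ 2 :=
                mul_le_of_le_one_left (by positivity) (hg1 S)
              nlinarith
      have h5 : 2 * t * (z * d / 2) - t ^ 2 * (z + z ^ 2) = d ^ 2 / 8 * (2 * z / (1 + z)) := by
        rw [ht]; field_simp; ring
      have h6 : p ≤ 2 * z / (1 + z) := by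
        rw [le_div_iff₀ (by positivity)]
        have h7 : p ≤ z := shareProb_le hKk
        have h8 : p ≤ 1 := shareProb_le_one
        have h9 : 0 ≤ p := shareProb_nonneg hKk
        nlinarith
      have h10 : 2 * t * (z * d / 2) ≤ 2 * t * ∑ b ∈ T, w b := by gcongr
      have h11 : d ^ 2 / 8 * p ≤ d ^ 2 / 8 * (2 * z / (1 + z)) := by gcongr
      linarith
    have : 0 < z * d := by positivity
    nlinarith
  refine (avg_indicator_le (fun T => sq_nonneg _) (c := (z * d / 2) ^ 2) (by positivity) _
    hgood).trans ?_
  -- Negative dependence leaves only the diagonal of the variance, and each weight is at most k/P.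
  have hvar : avg K (fun T => (∑ b ∈ T, w b - M) ^ 2) ≤ K * (k / P) ^ 2 := by
    have h1 : avg K (fun T => (∑ b ∈ T, w b - M) ^ 2)
        = avg K (fun T => (∑ b ∈ T, w b) ^ 2) - M ^ 2 := by
      have : ∀ T : Finset β, (∑ b ∈ T, w b - M) ^ 2
          = ((∑ b ∈ T, w b) ^ 2 - 2 * M * ∑ b ∈ T, w b) + M ^ 2 := fun T => by ring
      rw [avg_congr fun T _ => this T, avg_add, avg_sub, avg_const_mul, avg_const hKc,
        avg_sum_mem hKc]
      rw [← hPdef, ← hM]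
      ring
    have h2 := avg_sq_sum_mem_le hKc hw0
    rw [← hPdef] at h2
    have h3 : ∑ b, w b ^ 2 ≤ P * ((k : ℝ) / P) ^ 2 := by
      calc ∑ b, w b ^ 2 ≤ ∑ _b : β, ((k : ℝ) / P) ^ 2 := by
            gcongr with b _
            · exact hw0 b
            · exact hw1 b
        _ = _ := by simp [hPdef]
    have h4 : (K : ℝ) / P * ∑ b, w b ^ 2 ≤ K * (k / P) ^ 2 := by
      calc (K : ℝ) / P * ∑ b, w b ^ 2 ≤ K / P * (P * ((k : ℝ) / P) ^ 2) := by gcongr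
        _ = _ := by field_simp
    have h5 : M ^ 2 = ((K : ℝ) / P) ^ 2 * (∑ b, w b) ^ 2 := by rw [hM, mul_pow]
    linarith
  rw [div_le_div_iff₀ (by positivity) (by positivity)]
  calc _ ≤ (K * (k / P) ^ 2) * (K * d ^ 2) := by gcongr
    _ = _ := by rw [hz]; field_simp; ring

end OneStep

/-! ### Failure patterns and the avoidance probability of a set of nodes -/

/-- A sequence of independent steps, each of which lowers a quantity by `D` unless it fails, which
has probability at most `ρ` as long as the quantity exceeds `q₀`. -/
theorem sum_steps_le {A γ : Type*} [Fintype A] {w : A → ℝ} (hw0 : ∀ a, 0 ≤ w a)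
    (hw1 : ∑ a, w a = 1) {F : A → γ → ℝ} (hF0 : ∀ a s, 0 ≤ F a s) (hF1 : ∀ a s, F a s ≤ 1)
    {V : (γ → ℝ) → ℝ} (hV : ∀ g h : γ → ℝ, (∀ s, g s ≤ h s) → V g ≤ V h) {q₀ D ρ : ℝ}
    (hρ0 : 0 ≤ ρ) (hρ1 : ρ ≤ 1)
    (hstep : ∀ g : γ → ℝ, (∀ s, 0 ≤ g s) → (∀ s, g s ≤ 1) → q₀ < V g →
      ∑ a, w a * (if V g - D < V (fun s => g s * F a s) then 1 else 0) ≤ ρ)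
    (m : ℕ) : ∀ (j : ℕ) (g : γ → ℝ), (∀ s, 0 ≤ g s) → (∀ s, g s ≤ 1) → V g ≤ q₀ + j * D →
      ∑ y : Fin m → A, (∏ i, w (y i)) *
        (if q₀ < V (fun s => g s * ∏ i, F (y i) s) then 1 else 0) ≤ 2 ^ m * ρ ^ (m + 1 - j) := by
  induction m with
  | zero =>
    intro j g hg0 hg1 hg
    -- For j = 0 the quantity is already below q₀. For j ≥ 1 the truncated exponent is 0 and the
    -- bound is trivial.
    rcases Nat.eq_zero_or_pos j with rfl | hj
    · have : ¬ q₀ < V g := by simpa using hg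
      simp [this, hρ0]
    · have h0 : 0 + 1 - j = 0 := by omega
      rw [h0]
      simp only [Finset.univ_eq_empty, Finset.prod_empty, mul_one, one_mul, pow_zero,
        Finset.univ_unique, Finset.sum_const, Finset.card_singleton, one_smul]
      split_ifs <;> simp
  | succ m ih =>
    intro j g hg0 hg1 hg
    by_cases hgq : V g ≤ q₀
    · refine le_trans (le_of_eq ?_) (by positivity : (0 : ℝ) ≤ _)
      refine Finset.sum_eq_zero fun y _ => ?_
      rw [if_neg, mul_zero]
      rw [not_lt]
      refine le_trans (hV _ _ fun s => ?_) hgq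
      exact mul_le_of_le_one_right (hg0 s) (Finset.prod_le_one (fun i _ => hF0 _ _) fun i _ => hF1 _ _)
    push Not at hgq
    have hj : 1 ≤ j := by
      rcases Nat.eq_zero_or_pos j with rfl | hj
      · simp at hg; linarith
      · exact hj
    rw [← (Fin.consEquiv (fun _ : Fin (m + 1) => A)).sum_comp, Fintype.sum_prod_type]
    have h1 : ∀ a, ∑ y : Fin m → A, (∏ i, w ((Fin.consEquiv (fun _ : Fin (m + 1) => A)) (a, y) i)) *
        (if q₀ < V (fun s => g s * ∏ i, F ((Fin.consEquiv (fun _ : Fin (m + 1) => A)) (a, y) i) s)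
          then (1 : ℝ) else 0)
        = w a * ∑ y : Fin m → A, (∏ i, w (y i)) *
          (if q₀ < V (fun s => (g s * F a s) * ∏ i, F (y i) s) then 1 else 0) := by
      intro a
      rw [Finset.mul_sum]
      refine Finset.sum_congr rfl fun y _ => ?_
      simp only [Fin.prod_univ_succ, Fin.consEquiv_apply, Fin.cons_zero, Fin.cons_succ, mul_assoc]
    have hgF0 : ∀ a s, 0 ≤ g s * F a s := fun a s => mul_nonneg (hg0 s) (hF0 a s)
    have hgF : ∀ a s, g s * F a s ≤ g s := fun a s => mul_le_of_le_one_right (hg0 s) (hF1 a s)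
    -- A failed first step leaves j unchanged and costs ρ afterwards. A successful one lowers j by
    -- 1, which raises the exponent by 1.
    have h2 : ∀ a, ∑ y : Fin m → A, (∏ i, w (y i)) *
          (if q₀ < V (fun s => (g s * F a s) * ∏ i, F (y i) s) then 1 else 0)
        ≤ 2 ^ m * ρ ^ (m + 1 + 1 - j)
          + (if V g - D < V (fun s => g s * F a s) then 1 else 0) * (2 ^ m * ρ ^ (m + 1 - j)) := by
      intro a
      split_ifs with hbad
      · have := ih j _ (hgF0 a) (fun s => (hgF a s).trans (hg1 s)) ((hV _ _ (hgF a)).trans hg)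
        have h3 : 0 ≤ 2 ^ m * ρ ^ (m + 1 + 1 - j) := by positivity
        linarith
      · have := ih (j - 1) _ (hgF0 a) (fun s => (hgF a s).trans (hg1 s)) (by
          rw [Nat.cast_sub hj]; push_cast; linarith)
        rw [show m + 1 - (j - 1) = m + 1 + 1 - j by omega] at this
        linarith
    calc _ ≤ ∑ a, w a * (2 ^ m * ρ ^ (m + 1 + 1 - j)
          + (if V g - D < V (fun s => g s * F a s) then 1 else 0) * (2 ^ m * ρ ^ (m + 1 - j))) := by
          refine Finset.sum_le_sum fun a _ => ?_
          rw [h1]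
          exact mul_le_mul_of_nonneg_left (h2 a) (hw0 a)
      _ = 2 ^ m * ρ ^ (m + 1 + 1 - j)
          + (∑ a, w a * (if V g - D < V (fun s => g s * F a s) then 1 else 0))
            * (2 ^ m * ρ ^ (m + 1 - j)) := by
          simp_rw [mul_add, Finset.sum_add_distrib, ← Finset.sum_mul, hw1, one_mul, ← mul_assoc,
            ← Finset.sum_mul]
      _ ≤ 2 ^ m * ρ ^ (m + 1 + 1 - j) + ρ * (2 ^ m * ρ ^ (m + 1 - j)) := by
          gcongr
          exact hstep g hg0 hg1 hgq
      _ ≤ 2 ^ m * ρ ^ (m + 1 + 1 - j) + 2 ^ m * ρ ^ (m + 1 + 1 - j) := by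
          refine add_le_add le_rfl ?_
          rcases le_or_gt j (m + 1) with h | h
          · rw [show m + 1 + 1 - j = (m + 1 - j) + 1 by omega, pow_succ]
            linarith
          -- Both truncated exponents vanish here, so only ρ ≤ 1 is available and needed.
          · rw [show m + 1 + 1 - j = 0 by omega, show m + 1 - j = 0 by omega]
            have : (0 : ℝ) ≤ 2 ^ m := by positivity
            nlinarith
      _ = _ := by ring

theorem sum_steps_le_of_one_le {ι A γ : Type*} [Fintype ι] [DecidableEq ι] [Fintype A] {w : A → ℝ}
    (hw0 : ∀ a, 0 ≤ w a)
    (hw1 : ∑ a, w a = 1) {F : A → γ → ℝ} (hF0 : ∀ a s, 0 ≤ F a s) (hF1 : ∀ a s, F a s ≤ 1)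
    {V : (γ → ℝ) → ℝ} (hV : ∀ g h : γ → ℝ, (∀ s, g s ≤ h s) → V g ≤ V h) {q₀ D ρ : ℝ}
    (hρ0 : 0 ≤ ρ) (hρ1 : ρ ≤ 1)
    (hstep : ∀ g : γ → ℝ, (∀ s, 0 ≤ g s) → (∀ s, g s ≤ 1) → q₀ < V g →
      ∑ a, w a * (if V g - D < V (fun s => g s * F a s) then 1 else 0) ≤ ρ)
    (j : ℕ) (hj : V (fun _ => 1) ≤ q₀ + j * D) :
    ∑ y : ι → A, (∏ i, w (y i)) * (if q₀ < V (fun s => ∏ i, F (y i) s) then 1 else 0)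
      ≤ 2 ^ (Fintype.card ι) * ρ ^ (Fintype.card ι + 1 - j) := by
  have h := sum_steps_le hw0 hw1 hF0 hF1 hV hρ0 hρ1 hstep (Fintype.card ι) j (fun _ => 1)
    (by simp) (by simp) hj
  refine le_trans (le_of_eq ?_) h
  let e := Fintype.equivFin ι
  rw [← (Equiv.arrowCongr e (Equiv.refl A)).sum_comp]
  refine Finset.sum_congr rfl fun y _ => ?_
  have h1 : ∀ f : A → ℝ, ∏ i, f ((Equiv.arrowCongr e (Equiv.refl A)) y i) = ∏ i, f (y i) := by
    intro f
    rw [← e.prod_comp]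
    simp
  have h2 : (fun s => ∏ i, F ((Equiv.arrowCongr e (Equiv.refl A)) y i) s)
      = fun s => ∏ i, F (y i) s := funext fun s => h1 (fun a => F a s)
  simp only [one_mul]
  rw [h1 w, h2]

section Nodes

variable {r P : ℕ} {μ : Fin r → ℝ} {K : Fin r → ℕ}

/-- The average of the probability that a node with a random ring of size `k` has no edge to the
nodes `y`, given their key rings. -/
def avoid {ι : Type*} [Fintype ι] (α : ℝ) (k : ℕ) (y : ι → Fin r × Finset (Fin P)) : ℝ :=
  avg k (fun s : Finset (Fin P) => ∏ i, (1 - α * hit (y i).2 s))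

theorem sum_nodeWeight (hμ0 : ∀ i, 0 ≤ μ i) (hμ1 : ∑ i, μ i = 1) (hK : ∀ i, K i ≤ P) :
    ∑ a, nodeWeight μ K P a = 1 := by
  have := sum_nodeWeight_mul hμ0 (K := K) (P := P) (fun _ => 1)
  simp only [mul_one] at this
  rw [this]
  refine Eq.trans (Finset.sum_congr rfl fun i _ => ?_) hμ1
  rw [avg_const (by simpa using hK i), mul_one]

theorem sum_nodeWeight_mul_le (hμ0 : ∀ i, 0 ≤ μ i) (hμ1 : ∑ i, μ i = 1)
    {f : Finset (Fin P) → ℝ} {c : ℝ} (h : ∀ i, avg (K i) f ≤ c) :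
    ∑ a, nodeWeight μ K P a * f a.2 ≤ c := by
  rw [sum_nodeWeight_mul hμ0]
  calc _ ≤ ∑ i, μ i * c := by
        gcongr with i _
        · exact hμ0 i
        · exact h i
    _ = c := by rw [← Finset.sum_mul, hμ1, one_mul]

theorem factor_nonneg {α : ℝ} (hα0 : 0 ≤ α) (hα1 : α ≤ 1) (S T : Finset (Fin P)) :
    0 ≤ 1 - α * hit S T := by
  nlinarith [hit_nonneg S T, hit_le_one S T]

theorem factor_le_one {α : ℝ} (hα0 : 0 ≤ α) (S T : Finset (Fin P)) :
    1 - α * hit S T ≤ 1 := by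
  nlinarith [hit_nonneg S T]

theorem avg_mul_factor (α : ℝ) (k : ℕ) (g : Finset (Fin P) → ℝ) (T : Finset (Fin P)) :
    avg k (fun s => g s * (1 - α * hit T s)) = avg k g - α * avg k (fun s => g s * hit T s) := by
  rw [← avg_const_mul, ← avg_sub]
  exact avg_congr fun s _ => by ring

theorem avoid_nonneg {ι : Type*} [Fintype ι] (α : unitInterval) (k : ℕ)
    (y : ι → Fin r × Finset (Fin P)) : 0 ≤ avoid (α : ℝ) k y :=
  avg_nonneg fun _ => Finset.prod_nonneg fun _ _ => factor_nonneg α.2.1 α.2.2 _ _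

theorem avoid_le_one {ι : Type*} [Fintype ι] (α : unitInterval) {k : ℕ} (hk : k ≤ P)
    (y : ι → Fin r × Finset (Fin P)) : avoid (α : ℝ) k y ≤ 1 :=
  avg_le_one (by simpa using hk) fun _ =>
    Finset.prod_le_one (fun _ _ => factor_nonneg α.2.1 α.2.2 _ _) fun _ _ => factor_le_one α.2.1 _ _

variable [NeZero r]

/-- With high probability few nodes have about as many neighbors in a class as they can. -/
theorem sum_lt_avoid_le {ι : Type*} [Fintype ι] [DecidableEq ι]
    (hμ0 : ∀ i, 0 ≤ μ i) (hμ1 : ∑ i, μ i = 1)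
    (hK0 : ∀ i, K 0 ≤ K i) (hKpos : 0 < K 0) (hKP : ∀ i j, K i + K j ≤ P)
    {α : ℝ} (hα0 : 0 < α) (hα1 : α ≤ 1) (j : Fin r) {q L t : ℕ} (hq : 4 ≤ q) (hL : q * L ≤ K 0)
    {x : ℝ} (hx0 : 0 ≤ x) (hx : t * (α * ((1 - 4 / (q : ℝ)) * shareProb P (K 0) (K j))) ≤ x)
    (hx1 : 3 * (q : ℝ) ^ 2 * x ≤ 1) :
    ∑ y : ι → Fin r × Finset (Fin P), (∏ i, nodeWeight μ K P (y i)) *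
        (if 1 - t * (α * ((1 - 4 / (q : ℝ)) * shareProb P (K 0) (K j))) < avoid α (K j) y
          then 1 else 0)
      ≤ 2 ^ (Fintype.card ι) * ((3 * (q : ℝ) ^ 2 * x) ^ L) ^ (Fintype.card ι + 1 - t) := by
  have hKle : ∀ i, K i ≤ P := fun i => by have := hKP i i; omega
  have hw1 := sum_nodeWeight hμ0 hμ1 hKle
  set D := α * ((1 - 4 / (q : ℝ)) * shareProb P (K 0) (K j)) with hD
  refine sum_steps_le_of_one_le (F := fun a s => 1 - α * hit a.2 s) (V := avg (K j)) (D := D)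
    (nodeWeight_nonneg μ K P) hw1
    (fun a s => factor_nonneg hα0.le hα1 _ _) (fun a s => factor_le_one hα0.le _ _)
    (fun g h hgh => avg_mono fun s _ => hgh s) (by positivity)
    (pow_le_one₀ (by positivity) hx1) ?_ t ?_
  · intro g hg0 hg1 hgV
    refine sum_nodeWeight_mul_le hμ0 hμ1 (f := fun T => if avg (K j) g - D <
      avg (K j) (fun s => g s * (1 - α * hit T s)) then (1 : ℝ) else 0) fun i => ?_
    -- While the avoidance probability exceeds q₀ = 1 - tD, the lost mass is below tD ≤ x, so the
    -- one-step bound applies at every stage.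
    have hdef : avg (K j) (fun s => 1 - g s) ≤ x := by
      rw [avg_sub, avg_const (by simpa using hKle j)]
      linarith
    have := avg_low_drop_le (β := Fin P) (K := K 0) (k := K j) (l := K i) (q := q) (L := L)
      (by simpa using hKP 0 j) (lt_of_lt_of_le hKpos (hK0 j)) (by omega) hL (hK0 i) hg0 hg1 hdef hx1
    refine le_trans (avg_mono fun T _ => ?_) this
    rw [avg_mul_factor, Fintype.card_fin]
    split_ifs with h1 h2
    · exact le_rfl
    · refine absurd ?_ h2
      rw [hD] at h1
      have h3 : α * avg (K j) (fun s => g s * hit T s)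
          < α * ((1 - 4 / (q : ℝ)) * shareProb P (K 0) (K j)) := by linarith
      exact lt_of_mul_lt_mul_left h3 hα0.le
    · exact zero_le_one
    · exact le_rfl
  · rw [avg_const (by simpa using hKle j)]
    linarith

/-- With very high probability a large set of nodes leaves few nodes of a class without neighbors
in it. -/
theorem sum_lt_avoid_le_of_le {ι : Type*} [Fintype ι] [DecidableEq ι]
    (hμ0 : ∀ i, 0 ≤ μ i) (hμ1 : ∑ i, μ i = 1)
    (hK0 : ∀ i, K 0 ≤ K i) (hKpos : 0 < K 0) (hKP : ∀ i j, K i + K j ≤ P)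
    {α : ℝ} (hα0 : 0 < α) (hα1 : α ≤ 1) (j : Fin r) {t : ℕ} {d : ℝ} (hd : 0 < d)
    (ht : 1 ≤ d + t * (α * (d ^ 2 / 8 * shareProb P (K 0) (K j))))
    (hρ : 4 / (K 0 * d ^ 2) ≤ 1) :
    ∑ y : ι → Fin r × Finset (Fin P), (∏ i, nodeWeight μ K P (y i)) *
        (if d < avoid α (K j) y then 1 else 0)
      ≤ 2 ^ (Fintype.card ι) * (4 / (K 0 * d ^ 2)) ^ (Fintype.card ι + 1 - t) := by
  have hKle : ∀ i, K i ≤ P := fun i => by have := hKP i i; omega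
  have hw1 := sum_nodeWeight hμ0 hμ1 hKle
  set D := α * (d ^ 2 / 8 * shareProb P (K 0) (K j)) with hD
  refine sum_steps_le_of_one_le (F := fun a s => 1 - α * hit a.2 s) (V := avg (K j)) (D := D)
    (nodeWeight_nonneg μ K P) hw1
    (fun a s => factor_nonneg hα0.le hα1 _ _) (fun a s => factor_le_one hα0.le _ _)
    (fun g h hgh => avg_mono fun s _ => hgh s) (by positivity) hρ ?_ t ?_
  · intro g hg0 hg1 hgV
    refine sum_nodeWeight_mul_le hμ0 hμ1 (f := fun T => if avg (K j) g - D <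
      avg (K j) (fun s => g s * (1 - α * hit T s)) then (1 : ℝ) else 0) fun i => ?_
    have := avg_low_drop_le_of_le_avg (β := Fin P) (K := K 0) (k := K j) (l := K i)
      (by simpa using hKP 0 j) hKpos (lt_of_lt_of_le hKpos (hK0 j)) (hK0 i) hg0 hg1 hd hgV.le
    refine le_trans (avg_mono fun T _ => ?_) this
    rw [avg_mul_factor, Fintype.card_fin]
    split_ifs with h1 h2
    · exact le_rfl
    · refine absurd ?_ h2
      rw [hD] at h1
      have h3 : α * avg (K j) (fun s => g s * hit T s)
          < α * (d ^ 2 / 8 * shareProb P (K 0) (K j)) := by linarith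
      exact lt_of_mul_lt_mul_left h3 hα0.le
    · exact zero_le_one
    · exact le_rfl
  · rw [avg_const (by simpa using hKle j)]
    exact ht

end Nodes

/-! ### Probabilities of cuts -/

/-- The parameters of a network in which all key sharing probabilities are non-trivial. -/
structure Admissible {r : ℕ} [NeZero r] (μ : Fin r → ℝ) (K : Fin r → ℕ) (P : ℕ) : Prop where
  μ_nonneg : ∀ i, 0 ≤ μ i
  μ_sum : ∑ i, μ i = 1
  K_zero_le : ∀ i, K 0 ≤ K i
  K_pos : 0 < K 0
  add_le : ∀ i j, K i + K j ≤ P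

section Cut

variable {n r P : ℕ} [NeZero r] {μ : Fin r → ℝ} {K : Fin r → ℕ} {α : unitInterval}

theorem Admissible.le_pool (h : Admissible μ K P) (i : Fin r) : K i ≤ P := by
  have := h.add_le i i; omega

theorem Admissible.sum_weight (h : Admissible μ K P) : ∑ a, nodeWeight μ K P a = 1 :=
  sum_nodeWeight h.μ_nonneg h.μ_sum h.le_pool

theorem Admissible.sum_prod_weight (h : Admissible μ K P) (ι : Type*) [Fintype ι] [DecidableEq ι] :
    ∑ x : ι → Fin r × Finset (Fin P), ∏ v, nodeWeight μ K P (x v) = 1 := by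
  have := HeterogeneousKeyGraph.sum_prod_weight (ι := ι) (nodeWeight μ K P) (fun _ _ => 1)
  simpa [h.sum_weight] using this

theorem Admissible.isProbabilityMeasure (h : Admissible μ K P) :
    IsProbabilityMeasure (modelMeasure n μ K P α) := by
  constructor
  have h1 : (modelMeasure n μ K P α).real Set.univ = 1 := by
    rw [modelMeasure_real]
    simp [h.sum_prod_weight]
  rw [measureReal_def] at h1
  exact (ENNReal.toReal_eq_one_iff _).1 h1

/-- The probability that there are no edges between two disjoint sets of nodes, jointly with an
event on the nodes of the first set and a restriction of the classes in the second set. -/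
theorem Admissible.real_no_edges (h : Admissible μ K P) {S T : Finset (Fin n)} (hST : Disjoint S T)
    (D : (S → Fin r × Finset (Fin P)) → Prop) [DecidablePred D] (C : Fin r → Prop)
    [DecidablePred C] :
    (modelMeasure n μ K P α).real {ω | (D (fun u => ω.1 u) ∧ ∀ v ∈ T, C (ω.1 v).1) ∧
        ∀ u ∈ S, ∀ v ∈ T, ¬ (network ω).Adj u v}
      = ∑ y : S → Fin r × Finset (Fin P), (∏ u, nodeWeight μ K P (y u)) *
        ((if D y then 1 else 0) *
          (∑ i, μ i * (if C i then avoid (α : ℝ) (K i) y else 0)) ^ T.card) := by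
  classical
  rw [modelMeasure_no_edges (fun x => D (fun u => x u) ∧ ∀ v ∈ T, C (x v).1) hST]
  have h1 := sum_split h.sum_weight hST (fun y => if D y then (1 : ℝ) else 0)
    (fun y a => if C a.1 then ∏ u : S, (1 - (α : ℝ) * hit (y u).2 a.2) else 0)
  have h2 : ∀ y : S → Fin r × Finset (Fin P), ∑ a, nodeWeight μ K P a *
      (if C a.1 then ∏ u : S, (1 - (α : ℝ) * hit (y u).2 a.2) else 0)
      = ∑ i, μ i * (if C i then avoid (α : ℝ) (K i) y else 0) := by
    intro y
    rw [sum_nodeWeight_mul h.μ_nonneg]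
    refine Finset.sum_congr rfl fun i _ => ?_
    congr 1
    dsimp only
    split_ifs
    · rfl
    · exact avg_const (by simpa using h.le_pool i) 0
  simp_rw [h2] at h1
  rw [← h1]
  refine Finset.sum_congr rfl fun x _ => ?_
  congr 1
  have h3 : ∀ v, ∏ u ∈ S, (1 - (α : ℝ) * hit (x u).2 (x v).2)
      = ∏ u : S, (1 - (α : ℝ) * hit (x u).2 (x v).2) := fun v =>
    (Finset.prod_coe_sort S (fun u => 1 - (α : ℝ) * hit (x u).2 (x v).2)).symm
  by_cases hD : D (fun u => x u)
  · by_cases hC : ∀ v ∈ T, C (x v).1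
    · rw [if_pos ⟨hD, hC⟩, if_pos hD, one_mul, Finset.prod_comm]
      exact Finset.prod_congr rfl fun v hv => by rw [if_pos (hC v hv), h3]
    · rw [if_neg (fun h' => hC h'.2)]
      push Not at hC
      obtain ⟨v, hv, hvC⟩ := hC
      rw [Finset.prod_eq_zero hv (by rw [if_neg hvC]), mul_zero]
  · rw [if_neg (fun h' => hD h'.1), if_neg hD, zero_mul]

theorem Admissible.real_cut (h : Admissible μ K P) {S T : Finset (Fin n)} (hST : Disjoint S T) :
    (modelMeasure n μ K P α).real {ω | ∀ u ∈ S, ∀ v ∈ T, ¬ (network ω).Adj u v}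
      = ∑ y : S → Fin r × Finset (Fin P), (∏ u, nodeWeight μ K P (y u)) *
        (∑ i, μ i * avoid (α : ℝ) (K i) y) ^ T.card := by
  have := h.real_no_edges (α := α) hST (fun _ => True) (fun _ => True)
  simpa using this

theorem Admissible.real_class_cut (h : Admissible μ K P) {S T : Finset (Fin n)}
    (hST : Disjoint S T) (j : Fin r) :
    (modelMeasure n μ K P α).real {ω | (∀ v ∈ T, (ω.1 v).1 = j) ∧
        ∀ u ∈ S, ∀ v ∈ T, ¬ (network ω).Adj u v}
      = ∑ y : S → Fin r × Finset (Fin P), (∏ u, nodeWeight μ K P (y u)) *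
        (μ j * avoid (α : ℝ) (K j) y) ^ T.card := by
  have := h.real_no_edges (α := α) hST (fun _ => True) (fun i => i = j)
  simpa using this

theorem Admissible.share_nonneg (h : Admissible μ K P) (j : Fin r) :
    0 ≤ shareProb P (K 0) (K j) := shareProb_nonneg (h.add_le 0 j)

/-- A bound for the probability that there are no edges between two sets of nodes, the first of
which is not too large. -/
theorem Admissible.real_cut_le (h : Admissible μ K P) (hα : 0 < (α : ℝ)) {μ₀ Λ : ℝ} (hμ₀ : 0 < μ₀)
    (hμ : ∀ i, μ₀ ≤ μ i) (hΛ : Λ = (α : ℝ) * ∑ j, μ j * shareProb P (K 0) (K j))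
    {q L t : ℕ} (hq : 4 ≤ q) (hL : q * L ≤ K 0) (hx : 3 * (q : ℝ) ^ 2 * (t * Λ / μ₀) ≤ 1)
    {S T : Finset (Fin n)} (hST : Disjoint S T) :
    (modelMeasure n μ K P α).real {ω | ∀ u ∈ S, ∀ v ∈ T, ¬ (network ω).Adj u v}
      ≤ r * (2 ^ S.card * ((3 * (q : ℝ) ^ 2 * (t * Λ / μ₀)) ^ L) ^ (S.card + 1 - t))
        + Real.exp (-(T.card * (t * ((1 - 4 / (q : ℝ)) * Λ)))) := by
  classical
  set κ : ℝ := 1 - 4 / (q : ℝ) with hκ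
  have hqR : (4 : ℝ) ≤ q := by exact_mod_cast hq
  have hκ0 : 0 ≤ κ := by
    rw [hκ, sub_nonneg, div_le_one (by linarith)]; exact hqR
  have hκ1 : κ ≤ 1 := by
    have : 0 ≤ 4 / (q : ℝ) := by positivity
    rw [hκ]; linarith
  set p : Fin r → ℝ := fun j => shareProb P (K 0) (K j)
  have hp : ∀ j, 0 ≤ p j := h.share_nonneg
  set x := t * Λ / μ₀ with hxdef
  have hΛ0 : 0 ≤ Λ := by
    rw [hΛ]
    exact mul_nonneg hα.le (Finset.sum_nonneg fun j _ => mul_nonneg (h.μ_nonneg j) (hp j))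
  have hpj : ∀ j, (α : ℝ) * p j ≤ Λ / μ₀ := by
    intro j
    rw [le_div_iff₀ hμ₀, hΛ, mul_assoc]
    refine mul_le_mul_of_nonneg_left ?_ hα.le
    calc p j * μ₀ ≤ μ j * p j := by rw [mul_comm]; exact mul_le_mul_of_nonneg_right (hμ j) (hp j)
      _ ≤ _ := Finset.single_le_sum (f := fun j => μ j * p j)
        (fun j _ => mul_nonneg (h.μ_nonneg j) (hp j)) (Finset.mem_univ j)
  have hxj : ∀ j, t * ((α : ℝ) * (κ * p j)) ≤ x := by
    intro j
    rw [hxdef, mul_div_assoc]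
    refine mul_le_mul_of_nonneg_left ?_ (Nat.cast_nonneg _)
    calc (α : ℝ) * (κ * p j) ≤ (α : ℝ) * (1 * p j) := by
          gcongr
          exact hp j
      _ ≤ _ := by rw [one_mul]; exact hpj j
  -- If some class still has a high avoidance probability, bound the power by 1 and charge that
  -- class. Otherwise, averaging the drops over the classes reassembles Λ, and 1 - u ≤ e^(-u).
  have hmain : ∀ y : S → Fin r × Finset (Fin P), (∑ i, μ i * avoid (α : ℝ) (K i) y) ^ T.card
      ≤ (∑ j, if 1 - t * ((α : ℝ) * (κ * p j)) < avoid (α : ℝ) (K j) y then (1 : ℝ) else 0)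
        + Real.exp (-(T.card * (t * (κ * Λ)))) := by
    intro y
    have hs0 : 0 ≤ ∑ i, μ i * avoid (α : ℝ) (K i) y :=
      Finset.sum_nonneg fun i _ => mul_nonneg (h.μ_nonneg i) (avoid_nonneg α _ y)
    have hs1 : ∑ i, μ i * avoid (α : ℝ) (K i) y ≤ 1 := by
      rw [← h.μ_sum]
      exact Finset.sum_le_sum fun i _ =>
        mul_le_of_le_one_right (h.μ_nonneg i) (avoid_le_one α (h.le_pool i) y)
    by_cases hbad : ∃ j, 1 - t * ((α : ℝ) * (κ * p j)) < avoid (α : ℝ) (K j) y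
    · obtain ⟨j, hj⟩ := hbad
      have h1 : (1 : ℝ) ≤ ∑ j, if 1 - t * ((α : ℝ) * (κ * p j)) < avoid (α : ℝ) (K j) y
          then (1 : ℝ) else 0 := by
        have := Finset.single_le_sum (f := fun j => if 1 - t * ((α : ℝ) * (κ * p j)) <
          avoid (α : ℝ) (K j) y then (1 : ℝ) else 0) (fun j _ => by split_ifs <;> simp)
          (Finset.mem_univ j)
        simpa [hj] using this
      have h2 := Real.exp_pos (-(T.card * (t * (κ * Λ))))
      have h3 := pow_le_one₀ (n := T.card) hs0 hs1
      linarith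
    · push Not at hbad
      have h1 : ∑ i, μ i * avoid (α : ℝ) (K i) y ≤ 1 - t * (κ * Λ) := by
        calc _ ≤ ∑ i, μ i * (1 - t * ((α : ℝ) * (κ * p i))) :=
              Finset.sum_le_sum fun i _ => mul_le_mul_of_nonneg_left (hbad i) (h.μ_nonneg i)
          _ = ∑ i, μ i - t * (κ * ((α : ℝ) * ∑ i, μ i * p i)) := by
              simp_rw [Finset.mul_sum, ← Finset.sum_sub_distrib]
              exact Finset.sum_congr rfl fun i _ => by ring
          _ = _ := by rw [h.μ_sum, hΛ]
      have h2 : ∑ i, μ i * avoid (α : ℝ) (K i) y ≤ Real.exp (-(t * (κ * Λ))) :=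
        h1.trans (by have := Real.add_one_le_exp (-(t * (κ * Λ))); linarith)
      have h3 := pow_le_pow_left₀ hs0 h2 T.card
      rw [← Real.exp_nat_mul, mul_neg] at h3
      refine h3.trans (le_add_of_nonneg_left (Finset.sum_nonneg fun j _ => ?_))
      split_ifs <;> simp
  rw [h.real_cut hST]
  calc _ ≤ ∑ y : S → Fin r × Finset (Fin P), (∏ u, nodeWeight μ K P (y u)) *
        ((∑ j, if 1 - t * ((α : ℝ) * (κ * p j)) < avoid (α : ℝ) (K j) y then (1 : ℝ) else 0)
        + Real.exp (-(T.card * (t * (κ * Λ))))) :=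
        Finset.sum_le_sum fun y _ => mul_le_mul_of_nonneg_left (hmain y)
          (Finset.prod_nonneg fun u _ => nodeWeight_nonneg _ _ _ _)
    _ = (∑ j, ∑ y : S → Fin r × Finset (Fin P), (∏ u, nodeWeight μ K P (y u)) *
          (if 1 - t * ((α : ℝ) * (κ * p j)) < avoid (α : ℝ) (K j) y then (1 : ℝ) else 0))
        + Real.exp (-(T.card * (t * (κ * Λ)))) := by
        simp_rw [mul_add, Finset.sum_add_distrib, ← Finset.sum_mul, h.sum_prod_weight, one_mul]
        congr 1
        simp_rw [Finset.mul_sum]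
        rw [Finset.sum_comm]
    _ ≤ (∑ _j : Fin r, 2 ^ S.card * ((3 * (q : ℝ) ^ 2 * x) ^ L) ^ (S.card + 1 - t))
        + Real.exp (-(T.card * (t * (κ * Λ)))) := by
        gcongr with j _
        have := sum_lt_avoid_le (ι := S) h.μ_nonneg h.μ_sum h.K_zero_le h.K_pos h.add_le hα α.2.2 j
          hq hL (by positivity) (hxj j) hx
        simpa using this
    _ = _ := by simp

/-- A bound for the probability that a large set of nodes has no edges to a set of nodes of a
given class. -/
theorem Admissible.real_class_cut_le (h : Admissible μ K P) (hα : 0 < (α : ℝ)) {d : ℝ} (hd : 0 < d)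
    (j : Fin r) {t : ℕ} (ht : 1 ≤ d + t * ((α : ℝ) * (d ^ 2 / 8 * shareProb P (K 0) (K j))))
    (hρ : 4 / (K 0 * d ^ 2) ≤ 1) {S T : Finset (Fin n)} (hST : Disjoint S T) :
    (modelMeasure n μ K P α).real {ω | (∀ v ∈ T, (ω.1 v).1 = j) ∧
        ∀ u ∈ S, ∀ v ∈ T, ¬ (network ω).Adj u v}
      ≤ d ^ T.card + 2 ^ S.card * (4 / (K 0 * d ^ 2)) ^ (S.card + 1 - t) := by
  classical
  have hμj : μ j ≤ 1 := by
    rw [← h.μ_sum]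
    exact Finset.single_le_sum (fun i _ => h.μ_nonneg i) (Finset.mem_univ j)
  rw [h.real_class_cut hST]
  have hmain : ∀ y : S → Fin r × Finset (Fin P), (μ j * avoid (α : ℝ) (K j) y) ^ T.card
      ≤ d ^ T.card + (if d < avoid (α : ℝ) (K j) y then (1 : ℝ) else 0) := by
    intro y
    have h0 := avoid_nonneg α (K j) y
    have h1 := avoid_le_one α (h.le_pool j) y
    have h2 : μ j * avoid (α : ℝ) (K j) y ≤ avoid (α : ℝ) (K j) y :=
      mul_le_of_le_one_left h0 hμj
    have h3 : 0 ≤ μ j * avoid (α : ℝ) (K j) y := mul_nonneg (h.μ_nonneg j) h0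
    split_ifs with hy
    · have := pow_le_one₀ (n := T.card) h3 (h2.trans h1)
      have : 0 ≤ d ^ T.card := by positivity
      linarith
    · rw [add_zero]
      exact pow_le_pow_left₀ h3 (h2.trans (not_lt.1 hy)) _
  calc _ ≤ ∑ y : S → Fin r × Finset (Fin P), (∏ u, nodeWeight μ K P (y u)) *
        (d ^ T.card + (if d < avoid (α : ℝ) (K j) y then (1 : ℝ) else 0)) :=
        Finset.sum_le_sum fun y _ => mul_le_mul_of_nonneg_left (hmain y)
          (Finset.prod_nonneg fun u _ => nodeWeight_nonneg _ _ _ _)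
    _ = d ^ T.card + ∑ y : S → Fin r × Finset (Fin P), (∏ u, nodeWeight μ K P (y u)) *
          (if d < avoid (α : ℝ) (K j) y then (1 : ℝ) else 0) := by
        simp_rw [mul_add, Finset.sum_add_distrib, ← Finset.sum_mul, h.sum_prod_weight, one_mul]
    _ ≤ _ := by
        gcongr
        have := sum_lt_avoid_le_of_le (ι := S) h.μ_nonneg h.μ_sum h.K_zero_le h.K_pos h.add_le hα
          α.2.2 j hd ht hρ
        simpa using this

/-- It is unlikely that a class has few nodes. -/
theorem Admissible.real_few_class_le (h : Admissible μ K P) (j : Fin r) :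
    (modelMeasure n μ K P α).real
        {ω | ((Finset.univ.filter (fun v => (ω.1 v).1 = j)).card : ℝ) < μ j / 4 * n}
      ≤ Real.exp (-(μ j / 4 * n)) := by
  classical
  rw [modelMeasure_real]
  have hμj : 0 ≤ μ j := h.μ_nonneg j
  -- Chernoff's method with exponential parameter -1. Since e^(-1) ≤ 1/2, one node contributes a
  -- factor of at most e^(-μ_j/2).
  have h1 : ∀ x : Fin n → Fin r × Finset (Fin P),
      (SimpleGraph.binomialRandom (Fin n) α).real {G | (x, G) ∈ {ω : Sample n r P |
        ((Finset.univ.filter (fun v => (ω.1 v).1 = j)).card : ℝ) < μ j / 4 * n}}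
      ≤ Real.exp (μ j / 4 * n) * ∏ v, Real.exp (if (x v).1 = j then -1 else 0) := by
    intro x
    rw [← Real.exp_sum, ← Real.exp_add]
    have hs : ∑ v, (if (x v).1 = j then (-1 : ℝ) else 0)
        = -((Finset.univ.filter (fun v => (x v).1 = j)).card : ℝ) := by
      rw [← Finset.sum_filter, Finset.sum_const, nsmul_eq_mul, mul_neg, mul_one]
    rw [hs]
    by_cases hx : ((Finset.univ.filter (fun v => (x v).1 = j)).card : ℝ) < μ j / 4 * n
    · refine measureReal_le_one.trans (Real.one_le_exp ?_)
      linarith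
    · have : {G | (x, G) ∈ {ω : Sample n r P |
        ((Finset.univ.filter (fun v => (ω.1 v).1 = j)).card : ℝ) < μ j / 4 * n}} = ∅ := by
        ext G; simp [hx]
      rw [this]
      simp only [measureReal_empty]
      positivity
  have h2 : ∑ a, nodeWeight μ K P a * Real.exp (if a.1 = j then -1 else 0)
      ≤ Real.exp (-(μ j / 2)) := by
    rw [sum_nodeWeight_mul h.μ_nonneg]
    have h3 : ∀ i, μ i * avg (K i) (fun _ : Finset (Fin P) => Real.exp (if i = j then -1 else 0))
        ≤ μ i - (if i = j then μ j / 2 else 0) := by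
      intro i
      rw [avg_const (by simpa using h.le_pool i)]
      split_ifs with hi
      · subst hi
        have : Real.exp (-1) ≤ 1 / 2 := by
          rw [Real.exp_neg, one_div]
          exact inv_anti₀ (by norm_num) (by have := Real.add_one_le_exp (1 : ℝ); linarith)
        nlinarith
      · simp
    calc _ ≤ ∑ i, (μ i - (if i = j then μ j / 2 else 0)) := Finset.sum_le_sum fun i _ => h3 i
      _ = -(μ j / 2) + 1 := by
          rw [Finset.sum_sub_distrib, h.μ_sum]; simp; ring
      _ ≤ _ := Real.add_one_le_exp _
  have h0 : 0 ≤ ∑ a, nodeWeight μ K P a * Real.exp (if a.1 = j then -1 else 0) :=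
    Finset.sum_nonneg fun a _ => mul_nonneg (nodeWeight_nonneg _ _ _ _) (Real.exp_nonneg _)
  calc _ ≤ ∑ x : Fin n → Fin r × Finset (Fin P), (∏ v, nodeWeight μ K P (x v)) *
        (Real.exp (μ j / 4 * n) * ∏ v, Real.exp (if (x v).1 = j then -1 else 0)) :=
        Finset.sum_le_sum fun x _ => mul_le_mul_of_nonneg_left (h1 x)
          (Finset.prod_nonneg fun u _ => nodeWeight_nonneg _ _ _ _)
    _ = Real.exp (μ j / 4 * n) *
        (∑ a, nodeWeight μ K P a * Real.exp (if a.1 = j then -1 else 0)) ^ n := by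
        have := HeterogeneousKeyGraph.sum_prod_weight (ι := Fin n) (nodeWeight μ K P)
          (fun _ a => Real.exp (if a.1 = j then -1 else 0))
        rw [Finset.prod_const, Finset.card_univ, Fintype.card_fin] at this
        rw [← this, Finset.mul_sum]
        exact Finset.sum_congr rfl fun x _ => by ring
    _ ≤ Real.exp (μ j / 4 * n) * Real.exp (-(μ j / 2)) ^ n := by gcongr
    _ = _ := by
        rw [← Real.exp_nat_mul, ← Real.exp_add]
        congr 1
        ring

end Cut

/-! ### From disconnection to a union bound over cuts -/

/-- A disconnected graph has a nonempty set of at most half of the nodes without outgoing edges. -/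
theorem exists_cut_of_not_connected {n : ℕ} (hn : 0 < n) (G : SimpleGraph (Fin n))
    (hG : ¬ G.Connected) : ∃ S : Finset (Fin n), S.Nonempty ∧ 2 * S.card ≤ n ∧
      ∀ u ∈ S, ∀ v ∈ Sᶜ, ¬ G.Adj u v := by
  classical
  have : Nonempty (Fin n) := ⟨⟨0, hn⟩⟩
  have hpre : ¬ G.Preconnected := fun h => hG ⟨h⟩
  simp only [SimpleGraph.Preconnected, not_forall] at hpre
  obtain ⟨a, b, hab⟩ := hpre
  set S : Finset (Fin n) := Finset.univ.filter (fun w => G.Reachable a w) with hS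
  have hcut : ∀ u ∈ S, ∀ v ∈ Sᶜ, ¬ G.Adj u v := by
    intro u hu v hv hadj
    simp only [hS, Finset.mem_compl, Finset.mem_filter, Finset.mem_univ, true_and] at hu hv
    exact hv (hu.trans hadj.reachable)
  have hcard : S.card + Sᶜ.card = n := by
    rw [Finset.card_add_card_compl, Fintype.card_fin]
  rcases le_total (2 * S.card) n with h | h
  · exact ⟨S, ⟨a, by simp [hS]⟩, h, hcut⟩
  · refine ⟨Sᶜ, ⟨b, by simpa [hS] using hab⟩, by omega, ?_⟩
    intro u hu v hv hadj
    rw [compl_compl] at hv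
    exact hcut v hv u hu hadj.symm

/-- A disconnected network has a small cut, or few nodes of class `j`, or a large set of nodes
without edges to many nodes of class `j`. -/
theorem Admissible.real_not_connected_le {n r P : ℕ} [NeZero r] {μ : Fin r → ℝ} {K : Fin r → ℕ}
    {α : unitInterval} (h : Admissible μ K P) (hn : 0 < n) (j : Fin r) (η : ℝ) :
    (modelMeasure n μ K P α).real {ω | ¬ (network ω).Connected}
      ≤ ∑ S ∈ (Finset.univ : Finset (Finset (Fin n))).filter
            (fun S => S.Nonempty ∧ (S.card : ℝ) ≤ η * n),
          (modelMeasure n μ K P α).real {ω | ∀ u ∈ S, ∀ v ∈ Sᶜ, ¬ (network ω).Adj u v}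
        + Real.exp (-(μ j / 4 * n))
        + ∑ A ∈ (Finset.univ : Finset (Finset (Fin n) × Finset (Fin n))).filter
            (fun A => Disjoint A.1 A.2 ∧ η * n ≤ A.1.card ∧ μ j / 8 * n ≤ A.2.card),
          (modelMeasure n μ K P α).real {ω | (∀ v ∈ A.2, (ω.1 v).1 = j) ∧
            ∀ u ∈ A.1, ∀ v ∈ A.2, ¬ (network ω).Adj u v} := by
  classical
  have := h.isProbabilityMeasure (n := n) (α := α)
  set M := modelMeasure n μ K P α
  set F₁ := (Finset.univ : Finset (Finset (Fin n))).filter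
            (fun S => S.Nonempty ∧ (S.card : ℝ) ≤ η * n)
  set F₂ := (Finset.univ : Finset (Finset (Fin n) × Finset (Fin n))).filter
            (fun A => Disjoint A.1 A.2 ∧ η * n ≤ A.1.card ∧ μ j / 8 * n ≤ A.2.card)
  set E₁ : Set (Sample n r P) := ⋃ S ∈ F₁, {ω | ∀ u ∈ S, ∀ v ∈ Sᶜ, ¬ (network ω).Adj u v}
  set E₂ : Set (Sample n r P) :=
    {ω | ((Finset.univ.filter (fun v => (ω.1 v).1 = j)).card : ℝ) < μ j / 4 * n}
  set E₃ : Set (Sample n r P) := ⋃ A ∈ F₂, {ω | (∀ v ∈ A.2, (ω.1 v).1 = j) ∧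
            ∀ u ∈ A.1, ∀ v ∈ A.2, ¬ (network ω).Adj u v}
  have hsub : {ω : Sample n r P | ¬ (network ω).Connected} ⊆ E₁ ∪ E₂ ∪ E₃ := by
    intro ω hω
    obtain ⟨S, hS, hSn, hcut⟩ := exists_cut_of_not_connected hn (network ω) hω
    by_cases h1 : (S.card : ℝ) ≤ η * n
    · exact Or.inl (Or.inl (Set.mem_biUnion (Finset.mem_filter.2 ⟨Finset.mem_univ _, hS, h1⟩) hcut))
    by_cases h2 : ((Finset.univ.filter (fun v => (ω.1 v).1 = j)).card : ℝ) < μ j / 4 * n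
    · exact Or.inl (Or.inr h2)
    right
    push Not at h1 h2
    set J := Finset.univ.filter (fun v => (ω.1 v).1 = j) with hJ
    have hmemJ : ∀ v ∈ J, (ω.1 v).1 = j := fun v hv => (Finset.mem_filter.1 hv).2
    have hcard : (S.card : ℝ) + Sᶜ.card = n := by
      have := Finset.card_add_card_compl S
      rw [Fintype.card_fin] at this
      exact_mod_cast this
    have hSn' : 2 * (S.card : ℝ) ≤ n := by exact_mod_cast hSn
    have hJc : (J.card : ℝ) = (J ∩ S).card + (J ∩ Sᶜ).card := by
      have : (J ∩ S).card + (J ∩ Sᶜ).card = J.card := by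
        rw [← Finset.card_union_of_disjoint, ← Finset.inter_union_distrib_left,
          Finset.union_compl, Finset.inter_univ]
        exact Finset.disjoint_of_subset_left Finset.inter_subset_right
          (Finset.disjoint_of_subset_right Finset.inter_subset_right disjoint_compl_right)
      exact_mod_cast this.symm
    have hn0 : (0 : ℝ) ≤ n := Nat.cast_nonneg n
    -- One side of the cut holds half of the class-j nodes. If it is `S`, the complement plays the
    -- large set; it exceeds ηn because it is at least as big as `S`.
    rcases le_total (μ j / 8 * n) ((J ∩ Sᶜ).card : ℝ) with h3 | h3
    · refine Set.mem_biUnion (x := (S, J ∩ Sᶜ)) (Finset.mem_filter.2 ⟨Finset.mem_univ _, ?_, h1.le, h3⟩) ⟨?_, ?_⟩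
      · exact Finset.disjoint_of_subset_right Finset.inter_subset_right disjoint_compl_right
      · exact fun v hv => hmemJ v (Finset.inter_subset_left hv)
      · exact fun u hu v hv => hcut u hu v (Finset.inter_subset_right hv)
    · refine Set.mem_biUnion (x := (Sᶜ, J ∩ S)) (Finset.mem_filter.2 ⟨Finset.mem_univ _, ?_, ?_, ?_⟩) ⟨?_, ?_⟩
      · exact Finset.disjoint_of_subset_right Finset.inter_subset_right disjoint_compl_left
      · dsimp only
        nlinarith
      · dsimp only
        linarith
      · exact fun v hv => hmemJ v (Finset.inter_subset_left hv)
      · exact fun u hu v hv hadj => hcut v (Finset.inter_subset_right hv) u hu hadj.symm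
  calc M.real {ω | ¬ (network ω).Connected} ≤ M.real (E₁ ∪ E₂ ∪ E₃) := measureReal_mono hsub
    _ ≤ M.real E₁ + M.real E₂ + M.real E₃ :=
      (measureReal_union_le _ _).trans (by gcongr; exact measureReal_union_le _ _)
    _ ≤ _ := by
      gcongr
      · exact measureReal_biUnion_finset_le _ _
      · exact h.real_few_class_le j
      · exact measureReal_biUnion_finset_le _ _

/-- The binomial theorem gives (1 + b)^n ≤ e^(nb), and the empty set accounts for the 1. A bound
b^|S| on cuts is therefore summable as soon as nb → 0. -/
theorem sum_pow_card_le {n : ℕ} {b : ℝ} (hb : 0 ≤ b) :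
    ∑ S ∈ (Finset.univ : Finset (Finset (Fin n))).filter (fun S => S.Nonempty), b ^ S.card
      ≤ Real.exp (n * b) - 1 := by
  have h1 : ∑ S : Finset (Fin n), b ^ S.card = (b + 1) ^ n := by
    have := Fintype.sum_pow_mul_eq_add_pow (Fin n) b (1 : ℝ)
    simpa using this
  have h2 : (Finset.univ : Finset (Finset (Fin n))).filter (fun S => S.Nonempty)
      = Finset.univ.erase ∅ := by
    ext S
    simp [Finset.nonempty_iff_ne_empty]
  rw [h2]
  have h3 := Finset.sum_erase_add (Finset.univ : Finset (Finset (Fin n))) (fun S => b ^ S.card)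
    (Finset.mem_univ ∅)
  simp only [Finset.card_empty, pow_zero] at h3
  have h4 : (b + 1) ^ n ≤ Real.exp (n * b) := by
    rw [Real.exp_nat_mul]
    exact pow_le_pow_left₀ (by positivity) (Real.add_one_le_exp b) n
  linarith

/-- The sets of each size contribute exactly 1. Cut bounds carrying an inverse binomial coefficient
thus cost only a factor n + 1. -/
theorem sum_inv_choose_card (n : ℕ) :
    ∑ S : Finset (Fin n), ((n.choose S.card : ℕ) : ℝ)⁻¹ = n + 1 := by
  have h := Finset.sum_powerset_apply_card (x := (Finset.univ : Finset (Fin n)))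
    (fun m => ((n.choose m : ℕ) : ℝ)⁻¹)
  rw [Finset.powerset_univ, Finset.card_univ, Fintype.card_fin] at h
  rw [h]
  calc _ = ∑ m ∈ Finset.range (n + 1), (1 : ℝ) := by
        refine Finset.sum_congr rfl fun m hm => ?_
        have : (n.choose m : ℝ) ≠ 0 := by
          have := Nat.choose_pos (Nat.lt_succ_iff.1 (Finset.mem_range.1 hm))
          positivity
        rw [nsmul_eq_mul, mul_inv_cancel₀ this]
    _ = _ := by simp

/-- The entropy bound for binomial coefficients. -/
theorem choose_le_exp {n m : ℕ} (hm : 0 < m) (hmn : m ≤ n) :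
    (n.choose m : ℝ) ≤ Real.exp (m * (1 + Real.log (n / m))) := by
  have hm' : (0 : ℝ) < m := by exact_mod_cast hm
  have hn' : (0 : ℝ) < n := by exact_mod_cast (lt_of_lt_of_le hm hmn)
  rw [Real.exp_nat_mul, Real.exp_add, Real.exp_log (by positivity), mul_pow, ← Real.exp_nat_mul,
    mul_one]
  calc (n.choose m : ℝ) ≤ n ^ m / m.factorial := Nat.choose_le_pow_div m n
    _ = ((m : ℝ) ^ m / m.factorial) * (n / m) ^ m := by rw [div_pow]; field_simp
    _ ≤ _ := by
      gcongr
      exact Real.pow_div_factorial_le_exp _ hm'.le m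

/-- Apply log u ≤ u - 1 to u = 1/√y. Replacing the entropy by √y makes the failure probability of a
step a power of the density y. -/
theorem mul_one_add_log_inv_le {y : ℝ} (hy : 0 < y) :
    y * (1 + Real.log (1 / y)) ≤ 2 * Real.sqrt y := by
  have hs := Real.sqrt_pos.2 hy
  have h1 : Real.log (1 / y) = 2 * Real.log (1 / Real.sqrt y) := by
    rw [one_div, one_div, Real.log_inv, Real.log_inv, Real.log_sqrt hy.le]; ring
  have h2 : Real.log (1 / Real.sqrt y) ≤ 1 / Real.sqrt y - 1 := Real.log_le_sub_one_of_pos (by positivity)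
  have h3 : y = Real.sqrt y * Real.sqrt y := (Real.mul_self_sqrt hy.le).symm
  calc y * (1 + Real.log (1 / y)) ≤ y * (1 + 2 * (1 / Real.sqrt y - 1)) := by
        rw [h1]; gcongr
    _ = 2 * Real.sqrt y - y := by
        nth_rewrite 1 [h3]
        field_simp
        linear_combination h3
    _ ≤ _ := by linarith

theorem tendsto_log_nat : Tendsto (fun n : ℕ => Real.log n) atTop atTop :=
  Real.tendsto_log_atTop.comp tendsto_natCast_atTop_atTop

theorem eventually_mul_log_le_exp (C : ℝ) {a : ℝ} (ha : 0 < a) :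
    ∀ᶠ n : ℕ in atTop, C * Real.log n ≤ Real.exp (a * Real.log n) := by
  filter_upwards [tendsto_log_nat.eventually_ge_atTop 0,
    tendsto_log_nat.eventually_ge_atTop (2 * C / a ^ 2)] with n h0 h1
  rw [div_le_iff₀ (by positivity)] at h1
  have h2 := Real.quadratic_le_exp_of_nonneg (x := a * Real.log n) (by positivity)
  nlinarith [mul_nonneg ha.le h0, mul_le_mul_of_nonneg_right h1 h0]

/-- The three losses are 4/q in the drop of a successful step, 1/q in the proportion of successful
steps, and 1/q in the size of the complement. -/
theorem exists_loss_factor {c₁ : ℝ} (hc₁ : 1 < c₁) :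
    ∃ q : ℕ, 4 ≤ q ∧ 1 < (1 - 4 / (q : ℝ)) * (1 - 1 / (q : ℝ)) ^ 2 * c₁ := by
  have h1 : Tendsto (fun q : ℕ => (1 - 4 / (q : ℝ)) * (1 - 1 / (q : ℝ)) ^ 2 * c₁) atTop
      (𝓝 ((1 - 0) * (1 - 0) ^ 2 * c₁)) := by
    refine Tendsto.mul_const _ (Tendsto.mul ?_ (Tendsto.pow ?_ 2))
    · exact tendsto_const_nhds.sub (tendsto_const_div_atTop_nhds_zero_nat 4)
    · exact tendsto_const_nhds.sub (tendsto_const_div_atTop_nhds_zero_nat 1)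
  have h2 := h1.eventually (lt_mem_nhds (by simpa using hc₁ : (1 : ℝ) < (1 - 0) * (1 - 0) ^ 2 * c₁))
  obtain ⟨q, hq1, hq2⟩ := (h2.and (eventually_ge_atTop 4)).exists
  exact ⟨q, hq2, hq1⟩

/-! ### Small and medium cuts above the threshold -/

section Asymptotic

variable {r : ℕ} [NeZero r] {μ : Fin r → ℝ} {Θ : Scaling r} {μ₀ c₁ c₂ : ℝ}

theorem Admissible.meanEdge_nonneg {n : ℕ} (h : Admissible μ (Θ.K n) (Θ.P n)) :
    0 ≤ Θ.meanEdge μ n 0 :=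
  mul_nonneg (Θ.α_pos n).le
    (Finset.sum_nonneg fun j _ => mul_nonneg (h.μ_nonneg j) (h.share_nonneg j))

/-- For |S| up to n^(31/32), S takes up only a small part of the edge probability of an outside
node, so nearly every ring gives its full drop. The exponent θ > 1 leaves n·n^(-θ) → 0 in the union
bound. -/
theorem eventually_small_cut_le (hμ₀ : 0 < μ₀) (hμ : ∀ i, μ₀ ≤ μ i)
    (hadm : ∀ᶠ n in atTop, Admissible μ (Θ.K n) (Θ.P n))
    (hlo : ∀ᶠ n : ℕ in atTop, c₁ * (Real.log n / n) ≤ Θ.meanEdge μ n 0)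
    (hhi : ∀ᶠ n : ℕ in atTop, Θ.meanEdge μ n 0 ≤ c₂ * (Real.log n / n))
    (hK : Tendsto (fun n => Θ.K n 0) atTop atTop) (hc₁ : 1 < c₁) (hc₂ : 0 < c₂) :
    ∃ θ : ℝ, 1 < θ ∧ ∀ᶠ n : ℕ in atTop, ∀ S : Finset (Fin n), S.Nonempty →
      (S.card : ℝ) ≤ n * Real.exp (-(Real.log n / 32)) →
      (modelMeasure n μ (Θ.K n) (Θ.P n) (Θ.α n)).real
          {ω | ∀ u ∈ S, ∀ v ∈ Sᶜ, ¬ (network ω).Adj u v}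
        ≤ (2 * r * Real.exp (-(2 * Real.log n))) ^ S.card + Real.exp (-(θ * Real.log n)) ^ S.card := by
  obtain ⟨q, hq, hθ⟩ := exists_loss_factor hc₁
  refine ⟨_, hθ, ?_⟩
  have hqR : (4 : ℝ) ≤ q := by exact_mod_cast hq
  have hq1 : 1 / (q : ℝ) ≤ 1 := by rw [div_le_one (by linarith)]; linarith
  have hq4 : 4 / (q : ℝ) ≤ 1 := by rw [div_le_one (by linarith)]; linarith
  filter_upwards [hadm, hlo, hhi, hK.eventually_ge_atTop (q * (q * 128)), eventually_ge_atTop 3,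
    eventually_mul_log_le_exp (3 * (q : ℝ) ^ 2 * c₂ / μ₀) (a := 1 / 64) (by norm_num),
    tendsto_log_nat.eventually_ge_atTop 1,
    tendsto_log_nat.eventually_ge_atTop (32 * Real.log q)] with n h hlo hhi hK hn hC hℓ1 hℓq S hS hSn
  set ℓ := Real.log n with hℓ
  set Λ := Θ.meanEdge μ n 0 with hΛ
  set m := S.card with hm
  have hn0 : (0 : ℝ) < n := by exact_mod_cast (by omega : 0 < n)
  have hm1 : 1 ≤ m := hS.card_pos
  have hm1R : (1 : ℝ) ≤ m := by exact_mod_cast hm1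
  have hr1 : (1 : ℝ) ≤ r := by exact_mod_cast Nat.one_le_iff_ne_zero.2 (NeZero.ne r)
  have hΛ0 : 0 ≤ Λ := h.meanEdge_nonneg
  -- All but a fraction 1/q of the steps are asked to succeed, so missing the target takes at least
  -- m/q failures.
  set t := ⌈(1 - 1 / (q : ℝ)) * m⌉₊ with ht
  have ht1 : (1 - 1 / (q : ℝ)) * m ≤ t := Nat.le_ceil _
  have ht2 : (t : ℝ) < (1 - 1 / (q : ℝ)) * m + 1 :=
    Nat.ceil_lt_add_one (mul_nonneg (by linarith) (by linarith))
  have htm : t ≤ m := by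
    rw [ht, Nat.ceil_le]
    have : 0 ≤ 1 / (q : ℝ) := by positivity
    nlinarith
  have hX : 3 * (q : ℝ) ^ 2 * (t * Λ / μ₀) ≤ Real.exp (-(ℓ / 64)) := by
    have htm' : (t : ℝ) ≤ m := by exact_mod_cast htm
    calc 3 * (q : ℝ) ^ 2 * (t * Λ / μ₀)
        ≤ 3 * (q : ℝ) ^ 2 * ((n * Real.exp (-(ℓ / 32))) * (c₂ * (ℓ / n)) / μ₀) := by
          gcongr
          exact htm'.trans hSn
      _ = (3 * (q : ℝ) ^ 2 * c₂ / μ₀ * ℓ) * Real.exp (-(ℓ / 32)) := by field_simp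
      _ ≤ Real.exp (1 / 64 * ℓ) * Real.exp (-(ℓ / 32)) := by gcongr
      _ = _ := by rw [← Real.exp_add]; congr 1; ring
  have hX0 : 0 ≤ 3 * (q : ℝ) ^ 2 * (t * Λ / μ₀) := by positivity
  have hX1 : 3 * (q : ℝ) ^ 2 * (t * Λ / μ₀) ≤ 1 :=
    hX.trans (Real.exp_le_one_iff.2 (by linarith))
  refine (h.real_cut_le (Θ.α_pos n) hμ₀ hμ (Λ := Λ) rfl hq hK hX1 disjoint_compl_right).trans ?_
  refine add_le_add ?_ ?_
  -- With L = 128q, the at least m/q failures give the exponent 128m. The base is at most n^(-1/64),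
  -- hence n^(-2) per node.
  · have hexp : 128 * m ≤ q * 128 * (m + 1 - t) := by
      have h1 : (m : ℝ) ≤ q * ((m : ℝ) + 1 - t) := by
        have : (m : ℝ) / q ≤ (m : ℝ) + 1 - t := by
          have : (1 - 1 / (q : ℝ)) * m = m - m / q := by ring
          linarith
        rw [div_le_iff₀ (by linarith)] at this
        linarith
      have h2 : ((m + 1 - t : ℕ) : ℝ) = (m : ℝ) + 1 - t := by
        rw [Nat.cast_sub (by omega)]; push_cast; ring
      rw [← h2] at h1
      have h3 : m ≤ q * (m + 1 - t) := by exact_mod_cast h1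
      nlinarith
    calc (r : ℝ) * (2 ^ m * ((3 * (q : ℝ) ^ 2 * (t * Λ / μ₀)) ^ (q * 128)) ^ (m + 1 - t))
        ≤ (r : ℝ) ^ m * (2 ^ m * (Real.exp (-(ℓ / 64))) ^ (128 * m)) := by
          gcongr
          · exact le_self_pow₀ hr1 (by omega)
          · rw [← pow_mul]
            calc _ ≤ (3 * (q : ℝ) ^ 2 * (t * Λ / μ₀)) ^ (128 * m) :=
                  pow_le_pow_of_le_one hX0 hX1 hexp
              _ ≤ _ := by gcongr
      _ = (2 * r * (Real.exp (-(ℓ / 64)) ^ 128)) ^ m := by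
          rw [pow_mul, mul_pow, mul_pow]; ring
      _ = _ := by
          rw [← Real.exp_nat_mul]; congr 3; push_cast; ring
  · rw [← Real.exp_nat_mul, Real.exp_le_exp]
    have hTc : (Sᶜ.card : ℝ) = n - m := by
      have := Finset.card_add_card_compl S
      rw [Fintype.card_fin] at this
      rw [← hm] at this
      have h2 : (m : ℝ) + Sᶜ.card = n := by exact_mod_cast this
      linarith
    have hmn : (m : ℝ) ≤ n * (1 / q) := by
      refine hSn.trans ?_
      gcongr
      rw [one_div, ← Real.exp_log (by linarith : (0 : ℝ) < q), ← Real.exp_neg, Real.exp_le_exp]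
      linarith
    have hT : (1 - 1 / (q : ℝ)) * n ≤ Sᶜ.card := by rw [hTc]; linarith
    have hκ : 0 ≤ 1 - 4 / (q : ℝ) := by linarith
    have : ((1 - 1 / (q : ℝ)) * n) * (((1 - 1 / (q : ℝ)) * m) * ((1 - 4 / (q : ℝ)) * (c₁ * (ℓ / n))))
        ≤ Sᶜ.card * (t * ((1 - 4 / (q : ℝ)) * Λ)) := by
      have h1q : 0 ≤ 1 - 1 / (q : ℝ) := by linarith
      gcongr
    have h2 : ((1 - 1 / (q : ℝ)) * n) * (((1 - 1 / (q : ℝ)) * m) *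
        ((1 - 4 / (q : ℝ)) * (c₁ * (ℓ / n))))
        = m * ((1 - 4 / (q : ℝ)) * (1 - 1 / (q : ℝ)) ^ 2 * c₁ * ℓ) := by
      field_simp
    linarith

-- The number of successes demanded is matched to the entropy of choosing S. Success gives an
-- inverse square of the entropy bound for the binomial coefficient, while failure gives (constant ·
-- y²)^|S| with y = |S|/n, which also beats that coefficient for small y.
set_option maxHeartbeats 2000000 in
theorem eventually_medium_cut_le (hμ₀ : 0 < μ₀) (hμ : ∀ i, μ₀ ≤ μ i)
    (hadm : ∀ᶠ n in atTop, Admissible μ (Θ.K n) (Θ.P n))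
    (hlo : ∀ᶠ n : ℕ in atTop, c₁ * (Real.log n / n) ≤ Θ.meanEdge μ n 0)
    (hhi : ∀ᶠ n : ℕ in atTop, Θ.meanEdge μ n 0 ≤ c₂ * (Real.log n / n))
    (hK : Tendsto (fun n => Θ.K n 0) atTop atTop) (hc₁ : 1 < c₁) :
    ∃ η : ℝ, 0 < η ∧ ∀ᶠ n : ℕ in atTop, ∀ S : Finset (Fin n),
      n * Real.exp (-(Real.log n / 32)) ≤ S.card → (S.card : ℝ) ≤ η * n →
      (modelMeasure n μ (Θ.K n) (Θ.P n) (Θ.α n)).real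
          {ω | ∀ u ∈ S, ∀ v ∈ Sᶜ, ¬ (network ω).Adj u v}
        ≤ (r + 1) * Real.exp (-(2 * Real.log n)) * ((n.choose S.card : ℕ) : ℝ)⁻¹ := by
  set C := 4608 / μ₀ with hC
  have hC0 : 0 < C := by positivity
  -- The three terms make the complement at least n/2, the failure base C√y at most 1, and 2C⁴ey at
  -- most 1/2, respectively.
  set η : ℝ := min (1 / 12) (min (1 / C ^ 2) (1 / (12 * C ^ 4))) with hηdef
  have hη0 : 0 < η := by positivity
  have hη12 : η ≤ 1 / 12 := min_le_left _ _
  have hηC : η ≤ 1 / C ^ 2 := (min_le_right _ _).trans (min_le_left _ _)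
  have hηC4 : η ≤ 1 / (12 * C ^ 4) := (min_le_right _ _).trans (min_le_right _ _)
  refine ⟨η, hη0, ?_⟩
  filter_upwards [hadm, hlo, hhi, hK.eventually_ge_atTop (8 * 8), eventually_ge_atTop 3,
    tendsto_log_nat.eventually_ge_atTop 32,
    eventually_mul_log_le_exp 4 (a := 31 / 32) (by norm_num),
    eventually_mul_log_le_exp c₂ (a := 31 / 32) (by norm_num)]
    with n h hlo hhi hK hn hℓ32 hexp4 hexpc S hS1 hS2
  set ℓ := Real.log n with hℓ
  set Λ := Θ.meanEdge μ n 0 with hΛ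
  set m := S.card with hm
  have hn0 : (0 : ℝ) < n := by exact_mod_cast (by omega : 0 < n)
  have hS1' : Real.exp (31 / 32 * ℓ) ≤ m := by
    refine le_trans (le_of_eq ?_) hS1
    nth_rewrite 1 [← Real.exp_log hn0]
    rw [← Real.exp_add]
    congr 1
    ring
  have hm0 : (0 : ℝ) < m := lt_of_lt_of_le (Real.exp_pos _) hS1'
  have hm0' : 0 < m := by exact_mod_cast hm0
  have hm1R : (1 : ℝ) ≤ m := by exact_mod_cast hm0'
  have hmn : m ≤ n := by
    have : (m : ℝ) ≤ n := hS2.trans (by nlinarith)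
    exact_mod_cast this
  set y : ℝ := m / n with hy
  have hy0 : 0 < y := by positivity
  have hyη : y ≤ η := by rw [hy, div_le_iff₀ hn0]; exact hS2
  have hlog : Real.log (n / m) = Real.log (1 / y) := by rw [hy, one_div_div]
  have hlog0 : 0 ≤ Real.log (n / m) := Real.log_nonneg (by
    rw [le_div_iff₀ hm0, one_mul]; exact_mod_cast hmn)
  have hlogle : Real.log (n / m) ≤ ℓ / 32 := by
    rw [Real.log_div hn0.ne' hm0.ne']
    have : 31 / 32 * ℓ ≤ Real.log m := by rw [Real.le_log_iff_exp_le hm0]; exact hS1'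
    linarith
  -- Four times the entropy bound for log(n choose m), divided by n. The factor 4 pays for |Sᶜ| ≥
  -- n/2 and the drop factor 1/2, and together with tΛ ≥ 2ε still leaves twice the entropy.
  set ε : ℝ := 4 * (y * (1 + Real.log (n / m))) with hε
  have hε0 : 0 < ε := by positivity
  have hεy : ε ≤ 8 * Real.sqrt y := by
    have := mul_one_add_log_inv_le hy0
    rw [hε, hlog]; linarith
  have hnΛ : ℓ ≤ n * Λ := by
    calc ℓ ≤ c₁ * ℓ := by nlinarith
      _ = n * (c₁ * (ℓ / n)) := by field_simp
      _ ≤ _ := by gcongr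
  have hΛ0 : 0 < Λ := by
    by_contra hcon
    push Not at hcon
    nlinarith
  -- Needed because rounding `t` up adds at most Λ to tΛ, so 2ε ≤ tΛ ≤ 3ε.
  have hΛε : Λ ≤ ε := by
    calc Λ ≤ c₂ * (ℓ / n) := hhi
      _ = (c₂ * ℓ) / n := by ring
      _ ≤ m / n := by gcongr; exact hexpc.trans hS1'
      _ ≤ _ := by rw [hε]; nlinarith
  set t := ⌈2 * ε / Λ⌉₊ with ht
  have ht1 : 2 * ε / Λ ≤ t := Nat.le_ceil _
  have ht2 : (t : ℝ) < 2 * ε / Λ + 1 := Nat.ceil_lt_add_one (by positivity)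
  have ht1' : 2 * ε ≤ t * Λ := by rwa [div_le_iff₀ hΛ0] at ht1
  have ht2' : t * Λ ≤ 3 * ε := by
    have : (t : ℝ) * Λ < (2 * ε / Λ + 1) * Λ := by gcongr
    rw [add_mul, div_mul_cancel₀ _ hΛ0.ne'] at this
    linarith
  -- Since log(n/m) ≤ (log n)/32 and nΛ ≥ log n, at most about half of the steps are asked to
  -- succeed, so at least m/2 failures are required otherwise.
  have htm : m ≤ 2 * (m + 1 - t) := by
    have h1 : 2 * ε / Λ ≤ m / 2 := by
      rw [div_le_iff₀ hΛ0, hε, hy]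
      have h2 : 16 * (1 + Real.log (n / m)) ≤ n * Λ := by linarith
      calc 2 * (4 * ((m : ℝ) / n * (1 + Real.log (n / m))))
          = m / (2 * n) * (16 * (1 + Real.log (n / m))) := by field_simp; ring
        _ ≤ m / (2 * n) * (n * Λ) := by gcongr
        _ = _ := by field_simp
    have h3 : 2 * (t : ℝ) < m + 2 := by linarith
    have h4 : 2 * t < m + 2 := by exact_mod_cast h3
    omega
  have hX : 3 * ((8 : ℕ) : ℝ) ^ 2 * (t * Λ / μ₀) ≤ C * Real.sqrt y := by
    calc 3 * ((8 : ℕ) : ℝ) ^ 2 * (t * Λ / μ₀) ≤ 3 * ((8 : ℕ) : ℝ) ^ 2 * (3 * (8 * Real.sqrt y) / μ₀) := by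
          exact mul_le_mul_of_nonneg_left
            (div_le_div_of_nonneg_right (by linarith) hμ₀.le) (by positivity)
      _ = _ := by rw [hC]; push_cast; ring
  have hCy : C * Real.sqrt y ≤ 1 := by
    have h1 : Real.sqrt y ≤ Real.sqrt (1 / C ^ 2) := Real.sqrt_le_sqrt (hyη.trans hηC)
    rw [Real.sqrt_div zero_le_one, Real.sqrt_one, Real.sqrt_sq hC0.le, le_div_iff₀ hC0] at h1
    linarith
  have hX0 : 0 ≤ 3 * ((8 : ℕ) : ℝ) ^ 2 * (t * Λ / μ₀) := by positivity
  refine (h.real_cut_le (Θ.α_pos n) hμ₀ hμ (Λ := Λ) rfl (q := 8) (L := 8) (t := t) (by norm_num) hK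
    (hX.trans hCy) disjoint_compl_right).trans ?_
  have hchoose0 : (0 : ℝ) < (n.choose m : ℕ) := by exact_mod_cast Nat.choose_pos hmn
  rw [← div_eq_mul_inv, le_div_iff₀ hchoose0]
  have hent := choose_le_exp hm0' hmn
  have hent2 : Real.exp (m * (1 + Real.log (n / m))) = (Real.exp 1 / y) ^ m := by
    rw [Real.exp_nat_mul, Real.exp_add, Real.exp_log (by positivity), hy]
    congr 1
    field_simp
  have hfirst : (r : ℝ) * (2 ^ m * ((3 * ((8 : ℕ) : ℝ) ^ 2 * (t * Λ / μ₀)) ^ 8) ^ (m + 1 - t))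
      ≤ r * (2 * C ^ 4 * y ^ 2) ^ m := by
    have h1 : ((3 * ((8 : ℕ) : ℝ) ^ 2 * (t * Λ / μ₀)) ^ 8) ^ (m + 1 - t) ≤ (C ^ 4 * y ^ 2) ^ m := by
      calc _ ≤ ((C * Real.sqrt y) ^ 8) ^ (m + 1 - t) := by gcongr
        _ = (C * Real.sqrt y) ^ (4 * (2 * (m + 1 - t))) := by rw [← pow_mul]; congr 1; ring
        _ ≤ (C * Real.sqrt y) ^ (4 * m) := pow_le_pow_of_le_one (by positivity) hCy (by omega)
        _ = _ := by
          rw [pow_mul, mul_pow]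
          congr 2
          rw [show 4 = 2 * 2 from rfl, pow_mul, Real.sq_sqrt hy0.le]
    rw [mul_assoc 2, mul_pow 2]
    gcongr
  have hsecond : Real.exp (-(Sᶜ.card * (t * ((1 - 4 / ((8 : ℕ) : ℝ)) * Λ))))
      ≤ (Real.exp (m * (1 + Real.log (n / m))) ^ 2)⁻¹ := by
    have hTc : (n : ℝ) / 2 ≤ Sᶜ.card := by
      have := Finset.card_add_card_compl S
      rw [Fintype.card_fin] at this
      rw [← hm] at this
      have h2 : (m : ℝ) + Sᶜ.card = n := by exact_mod_cast this
      have : (m : ℝ) ≤ 1 / 12 * n := hS2.trans (by gcongr)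
      linarith
    rw [← Real.exp_nat_mul, ← Real.exp_neg, Real.exp_le_exp, neg_le_neg_iff]
    have h1 : (n : ℝ) / 2 * ε ≤ Sᶜ.card * (t * ((1 - 4 / ((8 : ℕ) : ℝ)) * Λ)) := by
      gcongr
      push_cast
      linarith
    refine le_trans (le_of_eq ?_) h1
    rw [hε, hy]
    push_cast
    field_simp
    ring
  have hhalf : (1 / 2 : ℝ) ^ m ≤ Real.exp (-(2 * ℓ)) := by
    have h1 : (1 / 2 : ℝ) ≤ Real.exp (-(1 / 2)) := by
      have := Real.add_one_le_exp (-(1 / 2) : ℝ)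
      linarith
    calc (1 / 2 : ℝ) ^ m ≤ Real.exp (-(1 / 2)) ^ m := by gcongr
      _ = Real.exp (-(m / 2)) := by rw [← Real.exp_nat_mul]; congr 1; ring
      _ ≤ _ := by
        rw [Real.exp_le_exp]
        have := hexp4.trans hS1'
        linarith
  have he := Real.exp_one_lt_three
  calc _ ≤ (r * (2 * C ^ 4 * y ^ 2) ^ m + (Real.exp (m * (1 + Real.log (n / m))) ^ 2)⁻¹)
        * Real.exp (m * (1 + Real.log (n / m))) := by gcongr
    _ = r * (2 * C ^ 4 * Real.exp 1 * y) ^ m + (y / Real.exp 1) ^ m := by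
        rw [add_mul]
        congr 1
        · rw [hent2, mul_assoc, ← mul_pow]
          congr 2
          field_simp
        · rw [sq, mul_inv, mul_assoc, inv_mul_cancel₀ (Real.exp_pos _).ne', mul_one, hent2,
            ← inv_pow, inv_div]
    _ ≤ r * (1 / 2) ^ m + (1 / 2) ^ m := by
        gcongr
        · calc 2 * C ^ 4 * Real.exp 1 * y ≤ 2 * C ^ 4 * 3 * (1 / (12 * C ^ 4)) := by
                gcongr
                exact hyη.trans hηC4
            _ = 1 / 2 := by field_simp; norm_num
        · linarith
        · have := Real.add_one_le_exp (1 : ℝ)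
          linarith
    _ = (r + 1) * (1 / 2) ^ m := by ring
    _ ≤ _ := by gcongr

end Asymptotic

/-! ### Large cuts and connectivity above the threshold -/

section Connected

variable {r : ℕ} [NeZero r] {μ : Fin r → ℝ} {Θ : Scaling r} {μ₀ c₁ c₂ : ℝ}

/-- A linear number of rings pushes the avoidance probability of class j below any constant d, since
t is o(n) and the failure probability per step tends to 0 with growing rings. The rate 3n is chosen
to beat the at most e^(2n) pairs (S, T). -/
theorem eventually_large_cut_le (hμ₀ : 0 < μ₀) (hμ : ∀ i, μ₀ ≤ μ i)
    (hadm : ∀ᶠ n in atTop, Admissible μ (Θ.K n) (Θ.P n))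
    (hlo : ∀ᶠ n : ℕ in atTop, c₁ * (Real.log n / n) ≤ Θ.meanEdge μ n 0)
    (hK : Tendsto (fun n => Θ.K n 0) atTop atTop) (hc₁ : 1 < c₁) {η : ℝ} (hη : 0 < η) :
    ∀ᶠ n : ℕ in atTop, ∀ j : Fin r, Θ.meanEdge μ n 0 ≤ (Θ.α n : ℝ) * Θ.p n 0 j →
      ∀ S T : Finset (Fin n), Disjoint S T → η * n ≤ S.card → μ j / 8 * n ≤ T.card →
      (modelMeasure n μ (Θ.K n) (Θ.P n) (Θ.α n)).real {ω | (∀ v ∈ T, (ω.1 v).1 = j) ∧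
          ∀ u ∈ S, ∀ v ∈ T, ¬ (network ω).Adj u v} ≤ 2 * Real.exp (-(3 * n)) := by
  -- With |T| ≥ μ₀n/8 this makes d^|T| at most e^(-3n).
  set d : ℝ := Real.exp (-(24 / μ₀)) with hd
  have hd0 : 0 < d := Real.exp_pos _
  have hKev : ∀ᶠ n in atTop, 4 * Real.exp (8 / η) / d ^ 2 ≤ (Θ.K n 0 : ℝ) :=
    (tendsto_natCast_atTop_atTop.comp hK).eventually_ge_atTop _
  filter_upwards [hadm, hlo, hKev, eventually_ge_atTop 3,
    tendsto_log_nat.eventually_ge_atTop (16 / (d ^ 2 * η)),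
    tendsto_log_nat.eventually_ge_atTop 1] with n h hlo hK hn hℓη hℓ1 j hj S T hST hS hT
  set ℓ := Real.log n with hℓ
  set Λ := Θ.meanEdge μ n 0 with hΛ
  have hn0 : (0 : ℝ) < n := by exact_mod_cast (by omega : 0 < n)
  have hΛℓ : ℓ / n ≤ Λ := by
    refine le_trans ?_ hlo
    have : 0 < ℓ / n := by positivity
    nlinarith
  have hΛ0 : 0 < Λ := lt_of_lt_of_le (by positivity) hΛℓ
  -- Enough steps of size at least d²Λ/8 to descend from 1 below d. Since t ≤ ηn/2 + 1 eventually,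
  -- at least ηn/2 of the steps must fail otherwise.
  set t := ⌈8 / (d ^ 2 * Λ)⌉₊ with ht
  have ht1 : 8 / (d ^ 2 * Λ) ≤ t := Nat.le_ceil _
  have ht2 : (t : ℝ) < 8 / (d ^ 2 * Λ) + 1 := Nat.ceil_lt_add_one (by positivity)
  have ht3 : 8 / (d ^ 2 * Λ) ≤ η * n / 2 := by
    rw [div_le_iff₀ (by positivity)]
    rw [div_le_iff₀ (by positivity)] at hℓη
    calc (8 : ℝ) = 16 / 2 := by norm_num
      _ ≤ ℓ * (d ^ 2 * η) / 2 := by gcongr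
      _ = η * n / 2 * (d ^ 2 * (ℓ / n)) := by field_simp
      _ ≤ _ := by gcongr
  have hρ : 4 / (Θ.K n 0 * d ^ 2) ≤ Real.exp (-(8 / η)) := by
    have hK0 : (0 : ℝ) < Θ.K n 0 := by exact_mod_cast h.K_pos
    rw [div_le_iff₀ (by positivity)] at hK
    rw [div_le_iff₀ (by positivity), Real.exp_neg]
    rw [← div_eq_inv_mul, le_div_iff₀ (Real.exp_pos _)]
    exact hK
  have hρ1 : 4 / (Θ.K n 0 * d ^ 2) ≤ 1 :=
    hρ.trans (Real.exp_le_one_iff.2 (by have : 0 ≤ 8 / η := by positivity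
                                        linarith))
  have htd : 1 ≤ d + t * ((Θ.α n : ℝ) * (d ^ 2 / 8 * shareProb (Θ.P n) (Θ.K n 0) (Θ.K n j))) := by
    have h1 : 1 ≤ t * (d ^ 2 / 8 * Λ) := by
      rw [div_le_iff₀ (by positivity)] at ht1
      linarith
    have h2 : t * (d ^ 2 / 8 * Λ)
        ≤ t * (d ^ 2 / 8 * ((Θ.α n : ℝ) * shareProb (Θ.P n) (Θ.K n 0) (Θ.K n j))) := by
      gcongr
      exact hj
    have h3 : t * (d ^ 2 / 8 * ((Θ.α n : ℝ) * shareProb (Θ.P n) (Θ.K n 0) (Θ.K n j)))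
        = t * ((Θ.α n : ℝ) * (d ^ 2 / 8 * shareProb (Θ.P n) (Θ.K n 0) (Θ.K n j))) := by ring
    linarith
  refine (h.real_class_cut_le (Θ.α_pos n) hd0 j htd hρ1 hST).trans ?_
  have hfirst : d ^ T.card ≤ Real.exp (-(3 * n)) := by
    rw [hd, ← Real.exp_nat_mul, Real.exp_le_exp]
    have h1 : μ₀ / 8 * n ≤ T.card := le_trans (by gcongr; exact hμ j) hT
    have h2 : μ₀ / 8 * n * (24 / μ₀) ≤ T.card * (24 / μ₀) := by gcongr
    have h3 : μ₀ / 8 * n * (24 / μ₀) = 3 * n := by field_simp; norm_num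
    linarith
  have hsecond : 2 ^ S.card * (4 / (Θ.K n 0 * d ^ 2)) ^ (S.card + 1 - t) ≤ Real.exp (-(3 * n)) := by
    have h1 : (2 : ℝ) ^ S.card ≤ Real.exp n := by
      have h2 : S.card ≤ n := by simpa using S.card_le_univ
      have h3 : (2 : ℝ) ≤ Real.exp 1 := by
        have := Real.add_one_le_exp (1 : ℝ)
        linarith
      calc (2 : ℝ) ^ S.card ≤ 2 ^ n := pow_le_pow_right₀ (by norm_num) h2
        _ ≤ Real.exp 1 ^ n := by gcongr
        _ = _ := by rw [← Real.exp_nat_mul, mul_one]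
    have h4 : (4 / (Θ.K n 0 * d ^ 2)) ^ (S.card + 1 - t) ≤ Real.exp (-(4 * n)) := by
      calc _ ≤ Real.exp (-(8 / η)) ^ (S.card + 1 - t) := by gcongr
        _ = Real.exp (-(((S.card + 1 - t : ℕ) : ℝ) * (8 / η))) := by
          rw [← Real.exp_nat_mul, mul_neg]
        _ ≤ _ := by
          rw [Real.exp_le_exp, neg_le_neg_iff]
          have h5 : (S.card : ℝ) + 1 - t ≤ ((S.card + 1 - t : ℕ) : ℝ) := by
            have : S.card + 1 ≤ (S.card + 1 - t) + t := by omega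
            have h6 : ((S.card + 1 : ℕ) : ℝ) ≤ ((S.card + 1 - t : ℕ) : ℝ) + t := by
              exact_mod_cast this
            push_cast at h6
            linarith
          have h7 : η * n / 2 ≤ ((S.card + 1 - t : ℕ) : ℝ) := by linarith
          calc 4 * (n : ℝ) = η * n / 2 * (8 / η) := by field_simp; norm_num
            _ ≤ _ := by gcongr
    calc _ ≤ Real.exp n * Real.exp (-(4 * n)) := by gcongr
      _ = _ := by rw [← Real.exp_add]; congr 1; ring
  linarith

/-- A mean cannot exceed all its terms. This class, which may vary with n, is the one used for large
cuts. -/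
theorem Admissible.exists_meanEdge_le {n : ℕ} (h : Admissible μ (Θ.K n) (Θ.P n)) :
    ∃ j, Θ.meanEdge μ n 0 ≤ (Θ.α n : ℝ) * Θ.p n 0 j := by
  by_contra hcon
  push Not at hcon
  have hα := Θ.α_pos n
  have h1 : ∀ j, Θ.p n 0 j < Θ.meanShare μ n 0 := fun j =>
    lt_of_mul_lt_mul_left (hcon j) hα.le
  obtain ⟨j, hj⟩ : ∃ j, 0 < μ j := by
    by_contra hneg
    push Not at hneg
    have := Finset.sum_nonpos (s := Finset.univ) fun i _ => hneg i
    rw [h.μ_sum] at this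
    linarith
  have h3 : ∑ j, μ j * Θ.p n 0 j < ∑ j, μ j * Θ.meanShare μ n 0 :=
    Finset.sum_lt_sum (fun i _ => mul_le_mul_of_nonneg_left (h1 i).le (h.μ_nonneg i))
      ⟨j, Finset.mem_univ j, mul_lt_mul_of_pos_left (h1 j) hj⟩
  rw [← Finset.sum_mul, h.μ_sum, one_mul] at h3
  exact lt_irrefl _ h3

theorem tendsto_mul_exp_neg_log {a : ℝ} (ha : 1 < a) :
    Tendsto (fun n : ℕ => (n : ℝ) * Real.exp (-(a * Real.log n))) atTop (𝓝 0) := by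
  have h1 : Tendsto (fun n : ℕ => Real.exp ((1 - a) * Real.log n)) atTop (𝓝 0) :=
    Real.tendsto_exp_atBot.comp (tendsto_log_nat.const_mul_atTop_of_neg (by linarith))
  refine h1.congr' ?_
  filter_upwards [eventually_ge_atTop 1] with n hn
  have hn0 : (0 : ℝ) < n := by exact_mod_cast hn
  nth_rewrite 2 [← Real.exp_log hn0]
  rw [← Real.exp_add]
  congr 1
  ring

/-- Above the threshold the network is connected with high probability. -/
theorem tendsto_not_connected (hμ₀ : 0 < μ₀) (hμ : ∀ i, μ₀ ≤ μ i)
    (hadm : ∀ᶠ n in atTop, Admissible μ (Θ.K n) (Θ.P n))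
    (hlo : ∀ᶠ n : ℕ in atTop, c₁ * (Real.log n / n) ≤ Θ.meanEdge μ n 0)
    (hhi : ∀ᶠ n : ℕ in atTop, Θ.meanEdge μ n 0 ≤ c₂ * (Real.log n / n))
    (hK : Tendsto (fun n => Θ.K n 0) atTop atTop) (hc₁ : 1 < c₁) (hc₂ : 0 < c₂) :
    Tendsto (fun n => Θ.prob μ n (fun G => ¬ G.Connected)) atTop (𝓝 0) := by
  obtain ⟨θ, hθ, hsmall⟩ := eventually_small_cut_le hμ₀ hμ hadm hlo hhi hK hc₁ hc₂
  obtain ⟨η, hη0, hmedium⟩ := eventually_medium_cut_le hμ₀ hμ hadm hlo hhi hK hc₁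
  have hlarge := eventually_large_cut_le hμ₀ hμ hadm hlo hK hc₁ hη0
  set b : ℕ → ℝ := fun n => (Real.exp (n * (2 * r * Real.exp (-(2 * Real.log n)))) - 1)
    + (Real.exp (n * Real.exp (-(θ * Real.log n))) - 1)
    + (r + 1) * Real.exp (-(2 * Real.log n)) * (n + 1)
    + Real.exp (-(μ₀ / 4 * n)) + 2 * Real.exp (-(n : ℝ)) with hb
  have hb0 : Tendsto b atTop (𝓝 0) := by
    have h2 := tendsto_mul_exp_neg_log (a := 2) (by norm_num)
    have h3 := tendsto_mul_exp_neg_log hθ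
    have e1 : Tendsto (fun n : ℕ => Real.exp (n * (2 * r * Real.exp (-(2 * Real.log n)))) - 1)
        atTop (𝓝 0) := by
      have : Tendsto (fun n : ℕ => (n : ℝ) * (2 * r * Real.exp (-(2 * Real.log n)))) atTop (𝓝 0) := by
        have := h2.const_mul (2 * (r : ℝ))
        rw [mul_zero] at this
        exact this.congr fun n => by ring
      have := (Real.continuous_exp.tendsto 0).comp this
      rw [Real.exp_zero] at this
      simpa using this.sub_const 1
    have e2 : Tendsto (fun n : ℕ => Real.exp (n * Real.exp (-(θ * Real.log n))) - 1)
        atTop (𝓝 0) := by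
      have := (Real.continuous_exp.tendsto 0).comp h3
      rw [Real.exp_zero] at this
      simpa using this.sub_const 1
    have e3 : Tendsto (fun n : ℕ => (r + 1) * Real.exp (-(2 * Real.log n)) * (n + 1))
        atTop (𝓝 0) := by
      have h4 : Tendsto (fun n : ℕ => Real.exp (-(2 * Real.log n))) atTop (𝓝 0) := by
        refine Real.tendsto_exp_atBot.comp (tendsto_neg_atTop_atBot.comp ?_)
        exact tendsto_log_nat.const_mul_atTop (by norm_num)
      have := (h2.add h4).const_mul ((r : ℝ) + 1)
      rw [add_zero, mul_zero] at this
      exact this.congr fun n => by ring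
    have e4 : Tendsto (fun n : ℕ => Real.exp (-(μ₀ / 4 * n))) atTop (𝓝 0) := by
      refine Real.tendsto_exp_atBot.comp (tendsto_neg_atTop_atBot.comp ?_)
      exact tendsto_natCast_atTop_atTop.const_mul_atTop (by positivity)
    have e5 : Tendsto (fun n : ℕ => 2 * Real.exp (-(n : ℝ))) atTop (𝓝 0) := by
      have : Tendsto (fun n : ℕ => Real.exp (-(n : ℝ))) atTop (𝓝 0) :=
        Real.tendsto_exp_atBot.comp (tendsto_neg_atTop_atBot.comp tendsto_natCast_atTop_atTop)
      simpa using this.const_mul 2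
    simpa using (((e1.add e2).add e3).add e4).add e5
  refine squeeze_zero' (Eventually.of_forall fun n => measureReal_nonneg) ?_ hb0
  filter_upwards [hsmall, hmedium, hlarge, hadm, eventually_ge_atTop 1]
    with n hsmall hmedium hlarge h hn
  obtain ⟨j, hj⟩ := h.exists_meanEdge_le
  refine (h.real_not_connected_le (α := Θ.α n) (by omega) j η).trans ?_
  have p1 : 0 ≤ 2 * r * Real.exp (-(2 * Real.log n)) := by positivity
  have p2 : 0 ≤ Real.exp (-(θ * Real.log n)) := by positivity
  refine add_le_add (add_le_add ?_ ?_) ?_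
  · set b₁ := 2 * r * Real.exp (-(2 * Real.log n))
    set b₂ := Real.exp (-(θ * Real.log n))
    set b₃ := (r + 1) * Real.exp (-(2 * Real.log n))
    have p3 : 0 ≤ b₃ := by positivity
    have hS : ∀ S ∈ (Finset.univ : Finset (Finset (Fin n))).filter
        (fun S => S.Nonempty ∧ (S.card : ℝ) ≤ η * n),
        (modelMeasure n μ (Θ.K n) (Θ.P n) (Θ.α n)).real
          {ω | ∀ u ∈ S, ∀ v ∈ Sᶜ, ¬ (network ω).Adj u v}
          ≤ b₁ ^ S.card + b₂ ^ S.card + b₃ * ((n.choose S.card : ℕ) : ℝ)⁻¹ := by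
      intro S hS
      obtain ⟨-, hS1, hS2⟩ := Finset.mem_filter.1 hS
      have q1 : 0 ≤ b₁ ^ S.card := pow_nonneg p1 _
      have q2 : 0 ≤ b₂ ^ S.card := pow_nonneg p2 _
      have q3 : 0 ≤ b₃ * ((n.choose S.card : ℕ) : ℝ)⁻¹ := by positivity
      rcases le_total (S.card : ℝ) (n * Real.exp (-(Real.log n / 32))) with hc | hc
      · have := hsmall S hS1 hc
        linarith
      · have := hmedium S hc hS2
        linarith
    refine (Finset.sum_le_sum hS).trans ?_
    rw [Finset.sum_add_distrib, Finset.sum_add_distrib]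
    have hmono : ∀ f : Finset (Fin n) → ℝ, (∀ S, 0 ≤ f S) →
        ∑ S ∈ (Finset.univ : Finset (Finset (Fin n))).filter
          (fun S => S.Nonempty ∧ (S.card : ℝ) ≤ η * n), f S
        ≤ ∑ S ∈ (Finset.univ : Finset (Finset (Fin n))).filter (fun S => S.Nonempty), f S := by
      intro f hf
      refine Finset.sum_le_sum_of_subset_of_nonneg ?_ fun S _ _ => hf S
      exact fun S hS => Finset.mem_filter.2 ⟨Finset.mem_univ _, (Finset.mem_filter.1 hS).2.1⟩
    refine add_le_add (add_le_add ?_ ?_) ?_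
    · exact (hmono _ fun S => pow_nonneg p1 _).trans (sum_pow_card_le p1)
    · exact (hmono _ fun S => pow_nonneg p2 _).trans (sum_pow_card_le p2)
    · rw [← Finset.mul_sum, ← sum_inv_choose_card]
      refine mul_le_mul_of_nonneg_left ?_ p3
      exact Finset.sum_le_univ_sum_of_nonneg fun S => by positivity
  · rw [Real.exp_le_exp, neg_le_neg_iff]
    gcongr
    exact hμ j
  · set F := (Finset.univ : Finset (Finset (Fin n) × Finset (Fin n))).filter
            (fun A => Disjoint A.1 A.2 ∧ η * n ≤ A.1.card ∧ μ j / 8 * n ≤ A.2.card)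
    have h1 : (F.card : ℝ) ≤ Real.exp (2 * n) := by
      have h2 : F.card ≤ 2 ^ n * 2 ^ n := by
        refine (Finset.card_le_univ F).trans_eq ?_
        simp
      have h3 : (2 : ℝ) ≤ Real.exp 1 := by
        have := Real.add_one_le_exp (1 : ℝ)
        linarith
      calc (F.card : ℝ) ≤ 2 ^ n * 2 ^ n := by exact_mod_cast h2
        _ ≤ Real.exp 1 ^ n * Real.exp 1 ^ n := by gcongr
        _ = _ := by rw [← Real.exp_nat_mul, ← Real.exp_add]; congr 1; ring
    calc _ ≤ ∑ _A ∈ F, 2 * Real.exp (-(3 * (n : ℝ))) := by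
          refine Finset.sum_le_sum fun A hA => ?_
          obtain ⟨-, hA1, hA2, hA3⟩ := Finset.mem_filter.1 hA
          exact hlarge j hj A.1 A.2 hA1 hA2 hA3
      _ = F.card * (2 * Real.exp (-(3 * (n : ℝ)))) := by rw [Finset.sum_const, nsmul_eq_mul]
      _ ≤ Real.exp (2 * n) * (2 * Real.exp (-(3 * (n : ℝ)))) := by gcongr
      _ = 2 * (Real.exp (2 * n) * Real.exp (-(3 * (n : ℝ)))) := by ring
      _ = _ := by rw [← Real.exp_add]; congr 2; ring

end Connected

/-! ### Isolated nodes of the first class -/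

/-- The second moment method for events of equal probability. -/
theorem real_iInter_compl_le {Ω : Type*} [MeasurableSpace Ω] {M : Measure Ω}
    [IsProbabilityMeasure M] {n : ℕ} (hn : 0 < n) {I : Fin n → Set Ω}
    (hI : ∀ v, MeasurableSet (I v)) {a b : ℝ} (ha : 0 < a) (hb : 0 ≤ b)
    (h1 : ∀ v, M.real (I v) = a) (h2 : ∀ u v, u ≠ v → M.real (I u ∩ I v) ≤ b) :
    M.real (⋂ v, (I v)ᶜ) ≤ 1 / (n * a) + (b / a ^ 2 - 1) := by
  have hn0 : (0 : ℝ) < n := by exact_mod_cast hn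
  set Z : Ω → ℝ := fun ω => ∑ v, (I v).indicator 1 ω with hZ
  have hint : ∀ v, Integrable ((I v).indicator (1 : Ω → ℝ)) M := fun v =>
    (integrable_const (1 : ℝ)).indicator (hI v)
  have hint2 : ∀ u v, Integrable ((I u ∩ I v).indicator (1 : Ω → ℝ)) M := fun u v =>
    (integrable_const (1 : ℝ)).indicator ((hI u).inter (hI v))
  have hEZ : ∫ ω, Z ω ∂M = n * a := by
    rw [hZ, integral_finsetSum _ fun v _ => hint v]
    simp [integral_indicator_one (hI _), h1]
  have hZ2 : ∀ ω, Z ω ^ 2 = ∑ u, ∑ v, (I u ∩ I v).indicator 1 ω := by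
    intro ω
    rw [hZ, sq, Finset.sum_mul_sum]
    refine Finset.sum_congr rfl fun u _ => Finset.sum_congr rfl fun v _ => ?_
    rw [Set.inter_indicator_one]
    rfl
  have hintZ : Integrable Z M := integrable_finsetSum _ fun v _ => hint v
  have hintZ2 : Integrable (fun ω => Z ω ^ 2) M := by
    simp_rw [hZ2]
    exact integrable_finsetSum _ fun u _ => integrable_finsetSum _ fun v _ => hint2 u v
  have hEZ2 : ∫ ω, Z ω ^ 2 ∂M ≤ n * a + n ^ 2 * b := by
    simp_rw [hZ2]
    rw [integral_finsetSum _ fun u _ => integrable_finsetSum _ fun v _ => hint2 u v]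
    calc _ = ∑ u, ∑ v, M.real (I u ∩ I v) := by
          refine Finset.sum_congr rfl fun u _ => ?_
          rw [integral_finsetSum _ fun v _ => hint2 u v]
          exact Finset.sum_congr rfl fun v _ => integral_indicator_one ((hI u).inter (hI v))
      _ ≤ ∑ u, ∑ v, ((if u = v then a else 0) + b) := by
          gcongr with u _ v _
          split_ifs with huv
          · subst huv
            rw [Set.inter_self, h1]
            linarith
          · rw [zero_add]
            exact h2 u v huv
      _ = _ := by
          simp_rw [Finset.sum_add_distrib]
          simp
          ring
  have hE : MeasurableSet (⋂ v, (I v)ᶜ) := MeasurableSet.iInter fun v => (hI v).compl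
  -- Chebyshev: where no event occurs, (Z - na)² equals (na)².
  have hkey : (n * a) ^ 2 * M.real (⋂ v, (I v)ᶜ) ≤ n * a + n ^ 2 * b - (n * a) ^ 2 := by
    have h3 : ∫ ω, (n * a) ^ 2 * (⋂ v, (I v)ᶜ).indicator (1 : Ω → ℝ) ω ∂M
        ≤ ∫ ω, (Z ω ^ 2 - 2 * (n * a) * Z ω + (n * a) ^ 2) ∂M := by
      refine integral_mono (((integrable_const (1 : ℝ)).indicator hE).const_mul _)
        ((hintZ2.sub (hintZ.const_mul _)).add (integrable_const _)) fun ω => ?_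
      dsimp only
      by_cases hω : ω ∈ ⋂ v, (I v)ᶜ
      · have hz : Z ω = 0 := by
          refine Finset.sum_eq_zero fun v _ => Set.indicator_of_notMem ?_ _
          exact Set.mem_iInter.1 hω v
        rw [Set.indicator_of_mem hω, hz]
        simp
      · rw [Set.indicator_of_notMem hω]
        nlinarith [sq_nonneg (Z ω - n * a)]
    have h4 : ∫ ω, (Z ω ^ 2 - 2 * (n * a) * Z ω + (n * a) ^ 2) ∂M
        = (∫ ω, Z ω ^ 2 ∂M) - 2 * (n * a) * (n * a) + (n * a) ^ 2 := by
      have hi : Integrable (fun ω => Z ω ^ 2 - 2 * (n * a) * Z ω) M :=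
        hintZ2.sub (hintZ.const_mul _)
      rw [integral_add hi (integrable_const _), integral_sub hintZ2 (hintZ.const_mul _),
        integral_const_mul, hEZ]
      simp
    rw [integral_const_mul, integral_indicator_one hE, h4] at h3
    nlinarith
  have hna : 0 < n * a := by positivity
  have h4 : M.real (⋂ v, (I v)ᶜ) ≤ (n * a + n ^ 2 * b - (n * a) ^ 2) / (n * a) ^ 2 := by
    rw [le_div_iff₀ (by positivity)]
    linarith
  refine h4.trans (le_of_eq ?_)
  field_simp
  ring

section Isolated

variable {n r P : ℕ} {μ : Fin r → ℝ} {K : Fin r → ℕ} {α : unitInterval}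

theorem nodeWeight_eq_zero (hμ : ∀ i, 0 ≤ μ i) {a : Fin r × Finset (Fin P)}
    (ha : a.2.card ≠ K a.1) : nodeWeight μ K P a = 0 := by
  classical
  have h := sum_nodeWeight_mul hμ (K := K) (P := P) (fun b => if b = a then 1 else 0)
  simp only [mul_ite, mul_one, mul_zero, Finset.sum_ite_eq', Finset.mem_univ, if_true] at h
  rw [h]
  refine Finset.sum_eq_zero fun i _ => mul_eq_zero_of_right _ ?_
  rw [avg]
  rw [Finset.sum_eq_zero, zero_div]
  intro S hS
  rw [if_neg]
  rintro rfl
  exact ha (Finset.mem_powersetCard_univ.1 hS)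

/-- Configurations whose ring sizes disagree with their classes carry no weight, so pointwise
estimates may assume the right sizes. -/
theorem sum_prod_weight_congr {ι : Type*} [Fintype ι] [DecidableEq ι] (hμ : ∀ i, 0 ≤ μ i)
    {f g : (ι → Fin r × Finset (Fin P)) → ℝ}
    (h : ∀ y, (∀ i, (y i).2.card = K (y i).1) → f y ≤ g y) :
    ∑ y, (∏ i, nodeWeight μ K P (y i)) * f y ≤ ∑ y, (∏ i, nodeWeight μ K P (y i)) * g y := by
  refine Finset.sum_le_sum fun y _ => ?_
  by_cases hy : ∀ i, (y i).2.card = K (y i).1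
  · exact mul_le_mul_of_nonneg_left (h y hy)
      (Finset.prod_nonneg fun u _ => nodeWeight_nonneg _ _ _ _)
  · push Not at hy
    obtain ⟨i, hi⟩ := hy
    rw [Finset.prod_eq_zero (Finset.mem_univ i) (nodeWeight_eq_zero hμ hi)]
    simp

/-- Average the symmetric `hit` over both rings, in either order. -/
theorem shareProb_comm {k l : ℕ} (h : k + l ≤ P) : shareProb P k l = shareProb P l k := by
  have h1 : avg k (fun S : Finset (Fin P) => avg l (fun T : Finset (Fin P) => hit S T))
      = shareProb P k l := by
    rw [avg_congr (g := fun _ => shareProb P k l) fun S hS => ?_, avg_const (by simp; omega)]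
    have := avg_hit S (k := l) (by simp; omega)
    rw [hS, Fintype.card_fin] at this
    exact this
  have h2 : avg l (fun T : Finset (Fin P) => avg k (fun S : Finset (Fin P) => hit S T))
      = shareProb P l k := by
    rw [avg_congr (g := fun _ => shareProb P l k) fun T hT => ?_, avg_const (by simp; omega)]
    have := avg_hit T (k := k) (by simp; omega)
    rw [hT, Fintype.card_fin] at this
    rw [← this]
    exact avg_congr fun S _ => hit_comm S T
  rw [← h1, ← h2, avg_comm]

variable [NeZero r]

theorem Admissible.sum_first_class (h : Admissible μ K P) (ι : Type*) [Fintype ι] [DecidableEq ι] :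
    ∑ y : ι → Fin r × Finset (Fin P), (∏ i, nodeWeight μ K P (y i)) *
      (if ∀ i, (y i).1 = 0 then 1 else 0) = μ 0 ^ Fintype.card ι := by
  have h1 := HeterogeneousKeyGraph.sum_prod_weight (ι := ι) (nodeWeight μ K P) (fun _ a => if a.1 = 0 then (1 : ℝ) else 0)
  rw [sum_nodeWeight_mul h.μ_nonneg] at h1
  have h2 : ∑ i, μ i * avg (K i) (fun _ : Finset (Fin P) => if i = 0 then (1 : ℝ) else 0) = μ 0 := by
    rw [Finset.sum_eq_single 0]
    · rw [avg_const (by simpa using h.le_pool 0)]; simp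
    · intro i _ hi
      rw [avg_const (by simpa using h.le_pool i)]; simp [hi]
    · simp
  rw [h2, Finset.prod_const, Finset.card_univ] at h1
  rw [← h1]
  refine Finset.sum_congr rfl fun y _ => ?_
  congr 1
  split_ifs with hy
  · simp [hy]
  · push Not at hy
    obtain ⟨i, hi⟩ := hy
    rw [Finset.prod_eq_zero (Finset.mem_univ i) (by rw [if_neg hi])]

theorem avg_hit_first (h : Admissible μ K P) (i : Fin r) {T : Finset (Fin P)} (hT : T.card = K 0) :
    avg (K i) (hit T) = shareProb P (K 0) (K i) := by
  rw [avg_hit T (by rw [hT]; simpa using h.add_le 0 i), hT, Fintype.card_fin]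

/-- The probability that a given node is in the first class and isolated. -/
theorem Admissible.real_isolated (h : Admissible μ K P) (v : Fin n) :
    (modelMeasure n μ K P α).real {ω | (ω.1 v).1 = 0 ∧ ∀ w ∈ ({v} : Finset (Fin n))ᶜ,
        ¬ (network ω).Adj v w}
      = μ 0 * (1 - (α : ℝ) * ∑ j, μ j * shareProb P (K 0) (K j)) ^ (n - 1) := by
  classical
  have h1 := h.real_no_edges (n := n) (α := α) (S := {v}) (T := {v}ᶜ) disjoint_compl_right
    (fun y => ∀ u, (y u).1 = 0) (fun _ => True)
  have h2 : {ω : Sample n r P | ((∀ u : ({v} : Finset (Fin n)), (ω.1 u).1 = 0) ∧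
      ∀ w ∈ ({v} : Finset (Fin n))ᶜ, True) ∧
      ∀ u ∈ ({v} : Finset (Fin n)), ∀ w ∈ ({v} : Finset (Fin n))ᶜ, ¬ (network ω).Adj u w}
      = {ω | (ω.1 v).1 = 0 ∧ ∀ w ∈ ({v} : Finset (Fin n))ᶜ, ¬ (network ω).Adj v w} := by
    ext ω
    simp
  rw [h2] at h1
  rw [h1]
  have hc : (({v} : Finset (Fin n))ᶜ).card = n - 1 := by
    rw [Finset.card_compl, Fintype.card_fin, Finset.card_singleton]
  have h3 : ∀ y : ({v} : Finset (Fin n)) → Fin r × Finset (Fin P),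
      (∀ i, (y i).2.card = K (y i).1) →
      (if ∀ u, (y u).1 = 0 then (1 : ℝ) else 0) *
          (∑ i, μ i * (if True then avoid (α : ℝ) (K i) y else 0)) ^ (({v} : Finset (Fin n))ᶜ).card
        = (if ∀ u, (y u).1 = 0 then (1 : ℝ) else 0) *
          (1 - (α : ℝ) * ∑ j, μ j * shareProb P (K 0) (K j)) ^ (n - 1) := by
    intro y hy
    split_ifs with h0
    · rw [hc]
      congr 2
      have h4 : ∀ i, avoid (α : ℝ) (K i) y = 1 - (α : ℝ) * shareProb P (K 0) (K i) := by
        intro i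
        unfold avoid
        have h5 : ∀ s, ∏ u, (1 - (α : ℝ) * hit (y u).2 s)
            = 1 - (α : ℝ) * hit (y ⟨v, by simp⟩).2 s := fun s =>
          Fintype.prod_unique _
        rw [avg_congr fun s _ => h5 s, avg_sub, avg_const (by simpa using h.le_pool i),
          avg_const_mul, avg_hit_first h i (by rw [hy, h0])]
      simp_rw [h4, mul_sub, mul_one, Finset.sum_sub_distrib, h.μ_sum, Finset.mul_sum]
      congr 1
      exact Finset.sum_congr rfl fun i _ => by ring
    · simp
  have h6 : ∑ y : ({v} : Finset (Fin n)) → Fin r × Finset (Fin P),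
      (∏ u, nodeWeight μ K P (y u)) * ((if ∀ u, (y u).1 = 0 then (1 : ℝ) else 0) *
          (∑ i, μ i * (if True then avoid (α : ℝ) (K i) y else 0)) ^ (({v} : Finset (Fin n))ᶜ).card)
      = ∑ y : ({v} : Finset (Fin n)) → Fin r × Finset (Fin P),
      (∏ u, nodeWeight μ K P (y u)) * ((if ∀ u, (y u).1 = 0 then (1 : ℝ) else 0) *
          (1 - (α : ℝ) * ∑ j, μ j * shareProb P (K 0) (K j)) ^ (n - 1)) :=
    le_antisymm (sum_prod_weight_congr h.μ_nonneg fun y hy => (h3 y hy).le)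
      (sum_prod_weight_congr h.μ_nonneg fun y hy => (h3 y hy).ge)
  rw [h6]
  simp_rw [← mul_assoc, ← Finset.sum_mul, h.sum_first_class]
  simp

-- Given both rings, a third node misses them with probability 1 - 2Λ + α²H, where H is its chance
-- of hitting both. The power is linearized in H, whose expectation factorizes once the third ring
-- is fixed.
set_option maxHeartbeats 1600000 in
theorem Admissible.real_two_isolated_le (h : Admissible μ K P) {μ₀ Λ : ℝ} (hμ₀ : 0 < μ₀)
    (hμ : ∀ i, μ₀ ≤ μ i) (hΛ : Λ = (α : ℝ) * ∑ j, μ j * shareProb P (K 0) (K j)) (hΛ1 : Λ < 1)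
    {u v : Fin n} (huv : u ≠ v) :
    (modelMeasure n μ K P α).real {ω | ((ω.1 u).1 = 0 ∧ (ω.1 v).1 = 0) ∧
        ∀ a ∈ ({u, v} : Finset (Fin n)), ∀ w ∈ ({u, v} : Finset (Fin n))ᶜ, ¬ (network ω).Adj a w}
      ≤ μ 0 ^ 2 * ((1 - Λ) ^ (2 * (n - 2)) *
        (1 + n * Λ ^ 2 / (μ₀ * (1 - Λ) ^ 2) * Real.exp (n * Λ / (1 - Λ) ^ 2))) := by
  classical
  set S : Finset (Fin n) := {u, v} with hS
  set p : Fin r → ℝ := fun j => shareProb P (K 0) (K j) with hp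
  have hp0 : ∀ j, 0 ≤ p j := h.share_nonneg
  have hα0 : 0 ≤ (α : ℝ) := α.2.1
  have hα1 : (α : ℝ) ≤ 1 := α.2.2
  have hΛ0 : 0 ≤ Λ := by
    rw [hΛ]
    exact mul_nonneg hα0 (Finset.sum_nonneg fun j _ => mul_nonneg (h.μ_nonneg j) (hp0 j))
  have h1Λ : 0 < 1 - Λ := by linarith
  have h1 := h.real_no_edges (n := n) (α := α) (S := S) (T := Sᶜ) disjoint_compl_right
    (fun y => ∀ u, (y u).1 = 0) (fun _ => True)
  have h2 : {ω : Sample n r P | ((∀ a : S, (ω.1 a).1 = 0) ∧ ∀ w ∈ Sᶜ, True) ∧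
      ∀ a ∈ S, ∀ w ∈ Sᶜ, ¬ (network ω).Adj a w}
      = {ω | ((ω.1 u).1 = 0 ∧ (ω.1 v).1 = 0) ∧ ∀ a ∈ S, ∀ w ∈ Sᶜ, ¬ (network ω).Adj a w} := by
    ext ω
    simp [hS]
  rw [h2] at h1
  rw [h1]
  have hSc : S.card = 2 := Finset.card_pair huv
  have hc : Sᶜ.card = n - 2 := by rw [Finset.card_compl, Fintype.card_fin, hSc]
  set a : S := ⟨u, by simp [hS]⟩ with ha
  set b : S := ⟨v, by simp [hS]⟩ with hb
  have hab : a ≠ b := by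
    intro h'
    exact huv (congrArg Subtype.val h')
  have hprod : ∀ f : S → ℝ, ∏ x, f x = f a * f b := by
    intro f
    refine Fintype.prod_eq_mul a b hab fun x hx => ?_
    have := x.2
    simp only [hS, Finset.mem_insert, Finset.mem_singleton] at this
    rcases this with h' | h'
    · exact absurd (Subtype.ext h') hx.1
    · exact absurd (Subtype.ext h') hx.2
  set H : (S → Fin r × Finset (Fin P)) → ℝ := fun y =>
    ∑ i, μ i * avg (K i) (fun s => ∏ x, hit (y x).2 s) with hH
  have hH0 : ∀ y, 0 ≤ H y := fun y => Finset.sum_nonneg fun i _ =>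
    mul_nonneg (h.μ_nonneg i) (avg_nonneg fun s => Finset.prod_nonneg fun x _ => hit_nonneg _ _)
  set E := Real.exp (n * Λ / (1 - Λ) ^ 2) with hE
  have hmain : ∀ y : S → Fin r × Finset (Fin P), (∀ i, (y i).2.card = K (y i).1) →
      (if ∀ u, (y u).1 = 0 then (1 : ℝ) else 0) *
          (∑ i, μ i * (if True then avoid (α : ℝ) (K i) y else 0)) ^ Sᶜ.card
        ≤ (if ∀ u, (y u).1 = 0 then (1 : ℝ) else 0) * ((1 - Λ) ^ (2 * (n - 2)) *
          (1 + (n * ((α : ℝ) ^ 2 / (1 - Λ) ^ 2) * E) * H y)) := by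
    intro y hy
    split_ifs with h0
    · rw [one_mul, one_mul, hc]
      have hcard : ∀ x, (y x).2.card = K 0 := fun x => by rw [hy, h0]
      have h4 : ∑ i, μ i * avoid (α : ℝ) (K i) y = 1 - 2 * Λ + (α : ℝ) ^ 2 * H y := by
        have h5 : ∀ i, avoid (α : ℝ) (K i) y
            = 1 - 2 * ((α : ℝ) * p i) + (α : ℝ) ^ 2 * avg (K i) (fun s => ∏ x, hit (y x).2 s) := by
          intro i
          unfold avoid
          have h6 : ∀ s, ∏ x, (1 - (α : ℝ) * hit (y x).2 s)
              = ((1 - (α : ℝ) * hit (y a).2 s) - (α : ℝ) * hit (y b).2 s)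
                + (α : ℝ) ^ 2 * ∏ x, hit (y x).2 s := by
            intro s
            rw [hprod, hprod]; ring
          rw [avg_congr fun s _ => h6 s, avg_add, avg_sub, avg_sub,
            avg_const (by simpa using h.le_pool i), avg_const_mul, avg_const_mul, avg_const_mul,
            avg_hit_first h i (hcard a), avg_hit_first h i (hcard b)]
          ring
        calc _ = ∑ i, (μ i - 2 * ((α : ℝ) * (μ i * p i))
              + (α : ℝ) ^ 2 * (μ i * avg (K i) (fun s => ∏ x, hit (y x).2 s))) :=
              Finset.sum_congr rfl fun i _ => by rw [h5]; ring
          _ = _ := by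
              rw [Finset.sum_add_distrib, Finset.sum_sub_distrib, h.μ_sum, ← Finset.mul_sum,
                ← Finset.mul_sum, ← Finset.mul_sum, hΛ]
      have h40 : 0 ≤ ∑ i, μ i * avoid (α : ℝ) (K i) y :=
        Finset.sum_nonneg fun i _ => mul_nonneg (h.μ_nonneg i) (avoid_nonneg α _ y)
      have hHΛ : (α : ℝ) ^ 2 * H y ≤ Λ := by
        have h7 : H y ≤ ∑ i, μ i * p i := by
          refine Finset.sum_le_sum fun i _ => mul_le_mul_of_nonneg_left ?_ (h.μ_nonneg i)
          rw [hp]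
          dsimp only
          rw [← avg_hit_first h i (hcard a)]
          refine avg_mono fun s _ => ?_
          rw [hprod]
          exact mul_le_of_le_one_right (hit_nonneg _ _) (hit_le_one _ _)
        calc (α : ℝ) ^ 2 * H y ≤ (α : ℝ) ^ 2 * ∑ i, μ i * p i := by gcongr
          _ = α * Λ := by rw [hΛ]; ring
          _ ≤ Λ := mul_le_of_le_one_left hΛ0 hα1
      set Y : ℝ := (α : ℝ) ^ 2 * H y / (1 - Λ) ^ 2 with hY
      have hY0 : 0 ≤ Y := div_nonneg (mul_nonneg (sq_nonneg _) (hH0 y)) (sq_nonneg _)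
      -- 1 - 2Λ ≤ (1 - Λ)², and the rest is (1 - Λ)² times Y.
      have h8 : ∑ i, μ i * avoid (α : ℝ) (K i) y ≤ (1 - Λ) ^ 2 * Real.exp Y := by
        calc _ ≤ (1 - Λ) ^ 2 * (Y + 1) := by
              rw [h4, mul_add, hY, mul_div_cancel₀ _ (by positivity)]
              nlinarith
          _ ≤ _ := by gcongr; exact Real.add_one_le_exp Y
      have h9 : (n - 2 : ℕ) * Y ≤ n * Y := by
        gcongr
        omega
      have h10 : n * Y ≤ n * Λ / (1 - Λ) ^ 2 := by
        rw [hY, mul_div_assoc (n : ℝ)]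
        exact mul_le_mul_of_nonneg_left (div_le_div_of_nonneg_right hHΛ (sq_nonneg _))
          (Nat.cast_nonneg n)
      -- From e^u ≤ 1 + u e^u, with the last exponential replaced by the deterministic bound E. The
      -- result is linear in H, so only the mean of H is needed.
      have h11 : Real.exp (n * Y) ≤ 1 + n * Y * E := by
        have h12 : 1 - n * Y ≤ Real.exp (-(n * Y)) := by
          have := Real.add_one_le_exp (-(n * Y)); linarith
        have h13 : Real.exp (n * Y) * (1 - n * Y) ≤ 1 := by
          calc _ ≤ Real.exp (n * Y) * Real.exp (-(n * Y)) := by gcongr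
            _ = 1 := by rw [← Real.exp_add]; simp
        have h14 : Real.exp (n * Y) ≤ E := Real.exp_le_exp.2 h10
        have h15 : n * Y * Real.exp (n * Y) ≤ n * Y * E := by gcongr
        linarith
      calc _ ≤ ((1 - Λ) ^ 2 * Real.exp Y) ^ (n - 2) := pow_le_pow_left₀ h40 h8 _
        _ = (1 - Λ) ^ (2 * (n - 2)) * Real.exp ((n - 2 : ℕ) * Y) := by
            rw [mul_pow, ← pow_mul, Real.exp_nat_mul]
        _ ≤ (1 - Λ) ^ (2 * (n - 2)) * (1 + n * Y * E) := by
            gcongr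
            exact (Real.exp_le_exp.2 h9).trans h11
        _ = _ := by rw [hY]; ring
    · simp
  refine (sum_prod_weight_congr h.μ_nonneg hmain).trans ?_
  -- Exchange the averages: with the third ring fixed, the two first-class rings hit it
  -- independently, with probability p_i each.
  have hsumH : ∑ y : S → Fin r × Finset (Fin P), (∏ x, nodeWeight μ K P (y x)) *
      ((if ∀ u, (y u).1 = 0 then (1 : ℝ) else 0) * H y) = μ 0 ^ 2 * ∑ i, μ i * p i ^ 2 := by
    have h3 : ∀ y : S → Fin r × Finset (Fin P), (∏ x, nodeWeight μ K P (y x)) *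
        ((if ∀ u, (y u).1 = 0 then (1 : ℝ) else 0) * H y)
        = ∑ i, μ i * avg (K i) (fun s => (∏ x, nodeWeight μ K P (y x)) *
          ∏ x, (if (y x).1 = 0 then hit (y x).2 s else 0)) := by
      intro y
      rw [hH, Finset.mul_sum, Finset.mul_sum]
      refine Finset.sum_congr rfl fun i _ => ?_
      rw [avg_const_mul]
      split_ifs with h0
      · simp only [h0, if_true]; ring
      · push Not at h0
        obtain ⟨x, hx⟩ := h0
        have h4 : ∀ s, ∏ x, (if (y x).1 = 0 then hit (y x).2 s else 0) = 0 := fun s =>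
          Finset.prod_eq_zero (Finset.mem_univ x) (by rw [if_neg hx])
        simp_rw [h4]
        rw [avg_const (by simpa using h.le_pool i)]
        simp
    rw [Finset.sum_congr rfl fun y _ => h3 y, Finset.sum_comm, Finset.mul_sum]
    refine Finset.sum_congr rfl fun i _ => ?_
    rw [← Finset.mul_sum, ← avg_sum]
    have h5 : ∀ s : Finset (Fin P), s.card = K i →
        ∑ y : S → Fin r × Finset (Fin P), (∏ x, nodeWeight μ K P (y x)) *
          ∏ x, (if (y x).1 = 0 then hit (y x).2 s else 0) = (μ 0 * p i) ^ 2 := by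
      intro s hs
      have h6 := HeterogeneousKeyGraph.sum_prod_weight (ι := S) (nodeWeight μ K P)
        (fun _ a => if a.1 = 0 then hit a.2 s else 0)
      rw [h6, Finset.prod_const, Finset.card_univ, Fintype.card_coe, hSc]
      congr 1
      rw [sum_nodeWeight_mul h.μ_nonneg, Finset.sum_eq_single 0]
      · simp only [if_true]
        congr 1
        rw [avg_congr fun T _ => hit_comm T s]
        have := avg_hit s (k := K 0) (by rw [hs]; simpa using h.add_le i 0)
        rw [this, hs, Fintype.card_fin]
        exact shareProb_comm (h.add_le i 0)
      · intro j _ hj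
        simp only [hj, if_false]
        rw [avg_const (by simpa using h.le_pool j), mul_zero]
      · simp
    rw [avg_congr h5, avg_const (by simpa using h.le_pool i)]
    ring
  -- Each p_i is at most (∑ μ_j p_j)/μ₀, which bounds the sum of squares by the square of the mean.
  have hsq : (α : ℝ) ^ 2 * ∑ i, μ i * p i ^ 2 ≤ Λ ^ 2 / μ₀ := by
    rw [le_div_iff₀ hμ₀, hΛ, mul_pow, mul_assoc]
    refine mul_le_mul_of_nonneg_left ?_ (sq_nonneg _)
    rw [Finset.sum_mul, sq, Finset.sum_mul]
    refine Finset.sum_le_sum fun i _ => ?_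
    have h3 : p i * μ₀ ≤ ∑ j, μ j * p j := by
      calc p i * μ₀ ≤ μ i * p i := by rw [mul_comm]; exact mul_le_mul_of_nonneg_right (hμ i) (hp0 i)
        _ ≤ _ := Finset.single_le_sum (f := fun j => μ j * p j)
          (fun j _ => mul_nonneg (h.μ_nonneg j) (hp0 j)) (Finset.mem_univ i)
    calc μ i * p i ^ 2 * μ₀ = μ i * p i * (p i * μ₀) := by ring
      _ ≤ _ := mul_le_mul_of_nonneg_left h3 (mul_nonneg (h.μ_nonneg i) (hp0 i))
  set c := n * ((α : ℝ) ^ 2 / (1 - Λ) ^ 2) * E with hcdef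
  set B := (1 - Λ) ^ (2 * (n - 2)) with hB
  have hB0 : 0 ≤ B := by positivity
  calc _ = B * (∑ y : S → Fin r × Finset (Fin P), (∏ x, nodeWeight μ K P (y x)) *
          (if ∀ u, (y u).1 = 0 then (1 : ℝ) else 0))
        + B * c * (∑ y : S → Fin r × Finset (Fin P), (∏ x, nodeWeight μ K P (y x)) *
          ((if ∀ u, (y u).1 = 0 then (1 : ℝ) else 0) * H y)) := by
        rw [Finset.mul_sum, Finset.mul_sum, ← Finset.sum_add_distrib]
        exact Finset.sum_congr rfl fun y _ => by ring
    _ = μ 0 ^ 2 * (B * (1 + n / (1 - Λ) ^ 2 * E * ((α : ℝ) ^ 2 * ∑ i, μ i * p i ^ 2))) := by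
        rw [h.sum_first_class, hsumH, Fintype.card_coe, hSc, hcdef]
        ring
    _ ≤ μ 0 ^ 2 * (B * (1 + n / (1 - Λ) ^ 2 * E * (Λ ^ 2 / μ₀))) := by gcongr
    _ = _ := by
        congr 3
        field_simp

end Isolated

section NoIsolated

variable {n r P : ℕ} {μ : Fin r → ℝ} {K : Fin r → ℕ} {α : unitInterval} [NeZero r]

theorem Admissible.real_no_isolated_le (h : Admissible μ K P) {μ₀ Λ : ℝ} (hμ₀ : 0 < μ₀)
    (hμ : ∀ i, μ₀ ≤ μ i) (hΛ : Λ = (α : ℝ) * ∑ j, μ j * shareProb P (K 0) (K j)) (hΛ1 : Λ < 1)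
    (hn : 2 ≤ n) :
    (modelMeasure n μ K P α).real {ω | ∀ v, ¬ (network ω).IsIsolated v}
      ≤ 1 / (n * (μ 0 * (1 - Λ) ^ (n - 1))) + (((1 - Λ) ^ 2)⁻¹ *
        (1 + n * Λ ^ 2 * ((1 - Λ) ^ 2)⁻¹ / μ₀ * Real.exp (n * Λ * ((1 - Λ) ^ 2)⁻¹)) - 1) := by
  have := h.isProbabilityMeasure (n := n) (α := α)
  have hμ0 : 0 < μ 0 := hμ₀.trans_le (hμ 0)
  have h1Λ : 0 < 1 - Λ := by linarith
  set I : Fin n → Set (Sample n r P) := fun v =>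
    {ω | (ω.1 v).1 = 0 ∧ ∀ w ∈ ({v} : Finset (Fin n))ᶜ, ¬ (network ω).Adj v w} with hI
  have h1 := real_iInter_compl_le (M := modelMeasure n μ K P α) (n := n) (by omega) (I := I)
    (fun v => MeasurableSet.of_discrete) (a := μ 0 * (1 - Λ) ^ (n - 1))
    (b := μ 0 ^ 2 * ((1 - Λ) ^ (2 * (n - 2)) *
        (1 + n * Λ ^ 2 / (μ₀ * (1 - Λ) ^ 2) * Real.exp (n * Λ / (1 - Λ) ^ 2))))
    (by positivity) (by positivity) (fun v => by rw [hΛ]; exact h.real_isolated v)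
    (fun u v huv => by
      refine (measureReal_mono ?_).trans (h.real_two_isolated_le hμ₀ hμ hΛ hΛ1 huv)
      rintro ω ⟨⟨hu, hu'⟩, hv, hv'⟩
      refine ⟨⟨hu, hv⟩, fun a ha w hw => ?_⟩
      simp only [Finset.mem_insert, Finset.mem_singleton, Finset.mem_compl, not_or] at ha hw
      rcases ha with rfl | rfl
      · exact hu' w (by simpa using hw.1)
      · exact hv' w (by simpa using hw.2))
  refine (measureReal_mono ?_).trans (h1.trans (le_of_eq ?_))
  · intro ω hω
    refine Set.mem_iInter.2 fun v hv => hω v fun w hw => hv.2 w ?_ hw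
    simpa using hw.ne'
  · congr 2
    obtain ⟨m, rfl⟩ := Nat.exists_eq_add_of_le' hn
    have e1 : 2 * (m + 2 - 2) = 2 * m := by omega
    have e2 : m + 2 - 1 = m + 1 := by omega
    rw [e1, e2]
    field_simp
    ring

end NoIsolated

/-! ### Asymptotics below the threshold -/

section ZeroLaw

variable {r : ℕ} [NeZero r] {μ : Fin r → ℝ} {Θ : Scaling r} {μ₀ c : ℝ}

/-- log(1 - Λ) ≥ 1 - 1/(1 - Λ) ≥ -Λ/(1 - Λ)². The weaker square matches the correction factor in the
two-node bound, so one quantity X → 1 controls both. -/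
theorem one_sub_inv_sq_mul_le {Λ : ℝ} (h0 : 0 ≤ Λ) (h1 : Λ < 1) (n : ℕ) :
    Real.exp (-(n * Λ * ((1 - Λ) ^ 2)⁻¹)) ≤ (1 - Λ) ^ (n - 1) := by
  have h2 : 0 < 1 - Λ := by linarith
  have h3 : Real.exp (-(Λ * ((1 - Λ) ^ 2)⁻¹)) ≤ 1 - Λ := by
    have h4 := Real.one_sub_inv_le_log_of_pos h2
    rw [← Real.le_log_iff_exp_le h2]
    refine le_trans ?_ h4
    rw [neg_le_sub_iff_le_add]
    have h5 : (1 - Λ)⁻¹ = 1 + Λ * (1 - Λ)⁻¹ := by field_simp; ring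
    have h6 : (1 - Λ)⁻¹ ≤ ((1 - Λ) ^ 2)⁻¹ := by
      apply inv_anti₀ (by positivity)
      nlinarith
    nlinarith
  calc _ = Real.exp (-(Λ * ((1 - Λ) ^ 2)⁻¹)) ^ n := by
        rw [← Real.exp_nat_mul]; congr 1; ring
    _ ≤ (1 - Λ) ^ n := pow_le_pow_left₀ (Real.exp_pos _).le h3 _
    _ ≤ _ := pow_le_pow_of_le_one h2.le (by linarith) (Nat.sub_le _ _)

/-- Below the threshold some node of the first class is isolated with high probability. -/
theorem tendsto_no_isolated (hμ₀ : 0 < μ₀) (hμ : ∀ i, μ₀ ≤ μ i)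
    (hadm : ∀ᶠ n in atTop, Admissible μ (Θ.K n) (Θ.P n))
    (hΛ : Tendsto (fun n => Θ.meanEdge μ n 0) atTop (𝓝 0))
    (hhi : ∀ᶠ n : ℕ in atTop, Θ.meanEdge μ n 0 ≤ c * (Real.log n / n)) (hc0 : 0 < c) (hc : c < 1) :
    Tendsto (fun n => Θ.prob μ n (fun G => ∀ v, ¬ G.IsIsolated v)) atTop (𝓝 0) := by
  -- The gap between c and c' absorbs X, so nΛX ≤ c' log n. Both error terms are then governed by
  -- n^(-(1-c')/2).
  obtain ⟨c', hcc', hc'⟩ := exists_between hc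
  set X : ℕ → ℝ := fun n => ((1 - Θ.meanEdge μ n 0) ^ 2)⁻¹ with hX
  have hXlim : Tendsto X atTop (𝓝 1) := by
    have := ((hΛ.const_sub 1).pow 2).inv₀ (by norm_num)
    simpa using this
  set e : ℕ → ℝ := fun n => Real.exp (-((1 - c') / 2 * Real.log n)) with he
  have helim : Tendsto e atTop (𝓝 0) := by
    refine Real.tendsto_exp_atBot.comp (tendsto_neg_atTop_atBot.comp ?_)
    exact tendsto_log_nat.const_mul_atTop (by linarith)
  have hlim : Tendsto (fun n => e n / μ 0 + (X n * (1 + X n / μ₀ * e n) - 1)) atTop (𝓝 0) := by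
    have := (helim.div_const (μ 0)).add
      ((hXlim.mul (((hXlim.div_const μ₀).mul helim).const_add 1)).sub_const 1)
    simpa using this
  refine squeeze_zero' (Eventually.of_forall fun n => measureReal_nonneg) ?_ hlim
  have hX1 : ∀ᶠ n in atTop, X n ≤ c' / c :=
    hXlim.eventually_le_const (by rwa [one_lt_div hc0])
  filter_upwards [hadm, hhi, hX1, hΛ.eventually_lt_const one_pos, eventually_ge_atTop 2,
    eventually_mul_log_le_exp 1 (a := (1 - c') / 4) (by linarith)] with n h hhi hX1 hΛ1 hn hlog
  set Λ := Θ.meanEdge μ n 0 with hΛdef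
  have hΛ0 : 0 ≤ Λ := h.meanEdge_nonneg
  have hn0 : (0 : ℝ) < n := by exact_mod_cast (by omega : 0 < n)
  have hμ0 : 0 < μ 0 := hμ₀.trans_le (hμ 0)
  have hX0 : 0 < X n := by
    have : 0 < 1 - Λ := by linarith
    simp only [hX]; positivity
  set L := Real.log n with hL
  have hL0 : 0 ≤ L := Real.log_natCast_nonneg n
  have hnexp : (n : ℝ) = Real.exp L := (Real.exp_log hn0).symm
  have hnΛ : n * Λ ≤ c * L := by
    calc n * Λ ≤ n * (c * (L / n)) := by gcongr
      _ = c * L := by field_simp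
  have hB : n * Λ * X n ≤ c' * L := by
    calc n * Λ * X n ≤ c * L * (c' / c) := by gcongr
      _ = c' * L := by field_simp
  have h1 := h.real_no_isolated_le (n := n) (α := Θ.α n) hμ₀ hμ (Λ := Λ) rfl hΛ1 hn
  refine h1.trans ?_
  have hfirst : 1 / (n * (μ 0 * (1 - Λ) ^ (n - 1))) ≤ e n / μ 0 := by
    have h2 : Real.exp ((1 - c') / 2 * L) ≤ n * (1 - Λ) ^ (n - 1) := by
      calc _ ≤ Real.exp (L + -(c' * L)) := Real.exp_le_exp.2 (by nlinarith)
        _ = n * Real.exp (-(c' * L)) := by rw [Real.exp_add, ← hnexp]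
        _ ≤ n * Real.exp (-(n * Λ * X n)) := by gcongr
        _ ≤ _ := by gcongr; exact one_sub_inv_sq_mul_le hΛ0 hΛ1 n
    calc _ = 1 / (n * (1 - Λ) ^ (n - 1)) / μ 0 := by
          rw [div_div]; congr 1; ring
      _ ≤ 1 / Real.exp ((1 - c') / 2 * L) / μ 0 := by gcongr
      _ = _ := by rw [one_div, ← Real.exp_neg]
  -- The left side is at most (log n)² n^(c'-1), and half of the exponent 1 - c' absorbs the
  -- logarithms.
  have hsecond : n * Λ ^ 2 * Real.exp (n * Λ * X n) ≤ e n := by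
    have h2 : (n * Λ) ^ 2 ≤ Real.exp ((1 - c') / 2 * L) := by
      calc (n * Λ) ^ 2 ≤ L ^ 2 := by
            refine pow_le_pow_left₀ (by positivity) ?_ 2
            nlinarith
        _ ≤ Real.exp ((1 - c') / 4 * L) ^ 2 := pow_le_pow_left₀ hL0 (by linarith) 2
        _ = _ := by rw [← Real.exp_nat_mul]; congr 1; push_cast; ring
    calc _ = (n * Λ) ^ 2 * (Real.exp (n * Λ * X n) * (n : ℝ)⁻¹) := by field_simp
      _ ≤ Real.exp ((1 - c') / 2 * L) * (Real.exp (c' * L) * Real.exp (-L)) := by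
          rw [Real.exp_neg, ← hnexp]
          gcongr
      _ = _ := by
          rw [← Real.exp_add, ← Real.exp_add]
          simp only [he]
          congr 1
          ring
  refine add_le_add hfirst (sub_le_sub_right (mul_le_mul_of_nonneg_left ?_ hX0.le) 1)
  refine add_le_add_right ?_ 1
  calc _ = X n / μ₀ * (n * Λ ^ 2 * Real.exp (n * Λ * X n)) := by
        simp only [hX]; ring
    _ ≤ _ := by gcongr

end ZeroLaw

/-! ### Growth of the smallest ring and the conclusion -/

section Main

variable {r : ℕ} [NeZero r] {μ : Fin r → ℝ} {Θ : Scaling r}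

theorem Scaling.admissible (Θ : Scaling r) (hμ : ∀ i, 0 ≤ μ i) (hμ1 : ∑ i, μ i = 1) {n : ℕ}
    (hn : 2 ≤ n) : Admissible μ (Θ.K n) (Θ.P n) where
  μ_nonneg := hμ
  μ_sum := hμ1
  K_zero_le i := Θ.K_mono n hn (Fin.zero_le i)
  K_pos := Θ.one_le_K n hn
  add_le i j := by
    have h1 := Θ.K_le n hn i
    have h2 := Θ.K_le n hn j
    exact_mod_cast (by linarith : (Θ.K n i : ℝ) + Θ.K n j ≤ Θ.P n)

/-- 1/n ≤ 1/(nα) = o(p_11) and p_11 ≤ K²/P ≤ K²/(σn) with K the smallest ring size, so K² must be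
unbounded. The choice ε = σ/(b + 1)² gives K ≥ b + 1. -/
theorem tendsto_smallest_ring {σ : ℝ} (hσ : 0 < σ)
    (hP : ∀ n : ℕ, 1 ≤ n → σ * (n : ℝ) ≤ (Θ.P n : ℝ))
    (hp : (fun n : ℕ => 1 / ((n : ℝ) * (Θ.α n : ℝ))) =o[atTop] (fun n : ℕ => Θ.p n 0 0)) :
    Tendsto (fun n => Θ.K n 0) atTop atTop := by
  refine tendsto_atTop.2 fun b => ?_
  have hε : 0 < σ / (b + 1 : ℝ) ^ 2 := by positivity
  filter_upwards [hp.bound hε, eventually_ge_atTop 2] with n h hn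
  have hn0 : (0 : ℝ) < n := by exact_mod_cast (by omega : 0 < n)
  have hα := Θ.α_pos n
  have hPn := hP n (by omega)
  have hP0 : (0 : ℝ) < Θ.P n := by nlinarith [mul_pos hσ hn0]
  have hadd : Θ.K n 0 + Θ.K n 0 ≤ Θ.P n := by
    have h1 := Θ.K_le n hn 0
    exact_mod_cast (by linarith : (Θ.K n 0 : ℝ) + Θ.K n 0 ≤ Θ.P n)
  have h0 : 0 ≤ Θ.p n 0 0 := shareProb_nonneg hadd
  rw [Real.norm_of_nonneg (by positivity), Real.norm_of_nonneg h0] at h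
  have h1 : 1 / (n : ℝ) ≤ 1 / ((n : ℝ) * Θ.α n) := by
    apply one_div_le_one_div_of_le (by positivity)
    exact mul_le_of_le_one_right hn0.le (Θ.α_lt_one n).le
  have h2 : Θ.p n 0 0 ≤ (Θ.K n 0 : ℝ) ^ 2 / (σ * n) := by
    calc Θ.p n 0 0 ≤ (Θ.K n 0 * Θ.K n 0 : ℝ) / Θ.P n := shareProb_le hadd
      _ ≤ _ := by rw [← sq]; gcongr
  have h3 : 1 / (n : ℝ) ≤ σ / (b + 1 : ℝ) ^ 2 * ((Θ.K n 0 : ℝ) ^ 2 / (σ * n)) :=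
    h1.trans (h.trans (by gcongr))
  have h4 : σ / (b + 1 : ℝ) ^ 2 * ((Θ.K n 0 : ℝ) ^ 2 / (σ * n))
      = (1 / n) * ((Θ.K n 0 : ℝ) ^ 2 / (b + 1 : ℝ) ^ 2) := by field_simp
  rw [h4] at h3
  have h5 : 1 ≤ (Θ.K n 0 : ℝ) ^ 2 / (b + 1 : ℝ) ^ 2 :=
    le_of_mul_le_mul_left (by simpa using h3) (by positivity : (0 : ℝ) < 1 / n)
  rw [one_le_div (by positivity)] at h5
  have h6 : (b + 1 : ℝ) ≤ Θ.K n 0 := le_of_sq_le_sq h5 (by positivity)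
  have h7 : b + 1 ≤ Θ.K n 0 := by exact_mod_cast h6
  omega

theorem tendsto_log_div_nat : Tendsto (fun n : ℕ => Real.log n / n) atTop (𝓝 0) :=
  Real.isLittleO_log_id_atTop.tendsto_div_nhds_zero.comp tendsto_natCast_atTop_atTop

theorem eventually_log_div_pos : ∀ᶠ n : ℕ in atTop, 0 < Real.log n / n := by
  filter_upwards [eventually_ge_atTop 2] with n hn
  have h2 : (1 : ℝ) < n := by exact_mod_cast hn
  exact div_pos (Real.log_pos h2) (by linarith)

theorem connected_no_isolated {n : ℕ} (hn : 2 ≤ n) {G : SimpleGraph (Fin n)} (hG : G.Connected)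
    (v : Fin n) : ¬ G.IsIsolated v := by
  have : Nontrivial (Fin n) := Fin.nontrivial_iff_two_le.2 hn
  exact hG.preconnected.not_isIsolated v

end Main

end HeterogeneousKeyGraph

end

open HeterogeneousKeyGraph

theorem theorem2 (r : ℕ) [NeZero r] (μ : Fin r → ℝ) (hμ_pos : ∀ i, 0 < μ i)
    (hμ_sum : ∑ i, μ i = 1) (Θ : HeterogeneousKeyGraph.Scaling r) (c : ℝ) (hc : 0 < c)
    (hΛ : (fun n : ℕ => Θ.meanEdge μ n 0) ~[atTop] (fun n : ℕ => c * (Real.log n / n)))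
    (σ : ℝ) (hσ : 0 < σ) (hP : ∀ n : ℕ, 1 ≤ n → σ * (n : ℝ) ≤ (Θ.P n : ℝ))
    (hp : (fun n : ℕ => 1 / ((n : ℝ) * (Θ.α n : ℝ))) =o[atTop] (fun n : ℕ => Θ.p n 0 0)) :
    (c < 1 →
      Tendsto (fun n : ℕ => Θ.prob μ n (fun G => G.Connected)) atTop (𝓝 0) ∧
      Tendsto (fun n : ℕ => Θ.prob μ n (fun G => ∀ v, ¬ G.IsIsolated v)) atTop (𝓝 0)) ∧
    (1 < c →
      Tendsto (fun n : ℕ => Θ.prob μ n (fun G => G.Connected)) atTop (𝓝 1) ∧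
      Tendsto (fun n : ℕ => Θ.prob μ n (fun G => ∀ v, ¬ G.IsIsolated v)) atTop (𝓝 1)) := by
  -- The smallest class probability serves as the uniform lower bound μ₀.
  obtain ⟨i₀, hi₀⟩ := Finite.exists_min μ
  have hadm : ∀ᶠ n in atTop, Admissible μ (Θ.K n) (Θ.P n) := by
    filter_upwards [eventually_ge_atTop 2] with n hn
    exact Θ.admissible (fun i => (hμ_pos i).le) hμ_sum hn
  have hratio : Tendsto (fun n : ℕ => Θ.meanEdge μ n 0 / (Real.log n / n)) atTop (𝓝 c) := by
    have h1 : ∀ᶠ n : ℕ in atTop, c * (Real.log n / n) ≠ 0 := by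
      filter_upwards [eventually_log_div_pos] with n hn
      positivity
    have h2 := ((isEquivalent_iff_tendsto_one h1).1 hΛ).const_mul c
    rw [mul_one] at h2
    refine h2.congr' ?_
    filter_upwards with n
    simp only [Pi.div_apply]
    rw [mul_div_assoc', mul_div_mul_left _ _ hc.ne']
  have hhi : ∀ c₂, c < c₂ → ∀ᶠ n : ℕ in atTop, Θ.meanEdge μ n 0 ≤ c₂ * (Real.log n / n) := by
    intro c₂ h2
    filter_upwards [hratio.eventually_le_const h2, eventually_log_div_pos] with n h3 h4
    exact (div_le_iff₀ h4).1 h3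
  have hlo : ∀ c₁, c₁ < c → ∀ᶠ n : ℕ in atTop, c₁ * (Real.log n / n) ≤ Θ.meanEdge μ n 0 := by
    intro c₁ h2
    filter_upwards [hratio.eventually_const_le h2, eventually_log_div_pos] with n h3 h4
    exact (le_div_iff₀ h4).1 h3
  -- This comparison transfers the limit 0 from no isolated node to connectivity, and the limit 1 in
  -- the other direction.
  have hle : ∀ᶠ n : ℕ in atTop, Θ.prob μ n (fun G => G.Connected)
      ≤ Θ.prob μ n (fun G => ∀ v, ¬ G.IsIsolated v) := by
    filter_upwards [hadm, eventually_ge_atTop 2] with n h hn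
    have := h.isProbabilityMeasure (n := n) (α := Θ.α n)
    exact measureReal_mono fun ω hω => connected_no_isolated hn hω
  refine ⟨fun hc1 => ?_, fun hc1 => ?_⟩
  · obtain ⟨c₂, h2, h3⟩ := exists_between hc1
    have hΛ0 : Tendsto (fun n => Θ.meanEdge μ n 0) atTop (𝓝 0) := by
      refine hΛ.symm.tendsto_nhds ?_
      simpa using tendsto_log_div_nat.const_mul c
    have h4 := tendsto_no_isolated (hμ_pos i₀) hi₀ hadm hΛ0 (hhi c₂ h2) (hc.trans h2) h3
    exact ⟨squeeze_zero' (Eventually.of_forall fun n => measureReal_nonneg) hle h4, h4⟩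
  · obtain ⟨c₁, h2, h3⟩ := exists_between hc1
    have h4 := tendsto_not_connected (hμ_pos i₀) hi₀ hadm (hlo c₁ h3) (hhi (c + 1) (by linarith))
      (tendsto_smallest_ring hσ hP hp) h2 (by linarith)
    have h5 : Tendsto (fun n : ℕ => Θ.prob μ n (fun G => G.Connected)) atTop (𝓝 1) := by
      have h6 := h4.const_sub 1
      rw [sub_zero] at h6
      refine h6.congr' ?_
      filter_upwards [hadm] with n h
      have := h.isProbabilityMeasure (n := n) (α := Θ.α n)
      have h7 := probReal_compl_eq_one_sub (μ := modelMeasure n μ (Θ.K n) (Θ.P n) (Θ.α n))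
        (s := {ω | (network ω).Connected}) MeasurableSet.of_discrete
      have h8 : Θ.prob μ n (fun G => ¬ G.Connected)
          = 1 - Θ.prob μ n (fun G => G.Connected) := h7
      rw [h8]
      ring
    refine ⟨h5, tendsto_of_tendsto_of_tendsto_of_le_of_le' h5 tendsto_const_nhds hle ?_⟩
    filter_upwards [hadm] with n h
    have := h.isProbabilityMeasure (n := n) (α := Θ.α n)
    exact measureReal_le_one
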